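/- **Theorem 3.1.** Fix a homogeneous Littlewood–Paley decomposition on $\mathbb{R}^n$: $\widehat{\varphi_0}\in C_c^\infty(\mathbb{R}^n)$ with $0\le\widehat{\varphi_0}\le 1$, $\operatorname{supp}\widehat{\varphi_0}\subset\{2^{-1}\le|\xi|\le 2\}$, $\sum_{j\in\mathbb{Z}}\widehat{\varphi_0}(2^{-j}\xi)=1$ for $\xi\ne0$, and $\Delta_jf=\mathscr{F}^{-1}[\widehat{\varphi_0}(2^{-j}\cdot)\widehat f\,]$. For $s\in\mathbb{R}$, $1\le p,q\le\infty$ and an interval $I$, put $$\|f\|_{\dot B^s_{p,q}}=\Big\|\big\{2^{sj}\|\Delta_jf\|_{L^p}\big\}_{j\in\mathbb{Z}}\Big\|_{\ell^q},\qquad \|f\|_{\widetilde{L^\infty}(I;\dot B^s_{p,q})}=\Big\|\big\{2^{sj}\|\Delta_jf\|_{L^\infty(I;L^p)}\big\}_{j\in\mathbb{Z}}\Big\|_{\ell^q}$$ (for tempered distributions modulo polynomials), and $\widetilde C(I;\dot B^s_{p,q})=C(I;\dot B^s_{p,q})\cap\widetilde{L^\infty}(I;\dot B^s_{p,q})$.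 Consider the forced Navier–Stokes equations $$\partial_tu-\Delta u+\mathbb{P}\operatorname{div}(u\otimes u)=\mathbb{P}f,\qquad \operatorname{div}u=0,\qquad u(0)=0\qquad\text{on }(0,\infty)\times\mathbb{R}^n,\tag{NS}$$ with $\mathbb{P}=I+\nabla\operatorname{div}(-\Delta)^{-1}$. A *global solution* of (NS) is a divergence-free real vector field $u$ with $\sup_{t\ge0}\|u(t)\|_{L^{n,\infty}}<\infty$ (so that $u\otimes u$ is well defined when $n\ge 3$) satisfying $$u(t)=\int_0^te^{(t-\tau)\Delta}\mathbb{P}\big(f(\tau)-\operatorname{div}(u\otimes u)(\tau)\big)\,d\tau\qquad(t\ge0)$$ in the sense of distributions modulo polynomials; here $\|g\|_{L^{n,\infty}}=\sup_{0<|A|<\infty}|A|^{-(1-1/n)}\int_A|g|\,dx$. Let $n$, $r$, $\sigma$ satisfy either 1. $n\ge3$, $n<r<2n$, $1\le\sigma<\infty$, or 2. $n\ge3$, $r=n$, $2<\sigma<\infty$. Then there exist positive constants $\varepsilon_0=\varepsilon_0(n,r,\sigma)$ and $c_0=c_0(n,r,\sigma)$ (for the fixed $\varphi_0$) such that for every $0<\varepsilon\le\varepsilon_0$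 there exists a real external force $f_\varepsilon\in\widetilde C((0,\infty);\dot B^{n/r-3}_{r,\sigma}(\mathbb{R}^n))$ with $$\|f_\varepsilon\|_{\widetilde{L^\infty}(0,\infty;\dot B^{n/r-3}_{r,\sigma})}\le\varepsilon,\qquad \lim_{t\to\infty}\|f_\varepsilon(t)\|_{\dot B^{n/r-3}_{r,\sigma}}=0,$$ and such that (NS) with $f=f_\varepsilon$ admits a global solution $u_\varepsilon\in\widetilde C([0,\infty);\dot B^{n/r-1}_{r,\sigma}(\mathbb{R}^n))$ satisfying $$\limsup_{t\to\infty}\|u_\varepsilon(t)\|_{\dot B^{-1}_{\infty,\infty}}\ge c_0,\qquad \liminf_{t\to\infty}\|u_\varepsilon(t)\|_{\dot B^{n/r-1}_{r,\sigma}}=0.$$ -/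

import Mathlib

open MeasureTheory Filter Topology Set
open scoped ENNReal SchwartzMap LineDeriv ContDiff

noncomputable section

namespace ForcedNS

/-- The Euclidean space `ℝⁿ`: physical space, frequency space and values of real vector fields. -/
abbrev Rn (n : ℕ) : Type := EuclideanSpace ℝ (Fin n)

/-- Values of complex vector fields. -/
abbrev Cn (n : ℕ) : Type := EuclideanSpace ℂ (Fin n)

/-- Vector-valued tempered distributions on `ℝⁿ`. An element of the quotient of `𝓢'` by the
polynomials is handled through a representative: the Littlewood--Paley blocks, hence all the norms
below, see only the class modulo polynomials. -/
abbrev Dist (n : ℕ) : Type := 𝓢'(Rn n, Cn n)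

variable {n : ℕ}

/-- The distribution is real: it takes real values on real test functions. -/
def IsRealDist (T : Dist n) : Prop :=
  ∀ φ : 𝓢(Rn n, ℂ), (∀ x, (φ x).im = 0) → ∀ k, (T φ k).im = 0

/-- `T` is the distribution `φ ↦ ∫ φ g` given by the (measurable) function `g`. -/
def IsGivenBy (T : Dist n) (g : Rn n → Cn n) : Prop :=
  AEStronglyMeasurable g volume ∧
    ∀ φ : 𝓢(Rn n, ℂ), Integrable (fun x => φ x • g x) ∧ T φ = ∫ x, φ x • g x

/-- The `L^p` norm of a distribution; it is `∞` if the distribution is not an `L^p` function. -/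
def lpNorm (p : ℝ≥0∞) (T : Dist n) : ℝ≥0∞ :=
  ⨅ (g : Rn n → Cn n) (_ : IsGivenBy T g), eLpNorm g p volume

/-- The Fourier multiplier `m(D)`, where `m` is a function of the angular frequency, i.e.
`m(D) e^{i x·ξ} = m(ξ) e^{i x·ξ}` (Mathlib's Fourier transform uses `e^{2π i x·ξ}`). -/
def mult (m : Rn n → ℝ) (T : Dist n) : Dist n :=
  TemperedDistribution.fourierMultiplierCLM (Cn n)
    (fun ξ => ((m ((2 * Real.pi) • ξ) : ℝ) : ℂ)) T

/-- `χ` (the Fourier transform of `φ₀`) generates a homogeneous Littlewood--Paley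
decomposition of unity. -/
structure IsLittlewoodPaley (χ : Rn n → ℝ) : Prop where
  smooth : ContDiff ℝ ∞ χ
  supp : Function.support χ ⊆ {ξ | 2⁻¹ ≤ ‖ξ‖ ∧ ‖ξ‖ ≤ 2}
  nonneg : ∀ ξ, 0 ≤ χ ξ
  le_one : ∀ ξ, χ ξ ≤ 1
  sum_eq_one : ∀ ξ, ξ ≠ 0 → HasSum (fun j : ℤ => χ ((2 : ℝ) ^ (-j) • ξ)) 1

/-- The symbol of the `j`-th Littlewood--Paley block. -/
def blockSymbol (χ : Rn n → ℝ) (j : ℤ) (ξ : Rn n) : ℝ := χ ((2 : ℝ) ^ (-j) • ξ)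

/-- The `j`-th Littlewood--Paley block `Δ_j T`. -/
def block (χ : Rn n → ℝ) (j : ℤ) (T : Dist n) : Dist n := mult (blockSymbol χ j) T

/-- The homogeneous Besov norm `‖T‖_{Ḃ^s_{p,q}}`. -/
def besovNorm (χ : Rn n → ℝ) (s : ℝ) (p q : ℝ≥0∞) (T : Dist n) : ℝ≥0∞ :=
  eLpNorm (fun j : ℤ => (2 : ℝ≥0∞) ^ (s * (j : ℝ)) * lpNorm p (block χ j T)) q Measure.count

/-- The Chemin--Lerner norm of `L̃^ρ(I; Ḃ^s_{p,q})`: the time norm is taken in each block. -/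
def cheminLernerNorm (χ : Rn n → ℝ) (ρ : ℝ≥0∞) (I : Set ℝ) (s : ℝ) (p q : ℝ≥0∞)
    (f : ℝ → Dist n) : ℝ≥0∞ :=
  eLpNorm (fun j : ℤ => (2 : ℝ≥0∞) ^ (s * (j : ℝ)) *
    eLpNorm (fun t => lpNorm p (block χ j (f t))) ρ (volume.restrict I)) q Measure.count

/-- `f ∈ C̃(I; Ḃ^s_{p,q}) = C(I; Ḃ^s_{p,q}) ∩ L̃^∞(I; Ḃ^s_{p,q})`. -/
structure MemCTilde (χ : Rn n → ℝ) (I : Set ℝ) (s : ℝ) (p q : ℝ≥0∞) (f : ℝ → Dist n) :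
    Prop where
  mem : ∀ t ∈ I, besovNorm χ s p q (f t) < ⊤
  cont : ∀ t₀ ∈ I, Tendsto (fun t => besovNorm χ s p q (f t - f t₀)) (𝓝[I] t₀) (𝓝 0)
  bound : cheminLernerNorm χ ⊤ I s p q f < ⊤

/-- The weak Lebesgue norm `‖g‖_{L^{p,∞}} = sup_A |A|^{-(1-1/p)} ∫_A |g|`. -/
def weakLpNorm (p : ℝ) (g : Rn n → Rn n) : ℝ≥0∞ :=
  ⨆ (A : Set (Rn n)) (_ : MeasurableSet A) (_ : 0 < volume A) (_ : volume A < ⊤),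
    (∫⁻ x in A, ‖g x‖ₑ) / (volume A) ^ (1 - 1 / p)

/-- The unit vector along the `l`-th axis. -/
def axis (l : Fin n) : Rn n := EuclideanSpace.single l 1

/-- A real vector field, viewed as a complex one. -/
def toComplex (v : Rn n) : Cn n := WithLp.toLp 2 (fun k => ((v k : ℝ) : ℂ))

/-- `div T = 0` in the sense of distributions. -/
def IsSolenoidal (T : Dist n) : Prop :=
  ∀ φ : 𝓢(Rn n, ℂ), ∑ k, T (∂_{axis k} φ) k = 0

/-- `N = div (v ⊗ v)` in the sense of distributions, i.e. `N_k = ∑_l ∂_l (v_k v_l)`. -/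
def IsDivTensor (N : Dist n) (v : Rn n → Rn n) : Prop :=
  ∀ (φ : 𝓢(Rn n, ℂ)) (k : Fin n),
    (∀ l, Integrable (fun x => ((v x k * v x l : ℝ) : ℂ) * φ x)) ∧
    N φ k = - ∑ l, ∫ x, ((v x k * v x l : ℝ) : ℂ) * (∂_{axis l} φ) x

/-- The symbol of the block of the heat semigroup, `Δ_j e^{tΔ}`. -/
def heatSymbol (χ : Rn n → ℝ) (j : ℤ) (t : ℝ) (ξ : Rn n) : ℝ :=
  blockSymbol χ j ξ * Real.exp (-t * ‖ξ‖ ^ 2)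

/-- The `(k,l)` entry of the symbol of `Δ_j e^{tΔ} ℙ`, with `ℙ = I + ∇ div (-Δ)^{-1}` the
Helmholtz projection. It is smooth, since the block vanishes near the origin. -/
def lerayHeatSymbol (χ : Rn n → ℝ) (j : ℤ) (t : ℝ) (k l : Fin n) (ξ : Rn n) : ℝ :=
  heatSymbol χ j t ξ * ((if k = l then 1 else 0) - ξ k * ξ l / ‖ξ‖ ^ 2)

/-- The pairing `⟨Δ_j e^{tΔ} ℙ G, φ⟩`. -/
def lerayHeat (χ : Rn n → ℝ) (j : ℤ) (t : ℝ) (G : Dist n) (φ : 𝓢(Rn n, ℂ)) : Cn n :=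
  WithLp.toLp 2 (fun k => ∑ l, mult (lerayHeatSymbol χ j t k l) G φ l)

/-- `u` is a global mild solution of
`∂_t u - Δu + ℙ div (u ⊗ u) = ℙ f`, `div u = 0`, `u(0) = a`: it is given by a real vector field
`v`, bounded in time with values in `L^{n,∞}` (so that `u ⊗ u` makes sense when `n ≥ 3`),
and it satisfies
`u(t) = e^{tΔ} a + ∫₀ᵗ e^{(t-τ)Δ} ℙ (f(τ) - div (u ⊗ u)(τ)) dτ` for all `t ≥ 0`.
The identity is understood modulo polynomials, that is, block by block; the time integral is
taken in the sense of distributions. -/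
def IsMildSolution (χ : Rn n → ℝ) (a : Dist n) (f u : ℝ → Dist n) : Prop :=
  ∃ (v : ℝ → Rn n → Rn n) (N : ℝ → Dist n),
    (∀ t, 0 ≤ t → IsGivenBy (u t) (fun x => toComplex (v t x))) ∧
    (⨆ (t : ℝ) (_ : 0 ≤ t), weakLpNorm (n : ℝ) (v t)) < ⊤ ∧
    (∀ t, 0 ≤ t → IsSolenoidal (u t)) ∧
    (∀ t, 0 ≤ t → IsDivTensor (N t) (v t)) ∧
    ∀ t, 0 ≤ t → ∀ (j : ℤ) (φ : 𝓢(Rn n, ℂ)),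
      IntervalIntegrable (fun τ => lerayHeat χ j (t - τ) (f τ - N τ) φ) volume 0 t ∧
      block χ j (u t) φ = mult (heatSymbol χ j t) a φ +
        ∫ τ in (0 : ℝ)..t, lerayHeat χ j (t - τ) (f τ - N τ) φ

end ForcedNS

end

/-! The construction is an exact cancellation of convex-integration type. Fix a solenoidal,
band-limited field `U` and a time bump `θ` supported in the unit interval. The force that produces
`θ U` alone, `θ' U - θ ΔU + θ² div (U ⊗ U)`, is not small. If `U` is chosen as a Laplacian, this
force is the divergence of a symmetric tensor; modulo multiples of the identity, whose divergence is
a gradient and is removed by `ℙ`, it equals `-div ∑ c² q² d ⊗ d` with constant vectors `d`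
(`ConeRep.tensor`, `exists_profile`). A high-frequency solenoidal wave of amplitude `√2 c q d` has
mean stress `c² q² d ⊗ d`. Adding such waves to `θ U` lets the nonlinearity itself drive the
low-frequency profile.

By `Profile.tensor_eq` and `Profile.force_expand` the remaining force consists of terms linear in
the waves, of interactions at frequencies at least of order `2 ^ M`, and of corrector
self-interactions carrying the square of an inverse frequency. In the norm of order `n/r - 3` the
last two gain `2 ^ (-M)`, since each is a divergence (`Profile.force_bound`). The linear terms have
the size of the waves in the norm of order `n/r - 1`. If `n < r`, this order is negative and high
frequency alone makes them small. If `r = n`, the norm is scale invariant; each wave is then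
replaced by `K` waves at lacunary frequencies with amplitude factor `√(2/K)`. The mean stress, an
`ℓ²` quantity, is unchanged, while the `ℓ^σ` norm over blocks is of order `K ^ (1/σ - 1/2)`, which
tends to `0` because `σ > 2` (`Profile.exists_waveSize_le`).

The `L^{n,∞}` bound has to be uniform in `K`. Riesz products give lacunary cosine sums Gaussian
exponential moments, hence `L^n` bounds depending only on the sum of the squared coefficients
(`eLpNorm_lacunary_le`).

Such windows, with errors `ε / 2 ^ (w + 1)`, are placed on the successive intervals `[w, w + 1]`.
The velocity vanishes at integer times, and at the midpoints a fixed low-frequency block of it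
equals that block of `U`; this yields the two asymptotic statements. The mild formulation reduces to
the fundamental theorem of calculus, because force minus convection is the heat operator applied to
a finite sum of terms `c(t) V` with `V` solenoidal, plus a gradient (`duhamel`,
`Profile.force_sub_convection`). The pieces are assembled in `Profile.exists_solution`. -/

noncomputable section

namespace ForcedNS

variable {n : ℕ}

open FourierTransform SchwartzMap

/-! ### Schwartz fields as tempered distributions; Fourier multipliers and `L^p` norms. -/

/-- Scalar complex Schwartz functions. -/
abbrev Sch (n : ℕ) : Type := 𝓢(Rn n, ℂ)

/-- The pointwise product of Schwartz functions. -/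
instance : Mul (Sch n) := ⟨fun F G => SchwartzMap.pairing (ContinuousLinearMap.mul ℂ ℂ) F G⟩

@[simp] lemma mul_apply (F G : Sch n) (x : Rn n) : (F * G) x = F x * G x := rfl

/-- The vector-valued Schwartz function with given components. -/
def vec : (Fin n → Sch n) →ₗ[ℂ] 𝓢(Rn n, Cn n) :=
  ∑ k, (SchwartzMap.postcompCLM (𝕜 := ℂ)
    (ContinuousLinearMap.toSpanSingleton ℂ (EuclideanSpace.single k (1 : ℂ)) :
      ℂ →L[ℂ] Cn n)).toLinearMap ∘ₗ LinearMap.proj k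

@[simp] lemma vec_apply (W : Fin n → Sch n) (x : Rn n) (k : Fin n) : vec W x k = W k x := by
  simp [vec, LinearMap.sum_apply, Finset.sum_apply, Pi.single_apply]

/-- The tempered distribution given by a Schwartz vector field. -/
def toDist : (Fin n → Sch n) →ₗ[ℂ] Dist n :=
  (SchwartzMap.toTemperedDistributionCLM (Rn n) (Cn n) volume).toLinearMap ∘ₗ vec

lemma toDist_apply (W : Fin n → Sch n) (φ : Sch n) : toDist W φ = ∫ x, φ x • vec W x := by
  simp [toDist]

lemma integrable_smul_vec (W : Fin n → Sch n) (φ : Sch n) :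
    Integrable (fun x => φ x • vec W x) :=
  (SchwartzMap.pairing (ContinuousLinearMap.lsmul ℂ ℂ) φ (vec W)).integrable

lemma integrable_mul (F G : Sch n) : Integrable (fun x => F x * G x) := (F * G).integrable

lemma toDist_apply_apply (W : Fin n → Sch n) (φ : Sch n) (k : Fin n) :
    toDist W φ k = ∫ x, φ x * W k x := by
  rw [toDist_apply, eval_integral_piLp]
  · simp
  · intro i; simpa using integrable_mul φ (W i)

lemma isGivenBy_toDist (W : Fin n → Sch n) : IsGivenBy (toDist W) (vec W) :=
  ⟨(vec W).continuous.aestronglyMeasurable, fun φ => ⟨integrable_smul_vec W φ, toDist_apply W φ⟩⟩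

/-- Componentwise Fourier multiplier with symbol `m`, a function of the angular frequency. -/
def multS (m : Rn n → ℝ) (F : Sch n) : Sch n :=
  SchwartzMap.fourierMultiplierCLM ℂ (fun ξ => ((m ((2 * Real.pi) • ξ) : ℝ) : ℂ)) F

/-- The symbol `m` defines a Fourier multiplier. -/
def IsSymbol (m : Rn n → ℝ) : Prop :=
  Function.HasTemperateGrowth (fun ξ : Rn n => ((m ((2 * Real.pi) • ξ) : ℝ) : ℂ))

lemma fourier_multS {m : Rn n → ℝ} (hm : IsSymbol m) (F : Sch n) (ξ : Rn n) :
    𝓕 (multS m F) ξ = (m ((2 * Real.pi) • ξ) : ℂ) * 𝓕 F ξ := by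
  unfold IsSymbol at hm
  simp [multS, SchwartzMap.fourierMultiplierCLM_apply, hm]

/-- Both multipliers are dual to the same operator on test functions, so the scalar identity can be
applied to one component at a time. From here on all blocks are computed on Schwartz functions. -/
lemma mult_toDist {m : Rn n → ℝ} (hm : IsSymbol m) (W : Fin n → Sch n) :
    mult m (toDist W) = toDist (fun k => multS m (W k)) := by
  ext φ k
  have h := congrArg (fun T : 𝓢'(Rn n, ℂ) => T φ)
    (TemperedDistribution.fourierMultiplierCLM_toTemperedDistributionCLM_eq hm (W k))
  simp only [TemperedDistribution.fourierMultiplierCLM_apply_apply,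
    SchwartzMap.toTemperedDistributionCLM_apply_apply, smul_eq_mul] at h
  rw [mult, TemperedDistribution.fourierMultiplierCLM_apply_apply, toDist_apply_apply, h,
    toDist_apply_apply]
  rfl

lemma mult_add (m : Rn n → ℝ) (T T' : Dist n) : mult m (T + T') = mult m T + mult m T' :=
  map_add _ _ _
lemma mult_smul (m : Rn n → ℝ) (c : ℂ) (T : Dist n) : mult m (c • T) = c • mult m T :=
  map_smul _ _ _
lemma mult_sum (m : Rn n → ℝ) {ι : Type*} (s : Finset ι) (T : ι → Dist n) :
    mult m (∑ i ∈ s, T i) = ∑ i ∈ s, mult m (T i) :=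
  map_sum _ _ _

lemma IsGivenBy.add {T T' : Dist n} {g g' : Rn n → Cn n} (h : IsGivenBy T g)
    (h' : IsGivenBy T' g') : IsGivenBy (T + T') (g + g') := by
  refine ⟨h.1.add h'.1, fun φ => ?_⟩
  have := h.2 φ
  have := h'.2 φ
  simp only [Pi.add_apply, smul_add]
  refine ⟨(h.2 φ).1.add (h'.2 φ).1, ?_⟩
  rw [integral_add (h.2 φ).1 (h'.2 φ).1, ← (h.2 φ).2, ← (h'.2 φ).2]
  rfl

lemma IsGivenBy.smul {T : Dist n} {g : Rn n → Cn n} (c : ℂ) (h : IsGivenBy T g) :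
    IsGivenBy (c • T) (c • g) := by
  refine ⟨h.1.const_smul c, fun φ => ?_⟩
  simp only [Pi.smul_apply, smul_comm (φ _) c]
  refine ⟨(h.2 φ).1.smul c, ?_⟩
  rw [integral_smul, ← (h.2 φ).2]
  rfl

lemma lpNorm_le {p : ℝ≥0∞} {T : Dist n} {g : Rn n → Cn n} (h : IsGivenBy T g) :
    lpNorm p T ≤ eLpNorm g p volume := iInf₂_le _ h

lemma lpNorm_add_le {p : ℝ≥0∞} (hp : 1 ≤ p) (T T' : Dist n) :
    lpNorm p (T + T') ≤ lpNorm p T + lpNorm p T' := by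
  unfold lpNorm
  rw [ENNReal.iInf_add]
  refine le_iInf fun g => ?_
  rw [ENNReal.iInf_add]
  refine le_iInf fun hg => ?_
  rw [ENNReal.add_iInf]
  refine le_iInf fun g' => ?_
  rw [ENNReal.add_iInf]
  refine le_iInf fun hg' => ?_
  exact (lpNorm_le (hg.add hg')).trans (eLpNorm_add_le hg.1 hg'.1 hp)

lemma lpNorm_zero (p : ℝ≥0∞) : lpNorm p (0 : Dist n) = 0 := by
  refine le_antisymm ?_ bot_le
  have : IsGivenBy (0 : Dist n) (0 : Rn n → Cn n) :=
    ⟨aestronglyMeasurable_zero, fun φ => ⟨by simp, by simp⟩⟩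
  simpa using lpNorm_le (p := p) this

lemma lpNorm_smul_le (p : ℝ≥0∞) (c : ℂ) (T : Dist n) :
    lpNorm p (c • T) ≤ ‖c‖ₑ * lpNorm p T := by
  rcases eq_or_ne c 0 with rfl | hc
  · have h0 : (0 : ℂ) • T = 0 := zero_smul ℂ T
    rw [h0]
    simp [lpNorm_zero]
  have hc' : ‖c‖ₑ ≠ 0 := by simpa using hc
  conv_rhs => unfold lpNorm
  rw [ENNReal.mul_iInf_of_ne hc' enorm_ne_top]
  refine le_iInf fun g => ?_
  rw [ENNReal.mul_iInf_of_ne hc' enorm_ne_top]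
  refine le_iInf fun hg => ?_
  exact (lpNorm_le (hg.smul c)).trans (eLpNorm_const_smul c g p volume).le

lemma lpNorm_sum_le {p : ℝ≥0∞} (hp : 1 ≤ p) {ι : Type*} (s : Finset ι) (T : ι → Dist n) :
    lpNorm p (∑ i ∈ s, T i) ≤ ∑ i ∈ s, lpNorm p (T i) := by
  classical
  induction s using Finset.induction_on with
  | empty => simp [lpNorm_zero]
  | insert a s ha ih =>
    rw [Finset.sum_insert ha, Finset.sum_insert ha]
    exact (lpNorm_add_le hp _ _).trans (by gcongr)

/-! ### Triangle inequalities for Besov norms. -/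

/-- The weighted norms of the Littlewood--Paley blocks. -/
def blockNorm (χ : Rn n → ℝ) (s : ℝ) (p : ℝ≥0∞) (T : Dist n) (j : ℤ) : ℝ≥0∞ :=
  (2 : ℝ≥0∞) ^ (s * (j : ℝ)) * lpNorm p (block χ j T)

lemma besovNorm_eq (χ : Rn n → ℝ) (s : ℝ) (p q : ℝ≥0∞) (T : Dist n) :
    besovNorm χ s p q T = eLpNorm (blockNorm χ s p T) q Measure.count := rfl

lemma blockNorm_sum_smul_le (χ : Rn n → ℝ) (s : ℝ) {p : ℝ≥0∞} (hp : 1 ≤ p) {ι : Type*}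
    (I : Finset ι) (c : ι → ℂ) (T : ι → Dist n) (j : ℤ) :
    blockNorm χ s p (∑ i ∈ I, c i • T i) j ≤ ∑ i ∈ I, ‖c i‖ₑ * blockNorm χ s p (T i) j := by
  unfold blockNorm block
  rw [mult_sum]
  refine (mul_le_mul_right (lpNorm_sum_le hp _ _) _).trans ?_
  rw [Finset.mul_sum]
  refine Finset.sum_le_sum fun i _ => ?_
  rw [mult_smul]
  refine (mul_le_mul_right (lpNorm_smul_le _ _ _) _).trans (le_of_eq ?_)
  ring

lemma blockNorm_add_le (χ : Rn n → ℝ) (s : ℝ) {p : ℝ≥0∞} (hp : 1 ≤ p) (T T' : Dist n) (j : ℤ) :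
    blockNorm χ s p (T + T') j ≤ blockNorm χ s p T j + blockNorm χ s p T' j := by
  unfold blockNorm block
  rw [mult_add, ← mul_add]
  gcongr
  exact lpNorm_add_le hp _ _

lemma blockNorm_zero (χ : Rn n → ℝ) (s : ℝ) (p : ℝ≥0∞) (j : ℤ) :
    blockNorm χ s p (0 : Dist n) j = 0 := by
  simp [blockNorm, block, mult, lpNorm_zero]

lemma besovNorm_zero (χ : Rn n → ℝ) (s : ℝ) (p q : ℝ≥0∞) :
    besovNorm χ s p q (0 : Dist n) = 0 := by
  rw [besovNorm_eq, show blockNorm χ s p (0 : Dist n) = 0 from funext (blockNorm_zero χ s p)]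
  simp

lemma besovNorm_sum_smul_le (χ : Rn n → ℝ) (s : ℝ) {p q : ℝ≥0∞} (hp : 1 ≤ p) (hq : 1 ≤ q)
    {ι : Type*} (I : Finset ι) (c : ι → ℂ) (T : ι → Dist n) :
    besovNorm χ s p q (∑ i ∈ I, c i • T i) ≤ ∑ i ∈ I, ‖c i‖ₑ * besovNorm χ s p q (T i) := by
  simp only [besovNorm_eq]
  calc _ ≤ eLpNorm (∑ i ∈ I, fun j => ‖c i‖ₑ * blockNorm χ s p (T i) j) q Measure.count := by
        refine eLpNorm_mono_enorm fun j => ?_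
        simpa using blockNorm_sum_smul_le χ s hp I c T j
    _ ≤ ∑ i ∈ I, eLpNorm (fun j => ‖c i‖ₑ * blockNorm χ s p (T i) j) q Measure.count :=
        eLpNorm_sum_le (fun i _ => .of_discrete) hq
    _ ≤ _ := by
        refine Finset.sum_le_sum fun i _ => ?_
        refine eLpNorm_le_mul_eLpNorm_of_ae_le_mul'' _ .of_discrete (.of_forall fun j => ?_)
        simp

/-! ### `L^p` bounds read off from the Fourier transform. -/

lemma eLpNorm_two_fourier (F : Sch n) :
    eLpNorm (fun ξ => (𝓕 F : Sch n) ξ) 2 volume = eLpNorm (fun x => F x) 2 volume := by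
  have h := SchwartzMap.norm_fourier_toL2_eq F
  have h1 := SchwartzMap.norm_toLp (f := (𝓕 F : Sch n)) (p := 2) (μ := volume)
  have h2 := SchwartzMap.norm_toLp (f := F) (p := 2) (μ := volume)
  have h3 := h1.symm.trans (h.trans h2)
  have h4 := SchwartzMap.eLpNorm_lt_top (𝓕 F : Sch n) 2 volume
  have h5 := SchwartzMap.eLpNorm_lt_top F 2 volume
  rw [← ENNReal.ofReal_toReal h4.ne, h3, ENNReal.ofReal_toReal h5.ne]

lemma enorm_le_of_fourier (F : Sch n) (x : Rn n) : ‖F x‖ₑ ≤ ∫⁻ ξ, ‖𝓕 F ξ‖ₑ := by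
  have : F x = 𝓕⁻ (𝓕 F) x := by simp
  rw [this, SchwartzMap.fourierInv_coe, Real.fourierInv_eq']
  refine (enorm_integral_le_lintegral_enorm _).trans (le_of_eq ?_)
  refine lintegral_congr fun ξ => ?_
  rw [enorm_smul]
  have : ‖Complex.exp (((2 * Real.pi * inner ℝ ξ x : ℝ) : ℂ) * Complex.I)‖ₑ = 1 := by
    rw [← ofReal_norm, Complex.norm_exp_ofReal_mul_I]; simp
  rw [this, one_mul]

/-- Interpolation between the sup bound `A |E|` from Fourier inversion and the `L²` bound from
Plancherel, through `|F|^r ≤ (sup |F|)^(r-2) |F|²`. The result is the Hausdorff–Young exponent. -/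
lemma eLpNorm_le_of_fourier {F : Sch n} {A : ℝ≥0∞} {E : Set (Rn n)} (hE : MeasurableSet E)
    (hV : volume E ≠ ⊤) (hA : A ≠ ⊤) {r : ℝ} (hr : 2 ≤ r)
    (h : ∀ ξ, ‖𝓕 F ξ‖ₑ ≤ E.indicator (fun _ => A) ξ) :
    eLpNorm F (ENNReal.ofReal r) volume ≤ A * volume E ^ (1 - 1 / r) := by
  have hsup : ∀ x, ‖F x‖ₑ ≤ A * volume E := fun x => by
    refine (enorm_le_of_fourier F x).trans ((lintegral_mono h).trans ?_)
    rw [lintegral_indicator_const hE]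
  have hL2 : ∫⁻ x, ‖F x‖ₑ ^ (2 : ℝ) ≤ A ^ (2 : ℝ) * volume E := by
    have h1 := eLpNorm_two_fourier F
    rw [eLpNorm_eq_lintegral_rpow_enorm_toReal (by simp) (by simp),
      eLpNorm_eq_lintegral_rpow_enorm_toReal (by simp) (by simp)] at h1
    have h2 := congrArg (fun a : ℝ≥0∞ => a ^ (2 : ℝ)) h1
    simp only [ENNReal.toReal_ofNat, ← ENNReal.rpow_mul] at h2
    norm_num at h2
    norm_num
    rw [← h2, ← lintegral_indicator_const hE]
    refine lintegral_mono fun ξ => ?_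
    have := h ξ
    by_cases hξ : ξ ∈ E
    · simp only [hξ, indicator_of_mem] at this ⊢
      gcongr
    · simp only [hξ, not_false_eq_true, indicator_of_notMem] at this ⊢
      simpa using this
  have hr0 : 0 < r := by linarith
  rw [eLpNorm_eq_lintegral_rpow_enorm_toReal (by simpa using hr0) (by simp),
    ENNReal.toReal_ofReal hr0.le]
  have hi : ∫⁻ x, ‖F x‖ₑ ^ r ≤ (A * volume E) ^ (r - 2) * (A ^ (2 : ℝ) * volume E) := by
    calc ∫⁻ x, ‖F x‖ₑ ^ r ≤ ∫⁻ x, (A * volume E) ^ (r - 2) * ‖F x‖ₑ ^ (2 : ℝ) := by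
          refine lintegral_mono fun x => ?_
          have : r = (r - 2) + 2 := by ring
          conv_lhs => rw [this]
          rw [ENNReal.rpow_add_of_nonneg _ _ (by linarith) (by norm_num)]
          gcongr ?_ * _
          exact ENNReal.rpow_le_rpow (hsup x) (by linarith)
      _ = (A * volume E) ^ (r - 2) * ∫⁻ x, ‖F x‖ₑ ^ (2 : ℝ) := by
          refine lintegral_const_mul' _ _ ?_
          exact ENNReal.rpow_ne_top_of_nonneg (by linarith) (ENNReal.mul_ne_top hA hV)
      _ ≤ _ := by gcongr
  have heq : (A * volume E) ^ (r - 2) * (A ^ (2 : ℝ) * volume E)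
      = (A * volume E ^ (1 - 1 / r)) ^ r := by
    rw [ENNReal.mul_rpow_of_nonneg _ _ (by linarith), ENNReal.mul_rpow_of_nonneg _ _ hr0.le,
      ← ENNReal.rpow_mul]
    have e1 : (1 - 1 / r) * r = (r - 2) + 1 := by field_simp; ring
    have e2 : A ^ r = A ^ (r - 2) * A ^ (2 : ℝ) := by
      rw [← ENNReal.rpow_add_of_nonneg _ _ (by linarith) (by norm_num)]; ring_nf
    rw [e1, e2, ENNReal.rpow_add_of_nonneg _ _ (by linarith) (by norm_num), ENNReal.rpow_one]
    ring
  calc _ ≤ ((A * volume E ^ (1 - 1 / r)) ^ r) ^ (1 / r) := by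
        rw [← heq]; gcongr
    _ = _ := by rw [← ENNReal.rpow_mul, mul_one_div_cancel hr0.ne', ENNReal.rpow_one]

/-- The dyadic annulus in ordinary frequency outside of which the `j`-th block vanishes. -/
def annulus (n : ℕ) (j : ℤ) : Set (Rn n) :=
  {ξ | (2 : ℝ) ^ (j - 1) ≤ 2 * Real.pi * ‖ξ‖ ∧ 2 * Real.pi * ‖ξ‖ ≤ (2 : ℝ) ^ (j + 1)}

lemma isSymbol_of_support {m : Rn n → ℝ} (hm : ContDiff ℝ ∞ m) {R : ℝ}
    (hs : ∀ ξ, m ξ ≠ 0 → ‖ξ‖ ≤ R) : IsSymbol m := by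
  have hpi := Real.pi_pos
  refine HasCompactSupport.hasTemperateGrowth ?_ ?_
  · refine HasCompactSupport.intro (isCompact_closedBall (0 : Rn n) R) fun ξ hξ => ?_
    rw [Metric.mem_closedBall, dist_zero_right, not_le] at hξ
    by_contra h0
    have h1 := hs ((2 * Real.pi) • ξ) (by simpa using h0)
    rw [norm_smul, Real.norm_of_nonneg (by positivity)] at h1
    have h3 := Real.pi_gt_three
    nlinarith [norm_nonneg ξ]
  · exact (Complex.ofRealCLM.contDiff.comp (hm.comp (contDiff_const_smul _)))

lemma blockSymbol_contDiff {χ : Rn n → ℝ} (hχ : IsLittlewoodPaley χ) (j : ℤ) :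
    ContDiff ℝ ∞ (blockSymbol χ j) := hχ.smooth.comp (contDiff_const_smul _)

lemma norm_of_blockSymbol_ne_zero {χ : Rn n → ℝ} (hχ : IsLittlewoodPaley χ) {j : ℤ} {ξ : Rn n}
    (h : blockSymbol χ j ξ ≠ 0) : (2 : ℝ) ^ (j - 1) ≤ ‖ξ‖ ∧ ‖ξ‖ ≤ (2 : ℝ) ^ (j + 1) := by
  have h1 := hχ.supp (Function.mem_support.2 h)
  have e0 : ‖((2 : ℝ) ^ (-j))‖ = ((2 : ℝ) ^ j)⁻¹ := by
    rw [Real.norm_of_nonneg (by positivity), zpow_neg]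
  rw [mem_ofPred_eq, norm_smul, e0] at h1
  have hp : (0 : ℝ) < 2 ^ j := by positivity
  rw [zpow_sub_one₀ two_ne_zero, zpow_add_one₀ two_ne_zero]
  rw [inv_mul_eq_div, le_div_iff₀ hp, div_le_iff₀ hp] at h1
  constructor <;> linarith [h1.1, h1.2]

lemma isSymbol_blockSymbol {χ : Rn n → ℝ} (hχ : IsLittlewoodPaley χ) (j : ℤ) :
    IsSymbol (blockSymbol χ j) :=
  isSymbol_of_support (blockSymbol_contDiff hχ j)
    fun _ h => (norm_of_blockSymbol_ne_zero hχ h).2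

lemma mem_annulus_of_blockSymbol_ne_zero {χ : Rn n → ℝ} (hχ : IsLittlewoodPaley χ) {j : ℤ}
    {ξ : Rn n} (h : blockSymbol χ j ((2 * Real.pi) • ξ) ≠ 0) : ξ ∈ annulus n j := by
  have := norm_of_blockSymbol_ne_zero hχ h
  have hpi := Real.pi_pos
  rwa [norm_smul, Real.norm_of_nonneg (by positivity)] at this

lemma block_toDist {χ : Rn n → ℝ} (hχ : IsLittlewoodPaley χ) (j : ℤ) (W : Fin n → Sch n) :
    block χ j (toDist W) = toDist (fun k => multS (blockSymbol χ j) (W k)) :=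
  mult_toDist (isSymbol_blockSymbol hχ j) W

lemma eLpNorm_vec_le (W : Fin n → Sch n) {p : ℝ≥0∞} (hp : 1 ≤ p) :
    eLpNorm (vec W) p volume ≤ ∑ k, eLpNorm (W k) p volume := by
  calc eLpNorm (vec W) p volume ≤ eLpNorm (∑ k, fun x => ‖W k x‖) p volume := by
        refine eLpNorm_mono_real fun x => ?_
        rw [EuclideanSpace.norm_eq, Finset.sum_apply]
        simp only [vec_apply]
        refine Real.sqrt_le_iff.2 ⟨Finset.sum_nonneg fun _ _ => norm_nonneg _, ?_⟩
        exact Finset.sum_sq_le_sq_sum_of_nonneg fun _ _ => norm_nonneg _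
    _ ≤ ∑ k, eLpNorm (fun x => ‖W k x‖) p volume :=
        eLpNorm_sum_le (fun k _ => (W k).continuous.norm.aestronglyMeasurable) hp
    _ = _ := by simp only [eLpNorm_norm]

/-- The block symbol lies in `[0, 1]`, so only the size and support of the transform on the annulus
matter. The set `E` is left free: a ball of radius `2 ^ j` serves for low frequencies, while a ball
of fixed radius about a carrier frequency gives bounds for waves with no volume growth. -/
lemma lpNorm_block_le {χ : Rn n → ℝ} (hχ : IsLittlewoodPaley χ) {j : ℤ} {W : Fin n → Sch n}
    {A : ℝ≥0∞} {E : Set (Rn n)} (hE : MeasurableSet E)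
    (hV : volume E ≠ ⊤) (hA : A ≠ ⊤) {r : ℝ} (hr : 2 ≤ r)
    (h : ∀ k, ∀ ξ ∈ annulus n j, ‖𝓕 (W k) ξ‖ₑ ≤ E.indicator (fun _ => A) ξ) :
    lpNorm (ENNReal.ofReal r) (block χ j (toDist W)) ≤ n * (A * volume E ^ (1 - 1 / r)) := by
  rw [block_toDist hχ]
  refine (lpNorm_le (isGivenBy_toDist _)).trans ?_
  refine (eLpNorm_vec_le _ (by simpa using by linarith)).trans ?_
  calc _ ≤ ∑ k : Fin n, (A * volume E ^ (1 - 1 / r)) := by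
        refine Finset.sum_le_sum fun k _ => eLpNorm_le_of_fourier hE hV hA hr fun ξ => ?_
        rw [fourier_multS (isSymbol_blockSymbol hχ j)]
        by_cases h0 : blockSymbol χ j ((2 * Real.pi) • ξ) = 0
        · simp [h0]
        · refine le_trans ?_ (h k ξ (mem_annulus_of_blockSymbol_ne_zero hχ h0))
          rw [enorm_mul]
          have : ‖((blockSymbol χ j ((2 * Real.pi) • ξ) : ℝ) : ℂ)‖ₑ ≤ 1 := by
            rw [← ofReal_norm, Complex.norm_real, Real.norm_of_nonneg (show 0 ≤ blockSymbol χ j _ from hχ.nonneg _)]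
            simpa [blockSymbol] using hχ.le_one _
          calc _ ≤ 1 * ‖𝓕 (W k) ξ‖ₑ := by gcongr
            _ = _ := one_mul _
    _ = _ := by simp

lemma lpNorm_block_eq_zero {χ : Rn n → ℝ} (hχ : IsLittlewoodPaley χ) {j : ℤ} {W : Fin n → Sch n}
    {r : ℝ} (hr : 2 ≤ r) (h : ∀ k, ∀ ξ ∈ annulus n j, 𝓕 (W k) ξ = 0) :
    lpNorm (ENNReal.ofReal r) (block χ j (toDist W)) = 0 := by
  have := lpNorm_block_le hχ (W := W) (A := 0) (E := ∅) (j := j) MeasurableSet.empty (by simp)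
    (by simp) hr (fun k ξ hξ => by simp [h k ξ hξ])
  simpa using this

/-! ### Sequence norms and geometric series. -/

lemma tsum_rpow_le_rpow_tsum {ι : Type*} (f : ι → ℝ≥0∞) {σ : ℝ} (hσ : 1 ≤ σ) :
    ∑' j, f j ^ σ ≤ (∑' j, f j) ^ σ := by
  set T := ∑' j, f j
  calc ∑' j, f j ^ σ ≤ ∑' j, f j * T ^ (σ - 1) := by
        refine ENNReal.tsum_le_tsum fun j => ?_
        have : σ = 1 + (σ - 1) := by ring
        conv_lhs => rw [this]
        rw [ENNReal.rpow_add_of_nonneg _ _ (by norm_num) (by linarith), ENNReal.rpow_one]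
        gcongr f j * ?_
        exact ENNReal.rpow_le_rpow (ENNReal.le_tsum j) (by linarith)
    _ = T * T ^ (σ - 1) := ENNReal.tsum_mul_right
    _ = T ^ σ := by
        nth_rewrite 1 [← ENNReal.rpow_one T]
        rw [← ENNReal.rpow_add_of_nonneg _ _ (by norm_num) (by linarith)]
        ring_nf

lemma eLpNorm_count_eq {σ : ℝ} (hσ : 0 < σ) (f : ℤ → ℝ≥0∞) :
    eLpNorm f (ENNReal.ofReal σ) Measure.count = (∑' j, f j ^ σ) ^ (1 / σ) := by
  rw [eLpNorm_eq_lintegral_rpow_enorm_toReal (by simpa using hσ) (by simp),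
    ENNReal.toReal_ofReal hσ.le, lintegral_count]
  simp only [enorm_eq_self]

lemma eLpNorm_count_le_tsum (f : ℤ → ℝ≥0∞) {σ : ℝ} (hσ : 1 ≤ σ) :
    eLpNorm f (ENNReal.ofReal σ) Measure.count ≤ ∑' j, f j := by
  have h0 : 0 < σ := by linarith
  rw [eLpNorm_count_eq h0]
  calc _ ≤ ((∑' j, f j) ^ σ) ^ (1 / σ) :=
        ENNReal.rpow_le_rpow (tsum_rpow_le_rpow_tsum f hσ) (by positivity)
    _ = _ := by rw [← ENNReal.rpow_mul, mul_one_div_cancel h0.ne', ENNReal.rpow_one]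

lemma tsum_le_of_geometric_right {x : ℤ → ℝ≥0∞} {j₀ : ℤ} {C q : ℝ≥0∞}
    (h0 : ∀ j < j₀, x j = 0) (h : ∀ k : ℕ, x (j₀ + k) ≤ C * q ^ k) :
    ∑' j, x j ≤ C * (1 - q)⁻¹ := by
  have hinj : Function.Injective (fun k : ℕ => j₀ + (k : ℤ)) := fun a b hab => by
    simpa using hab
  rw [← hinj.tsum_eq (f := x)]
  · rw [← ENNReal.tsum_geometric, ← ENNReal.tsum_mul_left]
    exact ENNReal.tsum_le_tsum h
  · intro j hj
    have : j₀ ≤ j := by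
      by_contra hlt
      exact hj (h0 j (not_le.1 hlt))
    exact ⟨(j - j₀).toNat, by simp [Int.toNat_of_nonneg (sub_nonneg.2 this)]⟩

lemma tsum_le_of_geometric_left {x : ℤ → ℝ≥0∞} {j₀ : ℤ} {C q : ℝ≥0∞}
    (h0 : ∀ j, j₀ < j → x j = 0) (h : ∀ k : ℕ, x (j₀ - k) ≤ C * q ^ k) :
    ∑' j, x j ≤ C * (1 - q)⁻¹ := by
  rw [← (Equiv.neg ℤ).tsum_eq x]
  refine tsum_le_of_geometric_right (j₀ := -j₀) (fun j hj => h0 _ ?_) fun k => ?_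
  · simp; omega
  · convert h k using 2; simp; ring

lemma two_rpow (x : ℝ) : (2 : ℝ≥0∞) ^ x = ENNReal.ofReal ((2 : ℝ) ^ x) := by
  rw [← ENNReal.ofReal_rpow_of_pos two_pos]; simp

/-- From `3 < π < 4`: on the annulus `‖ξ‖ ≤ 2 ^ j / π` and `2 ^ j ≤ 4 π ‖ξ‖ ≤ 16 ‖ξ‖`. -/
lemma annulus_norm_lt {j : ℤ} {ξ : Rn n} (h : ξ ∈ annulus n j) :
    ‖ξ‖ < (2 : ℝ) ^ (j : ℝ) ∧ (2 : ℝ) ^ (j : ℝ) ≤ 16 * ‖ξ‖ := by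
  have h3 := Real.pi_gt_three
  have h4 := Real.pi_lt_four
  obtain ⟨h1, h2⟩ := h
  rw [Real.rpow_intCast]
  have hp : (0 : ℝ) < 2 ^ j := by positivity
  rw [zpow_sub_one₀ two_ne_zero] at h1
  rw [zpow_add_one₀ two_ne_zero] at h2
  constructor <;> nlinarith [norm_nonneg ξ]

/-! ### Besov bounds for spectrally localized fields. -/

/-- Low frequencies: a band-limited field whose Fourier transform vanishes at the origin. -/
lemma tsum_blockNorm_lt_top {χ : Rn n → ℝ} (hχ : IsLittlewoodPaley χ) {W : Fin n → Sch n}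
    {A R : ℝ} {r s : ℝ} (hr : 2 ≤ r) (hs : 0 < s + 1 + n * (1 - 1 / r))
    (hA : 0 ≤ A) (hb : ∀ k ξ, ‖𝓕 (W k) ξ‖ ≤ A * ‖ξ‖) (hR : ∀ k ξ, 𝓕 (W k) ξ ≠ 0 → ‖ξ‖ ≤ R) :
    ∑' j, blockNorm χ s (ENNReal.ofReal r) (toDist W) j < ⊤ := by
  -- Blocks above `J` miss the spectrum.
  obtain ⟨J, hJ⟩ : ∃ J : ℕ, 16 * R < (2 : ℝ) ^ J := pow_unbounded_of_one_lt _ one_lt_two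
  -- The three contributions are the Besov weight, the vanishing of the transform at the origin, and
  -- the volume of the frequency ball. Since `e > 0`, the blocks decay geometrically as `j → -∞`.
  set e := s + 1 + n * (1 - 1 / r) with he
  set V := volume (Metric.closedBall (0 : Rn n) 1) with hV
  have hVt : V ≠ ⊤ := measure_closedBall_lt_top.ne
  have hr1 : 0 ≤ 1 - 1 / r := by
    rw [sub_nonneg, div_le_one (by linarith)]; linarith
  have hbound : ∀ j : ℤ, blockNorm χ s (ENNReal.ofReal r) (toDist W) j ≤
      (n * ENNReal.ofReal A * V ^ (1 - 1 / r)) * (2 : ℝ≥0∞) ^ (e * (j : ℝ)) := fun j => by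
    have hvol : volume (Metric.closedBall (0 : Rn n) ((2 : ℝ) ^ (j : ℝ)))
        = (2 : ℝ≥0∞) ^ ((j : ℝ) * n) * V := by
      rw [Measure.addHaar_closedBall' _ _ (by positivity), finrank_euclideanSpace_fin, two_rpow,
        Real.rpow_mul (by norm_num), Real.rpow_natCast]
    have := lpNorm_block_le hχ (W := W) (j := j) (A := ENNReal.ofReal (A * (2 : ℝ) ^ (j : ℝ)))
      (E := Metric.closedBall (0 : Rn n) ((2 : ℝ) ^ (j : ℝ))) measurableSet_closedBall
      measure_closedBall_lt_top.ne (by simp) hr (fun k ξ hξ => by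
        have hξ' := (annulus_norm_lt hξ).1.le
        rw [indicator_of_mem (by simpa using hξ'), ← ofReal_norm]
        exact ENNReal.ofReal_le_ofReal ((hb k ξ).trans (by gcongr)))
    unfold blockNorm
    refine (mul_le_mul_right this _).trans (le_of_eq ?_)
    rw [hvol, ENNReal.ofReal_mul hA, ← two_rpow, ENNReal.mul_rpow_of_nonneg _ _ hr1,
      ← ENNReal.rpow_mul]
    have : (2 : ℝ≥0∞) ^ (e * (j : ℝ)) = 2 ^ (s * (j : ℝ)) * 2 ^ (j : ℝ) *
        2 ^ ((j : ℝ) * n * (1 - 1 / r)) := by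
      rw [← ENNReal.rpow_add _ _ (by simp) (by simp), ← ENNReal.rpow_add _ _ (by simp) (by simp)]
      rw [he]; ring_nf
    rw [this]; ring
  refine lt_of_le_of_lt (tsum_le_of_geometric_left (j₀ := J)
    (C := (n * ENNReal.ofReal A * V ^ (1 - 1 / r)) * (2 : ℝ≥0∞) ^ (e * (J : ℝ)))
    (q := (2 : ℝ≥0∞) ^ (-e)) ?_ ?_) ?_
  · intro j hj
    have := lpNorm_block_eq_zero hχ (W := W) (j := j) hr (fun k ξ hξ => by
      by_contra hne
      have h1 := (annulus_norm_lt hξ).2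
      have h2 := hR k ξ hne
      have h3 : (2 : ℝ) ^ J ≤ 2 ^ (j : ℝ) := by
        rw [← Real.rpow_natCast]
        exact Real.rpow_le_rpow_of_exponent_le (by norm_num) (by exact_mod_cast hj.le)
      linarith)
    simp [blockNorm, this]
  · intro k
    refine (hbound _).trans (le_of_eq ?_)
    rw [mul_assoc _ ((2 : ℝ≥0∞) ^ (e * (J : ℝ))), ← ENNReal.rpow_natCast, ← ENNReal.rpow_mul,
      ← ENNReal.rpow_add _ _ (by simp) (by simp)]
    push_cast
    ring_nf
  · refine ENNReal.mul_lt_top ?_ ?_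
    · refine ENNReal.mul_lt_top (ENNReal.mul_lt_top (ENNReal.mul_lt_top (by simp) (by simp)) ?_) ?_
      · exact ENNReal.rpow_lt_top_of_nonneg hr1 hVt
      · rw [two_rpow]; simp
    · rw [ENNReal.inv_lt_top, tsub_pos_iff_lt]
      exact ENNReal.rpow_lt_one_of_one_lt_of_neg (by norm_num) (by linarith)

/-- High frequencies: a field whose Fourier transform lives on a ball of radius `R`, outside
of the ball of radius `2 ^ m` about the origin. -/
lemma tsum_blockNorm_le_of_high {χ : Rn n → ℝ} (hχ : IsLittlewoodPaley χ) {W : Fin n → Sch n}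
    {A R : ℝ} {r s : ℝ} (hr : 2 ≤ r) (hs : s + 1 ≤ -1) (hA : 0 ≤ A) (c : Rn n) (m : ℕ)
    (hb : ∀ k ξ, ‖𝓕 (W k) ξ‖ ≤ A * ‖ξ‖)
    (hR : ∀ k ξ, 𝓕 (W k) ξ ≠ 0 → ‖ξ - c‖ ≤ R ∧ (2 : ℝ) ^ m ≤ ‖ξ‖) :
    ∑' j, blockNorm χ s (ENNReal.ofReal r) (toDist W) j ≤
      (n * volume (Metric.closedBall (0 : Rn n) R) ^ (1 - 1 / r) * 2) *
        ENNReal.ofReal (A * 2⁻¹ ^ m) := by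
  have hr1 : 0 ≤ 1 - 1 / r := by
    rw [sub_nonneg, div_le_one (by linarith)]; linarith
  set V := volume (Metric.closedBall (0 : Rn n) R) with hV
  have hVc : volume (Metric.closedBall c R) = V := Measure.addHaar_closedBall_center _ _ _
  have hbound : ∀ j : ℤ, blockNorm χ s (ENNReal.ofReal r) (toDist W) j ≤
      (n * ENNReal.ofReal A * V ^ (1 - 1 / r)) * (2 : ℝ≥0∞) ^ ((s + 1) * (j : ℝ)) := fun j => by
    have := lpNorm_block_le hχ (W := W) (j := j) (A := ENNReal.ofReal (A * (2 : ℝ) ^ (j : ℝ)))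
      (E := Metric.closedBall c R) measurableSet_closedBall
      measure_closedBall_lt_top.ne (by simp) hr (fun k ξ hξ => by
        have hξ' := (annulus_norm_lt hξ).1.le
        by_cases h0 : 𝓕 (W k) ξ = 0
        · simp [h0]
        rw [indicator_of_mem (by simpa [dist_eq_norm] using (hR k ξ h0).1), ← ofReal_norm]
        exact ENNReal.ofReal_le_ofReal ((hb k ξ).trans (by gcongr)))
    unfold blockNorm
    refine (mul_le_mul_right this _).trans (le_of_eq ?_)
    rw [hVc, ENNReal.ofReal_mul hA, ← two_rpow, add_mul, one_mul,
      ENNReal.rpow_add _ _ (by simp) (by simp)]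
    ring
  -- Blocks below `m` vanish, and `s + 1 ≤ -1` turns the weight times the factor `‖ξ‖` into at most
  -- `2 ^ (-j)`; summing the ratio `1/2` produces the factor `2`.
  refine (tsum_le_of_geometric_right (j₀ := m)
    (C := (n * ENNReal.ofReal A * V ^ (1 - 1 / r)) * (2 : ℝ≥0∞)⁻¹ ^ m)
    (q := (2 : ℝ≥0∞)⁻¹) ?_ ?_).trans (le_of_eq ?_)
  · intro j hj
    have := lpNorm_block_eq_zero hχ (W := W) (j := j) hr (fun k ξ hξ => by
      by_contra hne
      have h1 := (annulus_norm_lt hξ).1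
      have h2 := (hR k ξ hne).2
      have h3 : (2 : ℝ) ^ (j : ℝ) ≤ 2 ^ m := by
        rw [← Real.rpow_natCast]
        exact Real.rpow_le_rpow_of_exponent_le (by norm_num) (by exact_mod_cast hj.le)
      linarith)
    simp [blockNorm, this]
  · intro k
    refine (hbound _).trans ?_
    rw [mul_assoc _ (2⁻¹ ^ m) _, ← pow_add]
    gcongr
    rw [← ENNReal.rpow_natCast, ENNReal.inv_rpow, ← ENNReal.rpow_neg]
    refine ENNReal.rpow_le_rpow_of_exponent_le (by norm_num) ?_
    push_cast
    nlinarith [(Nat.cast_nonneg m : (0 : ℝ) ≤ m), (Nat.cast_nonneg k : (0 : ℝ) ≤ k)]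
  · rw [ENNReal.ofReal_mul hA, ENNReal.ofReal_pow (by norm_num), ENNReal.ofReal_inv_of_pos two_pos,
      ENNReal.one_sub_inv_two, inv_inv]
    simp
    ring

/-- A field whose Fourier transform lives on a ball, at frequencies comparable to `2 ^ m`. -/
lemma blockNorm_le_of_frequency {χ : Rn n → ℝ} (hχ : IsLittlewoodPaley χ) {W : Fin n → Sch n}
    {A R : ℝ} {r s : ℝ} (hr : 2 ≤ r) (c : Rn n) (m : ℕ)
    (hb : ∀ k ξ, ‖𝓕 (W k) ξ‖ ≤ A)
    (hR : ∀ k ξ, 𝓕 (W k) ξ ≠ 0 → ‖ξ - c‖ ≤ R ∧ (2 : ℝ) ^ m ≤ 2 * ‖ξ‖ ∧ ‖ξ‖ ≤ 2 * 2 ^ m) (j : ℤ) :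
    blockNorm χ s (ENNReal.ofReal r) (toDist W) j ≤
      (Icc (m : ℤ) (m + 5)).indicator (fun j => (2 : ℝ≥0∞) ^ (s * (j : ℝ)) *
        (n * (ENNReal.ofReal A * volume (Metric.closedBall (0 : Rn n) R) ^ (1 - 1 / r)))) j := by
  by_cases hj : j ∈ Icc (m : ℤ) (m + 5)
  · rw [indicator_of_mem hj]
    have := lpNorm_block_le hχ (W := W) (j := j) (A := ENNReal.ofReal A)
      (E := Metric.closedBall c R) measurableSet_closedBall
      measure_closedBall_lt_top.ne (by simp) hr (fun k ξ hξ => by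
        by_cases h0 : 𝓕 (W k) ξ = 0
        · simp [h0]
        rw [indicator_of_mem (by simpa [dist_eq_norm] using (hR k ξ h0).1), ← ofReal_norm]
        exact ENNReal.ofReal_le_ofReal (hb k ξ))
    unfold blockNorm
    refine mul_le_mul_right (this.trans (le_of_eq ?_)) _
    rw [Measure.addHaar_closedBall_center _ c]
  · rw [indicator_of_notMem hj]
    refine le_of_eq ?_
    -- On the spectrum `2π‖ξ‖` lies between `π 2 ^ m` and `4π 2 ^ m`, hence strictly between `2 ^ m`
    -- and `2 ^ (m + 4)`; this meets the annulus only for `m ≤ j ≤ m + 5`.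
    have := lpNorm_block_eq_zero hχ (W := W) (j := j) hr (fun k ξ hξ => by
      by_contra hne
      apply hj
      obtain ⟨-, h1, h2⟩ := hR k ξ hne
      obtain ⟨h3, h4⟩ := hξ
      have hp3 := Real.pi_gt_three
      have hp4 := Real.pi_lt_four
      have hn := norm_nonneg ξ
      constructor
      · by_contra hlt
        have : (2 : ℝ) ^ (j + 1) ≤ 2 ^ (m : ℤ) := zpow_le_zpow_right₀ (by norm_num) (by omega)
        rw [zpow_natCast] at this
        have : (0 : ℝ) < 2 ^ m := by positivity
        nlinarith
      · by_contra hlt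
        have : (2 : ℝ) ^ ((m : ℤ) + 5) ≤ 2 ^ (j - 1) := zpow_le_zpow_right₀ (by norm_num) (by omega)
        rw [zpow_add₀ two_ne_zero, zpow_natCast] at this
        have hm0 : (0 : ℝ) < 2 ^ m := by positivity
        have e5 : (2 : ℝ) ^ (5 : ℤ) = 32 := by norm_num
        rw [e5] at this
        nlinarith)
    simp [blockNorm, this]

/-! ### Derivatives, the Laplacian and modulation on the Fourier side. -/

/-- The partial derivative `∂_l`. -/
def dS (l : Fin n) : Sch n →ₗ[ℂ] Sch n := (LineDeriv.lineDerivOpCLM ℂ (Sch n) (axis l)).toLinearMap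

lemma dS_eq (l : Fin n) (F : Sch n) : dS l F = ∂_{axis l} F := rfl

lemma dS_apply (l : Fin n) (F : Sch n) (x : Rn n) : dS l F x = fderiv ℝ F x (axis l) := by
  rw [dS_eq, SchwartzMap.lineDerivOp_apply_eq_fderiv]

lemma inner_axis (ξ : Rn n) (l : Fin n) : inner ℝ ξ (axis l) = ξ l := by
  simp [axis, EuclideanSpace.inner_single_right]

lemma fourier_dS (l : Fin n) (F : Sch n) (ξ : Rn n) :
    𝓕 (dS l F) ξ = 2 * Real.pi * Complex.I * ξ l * 𝓕 F ξ := by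
  rw [dS_eq, SchwartzMap.fourier_lineDerivOp_eq]
  have : (fun ξ : Rn n => inner ℝ ξ (axis l)).HasTemperateGrowth := by fun_prop
  rw [smul_apply, SchwartzMap.smulLeftCLM_apply_apply this, inner_axis]
  simp
  ring

lemma dS_mul (l : Fin n) (F G : Sch n) : dS l (F * G) = dS l F * G + F * dS l G := by
  ext x
  have h : HasFDerivAt (F * G : Sch n) (F x • fderiv ℝ G x + G x • fderiv ℝ F x) x :=
    F.differentiableAt.hasFDerivAt.mul G.differentiableAt.hasFDerivAt
  simp [dS_apply, h.fderiv]
  ring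

lemma sch_ext_fourier {F G : Sch n} (h : ∀ ξ, 𝓕 F ξ = 𝓕 G ξ) : F = G := by
  have : 𝓕 F = 𝓕 G := SchwartzMap.ext h
  simpa using congrArg (fun H : Sch n => 𝓕⁻ H) this

lemma fourier_add (F G : Sch n) (ξ : Rn n) : 𝓕 (F + G) ξ = 𝓕 F ξ + 𝓕 G ξ := by
  simp [FourierTransform.fourier_add]
lemma fourier_smul (c : ℂ) (F : Sch n) (ξ : Rn n) : 𝓕 (c • F) ξ = c * 𝓕 F ξ := by
  simp [FourierTransform.fourier_smul]
lemma fourier_sum {ι : Type*} (s : Finset ι) (F : ι → Sch n) (ξ : Rn n) :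
    𝓕 (∑ i ∈ s, F i) ξ = ∑ i ∈ s, 𝓕 (F i) ξ := by
  rw [← FourierTransform.fourierCLM_apply (R := ℂ), map_sum]
  simp
lemma fourier_zero (ξ : Rn n) : 𝓕 (0 : Sch n) ξ = 0 := by
  simp

lemma dS_comm (k l : Fin n) (F : Sch n) : dS k (dS l F) = dS l (dS k F) :=
  sch_ext_fourier fun ξ => by simp only [fourier_dS]; ring

/-- The Laplacian. -/
def lapS : Sch n →ₗ[ℂ] Sch n := ∑ l, dS l ∘ₗ dS l

lemma lapS_eq (F : Sch n) : lapS F = ∑ l, dS l (dS l F) := by simp [lapS, LinearMap.sum_apply]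

lemma fourier_lapS (F : Sch n) (ξ : Rn n) :
    𝓕 (lapS F) ξ = -(((2 * Real.pi) ^ 2 * ‖ξ‖ ^ 2 : ℝ) : ℂ) * 𝓕 F ξ := by
  rw [lapS_eq, fourier_sum]
  simp only [fourier_dS]
  rw [EuclideanSpace.norm_sq_eq, Finset.mul_sum]
  push_cast
  rw [← Finset.sum_neg_distrib, Finset.sum_mul]
  refine Finset.sum_congr rfl fun l _ => ?_
  have : ((‖ξ.ofLp l‖ : ℝ) : ℂ) ^ 2 = (ξ l : ℂ) ^ 2 := by
    rw [← Complex.ofReal_pow, ← Complex.ofReal_pow]; simp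
  rw [this]
  linear_combination (-4 * (Real.pi : ℂ) ^ 2 * (ξ l) ^ 2 * 𝓕 F ξ) * (-Complex.I_sq)

lemma dS_lapS (k : Fin n) (F : Sch n) : dS k (lapS F) = lapS (dS k F) := by
  rw [lapS_eq, lapS_eq, map_sum]
  exact Finset.sum_congr rfl fun l _ => by rw [dS_comm k l, dS_comm k l]

/-- Modulation: multiplication by `e^{2π i μ·x}`. -/
def Md (μ : Rn n) : Sch n →ₗ[ℂ] Sch n :=
  ((fourierInvCLM ℂ (Sch n)) ∘L (SchwartzMap.compSubConstCLM ℂ μ) ∘L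
    (fourierCLM ℂ (Sch n))).toLinearMap

lemma fourier_Md (μ : Rn n) (F : Sch n) (ξ : Rn n) : 𝓕 (Md μ F) ξ = 𝓕 F (ξ - μ) := by
  simp [Md]

lemma Md_apply (μ : Rn n) (F : Sch n) (x : Rn n) :
    Md μ F x = Complex.exp ((2 * Real.pi * inner ℝ μ x : ℝ) * Complex.I) * F x := by
  have h1 : Md μ F x = 𝓕⁻ (fun ξ => 𝓕 F (ξ - μ)) x := by
    have : Md μ F = 𝓕⁻ (SchwartzMap.compSubConstCLM ℂ μ (𝓕 F)) := rfl
    rw [this, SchwartzMap.fourierInv_coe]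
    congr 1
  have h2 : F x = 𝓕⁻ (fun ξ => 𝓕 F ξ) x := by
    rw [← SchwartzMap.fourierInv_coe]; simp
  rw [h1, h2, Real.fourierInv_eq', Real.fourierInv_eq', ← integral_const_mul,
    ← integral_sub_right_eq_self (fun v : Rn n =>
      Complex.exp ((2 * Real.pi * inner ℝ μ x : ℝ) * Complex.I) *
        (Complex.exp ((2 * Real.pi * inner ℝ v x : ℝ) * Complex.I) • 𝓕 F v)) μ]
  refine integral_congr_ae (.of_forall fun v => ?_)
  simp only [smul_eq_mul]
  rw [← mul_assoc, ← Complex.exp_add, inner_sub_left]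
  congr 2
  push_cast
  ring

/-- Frequencies add under multiplication. Hence two waves of opposite frequencies produce an
unmodulated, low-frequency product, which is the mechanism behind the mean stress. -/
lemma Md_mul (μ ν : Rn n) (F G : Sch n) : Md μ F * Md ν G = Md (μ + ν) (F * G) := by
  ext x
  rw [mul_apply, Md_apply, Md_apply, Md_apply, inner_add_left, mul_add, Complex.ofReal_add, add_mul,
    Complex.exp_add, mul_apply]
  ring

lemma Md_zero (F : Sch n) : Md 0 F = F := by ext x; simp [Md_apply]

lemma dS_Md (l : Fin n) (μ : Rn n) (F : Sch n) :
    dS l (Md μ F) = Md μ (dS l F) + (2 * Real.pi * Complex.I * μ l) • Md μ F :=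
  sch_ext_fourier fun ξ => by
    simp only [fourier_add, fourier_smul, fourier_dS, fourier_Md]
    simp
    ring

/-! ### Spectral supports; real band-limited functions. -/

/-- The Fourier transform of `F` vanishes outside of the closed ball of centre `c` and
radius `R`. -/
def Spec (F : Sch n) (c : Rn n) (R : ℝ) : Prop := ∀ ξ, 𝓕 F ξ ≠ 0 → ‖ξ - c‖ ≤ R

lemma Spec.mono {F : Sch n} {c : Rn n} {R R' : ℝ} (h : Spec F c R) (hR : R ≤ R') : Spec F c R' :=
  fun ξ hξ => (h ξ hξ).trans hR

lemma Spec.add {F G : Sch n} {c : Rn n} {R : ℝ} (hF : Spec F c R) (hG : Spec G c R) :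
    Spec (F + G) c R := fun ξ hξ => by
  rw [fourier_add] at hξ
  by_cases h : 𝓕 F ξ = 0
  · exact hG ξ (by simpa [h] using hξ)
  · exact hF ξ h

lemma Spec.smul {F : Sch n} {c : Rn n} {R : ℝ} (a : ℂ) (hF : Spec F c R) : Spec (a • F) c R :=
  fun ξ hξ => hF ξ fun h => hξ (by rw [fourier_smul, h, mul_zero])

lemma Spec.dS {F : Sch n} {c : Rn n} {R : ℝ} (l : Fin n) (hF : Spec F c R) :
    Spec (dS l F) c R :=
  fun ξ hξ => hF ξ fun h => hξ (by rw [fourier_dS, h, mul_zero])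

lemma Spec.zero (c : Rn n) (R : ℝ) : Spec (0 : Sch n) c R := fun ξ h => absurd (fourier_zero ξ) h

lemma Spec.Md {F : Sch n} {c : Rn n} {R : ℝ} (μ : Rn n) (hF : Spec F c R) :
    Spec (Md μ F) (c + μ) R := fun ξ hξ => by
  rw [fourier_Md] at hξ
  have := hF _ hξ
  rwa [sub_sub, add_comm μ c] at this

/-- The transform of a product is the convolution of the transforms, so where it does not vanish
some pair of frequencies in the two balls adds up to `ξ`. The inverse transforms enter because the
convolution theorem is applied to `𝓕⁻ F` and `𝓕⁻ G`. -/
lemma Spec.mul {F G : Sch n} {R R' : ℝ} (hF : Spec F 0 R) (hG : Spec G 0 R') :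
    Spec (F * G) 0 (R + R') := fun ξ hξ => by
  have hinv : ∀ (H : Sch n) (ζ : Rn n), 𝓕⁻ H ζ = 𝓕 H (-ζ) := fun H ζ => by
    rw [SchwartzMap.fourierInv_coe, Real.fourierInv_eq_fourier_neg, SchwartzMap.fourier_coe]
  have h1 : SchwartzMap.convolution (ContinuousLinearMap.mul ℂ ℂ) (𝓕⁻ F) (𝓕⁻ G) = 𝓕⁻ (F * G) := by
    have : 𝓕 (SchwartzMap.convolution (ContinuousLinearMap.mul ℂ ℂ) (𝓕⁻ F) (𝓕⁻ G)) = F * G := by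
      rw [SchwartzMap.fourier_convolution]; simp; rfl
    rw [← this]; simp
  have h2 := congrArg (fun H : Sch n => H (-ξ)) h1
  simp only [hinv, neg_neg, SchwartzMap.convolution_apply, MeasureTheory.convolution] at h2
  rw [← h2] at hξ
  obtain ⟨t, ht⟩ : ∃ t, 𝓕 F (-t) * 𝓕 G (-(-ξ - t)) ≠ 0 := by
    by_contra hcon
    push Not at hcon
    exact hξ (integral_eq_zero_of_ae (.of_forall fun t => hcon t))
  have a1 := hF _ (left_ne_zero_of_mul ht)
  have a2 := hG _ (right_ne_zero_of_mul ht)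
  calc ‖ξ - 0‖ = ‖(-t - 0) + (-(-ξ - t) - 0)‖ := by congr 1; abel
    _ ≤ R + R' := (norm_add_le _ _).trans (by linarith)

lemma norm_fourier_le (F : Sch n) : ∃ C : ℝ, 0 ≤ C ∧ ∀ ξ, ‖𝓕 F ξ‖ ≤ C :=
  ⟨_, norm_nonneg _, fun ξ => SchwartzMap.norm_fourier_apply_le_toLp_one F ξ⟩

/-- Fields with compactly supported Fourier transform. -/
def BL (F : Sch n) : Prop := ∃ R, Spec F 0 R

/-- Real-valued functions. -/
def IsRealS (F : Sch n) : Prop := ∀ x, (F x).im = 0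

/-- Real-valued band-limited functions. -/
def RBL (F : Sch n) : Prop := IsRealS F ∧ BL F

lemma BL.add {F G : Sch n} (hF : BL F) (hG : BL G) : BL (F + G) := by
  obtain ⟨R, hR⟩ := hF
  obtain ⟨R', hR'⟩ := hG
  exact ⟨max R R', (hR.mono (le_max_left _ _)).add (hR'.mono (le_max_right _ _))⟩
lemma BL.smul {F : Sch n} (c : ℂ) (hF : BL F) : BL (c • F) := hF.imp fun _ h => h.smul c
lemma BL.mul {F G : Sch n} (hF : BL F) (hG : BL G) : BL (F * G) := by
  obtain ⟨R, hR⟩ := hF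
  obtain ⟨R', hR'⟩ := hG
  exact ⟨_, hR.mul hR'⟩
lemma BL.dS {F : Sch n} (l : Fin n) (hF : BL F) : BL (dS l F) := hF.imp fun _ h => h.dS l
lemma BL.zero : BL (0 : Sch n) := ⟨0, Spec.zero _ _⟩
lemma BL.sum {ι : Type*} {s : Finset ι} {F : ι → Sch n} (h : ∀ i ∈ s, BL (F i)) :
    BL (∑ i ∈ s, F i) :=
  Finset.sum_induction _ _ (fun _ _ => BL.add) BL.zero h

lemma IsRealS.add {F G : Sch n} (hF : IsRealS F) (hG : IsRealS G) : IsRealS (F + G) :=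
  fun x => by simp [hF x, hG x]
lemma IsRealS.sub {F G : Sch n} (hF : IsRealS F) (hG : IsRealS G) : IsRealS (F - G) :=
  fun x => by simp [hF x, hG x]
lemma IsRealS.smul {F : Sch n} (c : ℝ) (hF : IsRealS F) : IsRealS ((c : ℂ) • F) :=
  fun x => by simp [hF x]
lemma IsRealS.mul {F G : Sch n} (hF : IsRealS F) (hG : IsRealS G) : IsRealS (F * G) :=
  fun x => by simp [Complex.mul_im, hF x, hG x]
lemma IsRealS.zero : IsRealS (0 : Sch n) := fun x => by simp
lemma IsRealS.sum {ι : Type*} {s : Finset ι} {F : ι → Sch n} (h : ∀ i ∈ s, IsRealS (F i)) :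
    IsRealS (∑ i ∈ s, F i) :=
  Finset.sum_induction _ _ (fun _ _ => IsRealS.add) IsRealS.zero h
lemma IsRealS.dS {F : Sch n} (l : Fin n) (hF : IsRealS F) : IsRealS (dS l F) := fun x => by
  rw [dS_apply]
  have h : HasFDerivAt (fun x => (F x).im) (Complex.imCLM.comp (fderiv ℝ F x)) x :=
    Complex.imCLM.hasFDerivAt.comp x F.differentiableAt.hasFDerivAt
  have h0 : (fun x => (F x).im) = fun _ => 0 := funext hF
  rw [h0] at h
  have := h.unique (hasFDerivAt_const 0 x)
  simpa using congrArg (fun L => L (axis l)) this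
lemma IsRealS.lapS {F : Sch n} (hF : IsRealS F) : IsRealS (lapS F) := by
  rw [lapS_eq]; exact IsRealS.sum fun l _ => (hF.dS l).dS l
lemma BL.lapS {F : Sch n} (hF : BL F) : BL (lapS F) := by
  rw [lapS_eq]; exact BL.sum fun l _ => (hF.dS l).dS l

lemma RBL.add {F G : Sch n} (hF : RBL F) (hG : RBL G) : RBL (F + G) :=
  ⟨hF.1.add hG.1, hF.2.add hG.2⟩
lemma RBL.smul {F : Sch n} (c : ℝ) (hF : RBL F) : RBL ((c : ℂ) • F) := ⟨hF.1.smul c, hF.2.smul _⟩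
lemma RBL.mul {F G : Sch n} (hF : RBL F) (hG : RBL G) : RBL (F * G) :=
  ⟨hF.1.mul hG.1, hF.2.mul hG.2⟩
lemma RBL.dS {F : Sch n} (l : Fin n) (hF : RBL F) : RBL (dS l F) := ⟨hF.1.dS l, hF.2.dS l⟩
lemma RBL.lapS {F : Sch n} (hF : RBL F) : RBL (lapS F) := ⟨hF.1.lapS, hF.2.lapS⟩
lemma RBL.zero : RBL (0 : Sch n) := ⟨IsRealS.zero, BL.zero⟩
lemma RBL.neg {F : Sch n} (hF : RBL F) : RBL (-F) := by simpa using hF.smul (-1)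
lemma RBL.sub {F G : Sch n} (hF : RBL F) (hG : RBL G) : RBL (F - G) := by
  rw [sub_eq_add_neg]; exact hF.add hG.neg

/-! ### Symmetric tensors as sums of squares modulo the identity. -/

/-- Finite real combinations of squares of real band-limited functions. -/
def SqSpan (h : Sch n) : Prop :=
  ∃ (m : ℕ) (a : Fin m → ℝ) (q : Fin m → Sch n), (∀ i, RBL (q i)) ∧
    h = ∑ i, (a i : ℂ) • (q i * q i)

lemma SqSpan.zero : SqSpan (0 : Sch n) := ⟨0, fun _ => 0, fun _ => 0, fun i => i.elim0, by simp⟩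

lemma SqSpan.add {h h' : Sch n} (H : SqSpan h) (H' : SqSpan h') : SqSpan (h + h') := by
  obtain ⟨m, a, q, hq, rfl⟩ := H
  obtain ⟨m', a', q', hq', rfl⟩ := H'
  refine ⟨m + m', Fin.append a a', Fin.append q q', fun i => ?_, ?_⟩
  · refine Fin.addCases (fun i => ?_) (fun i => ?_) i
    · simpa using hq i
    · simpa using hq' i
  · simp [Fin.sum_univ_add]

lemma SqSpan.smul {h : Sch n} (c : ℝ) (H : SqSpan h) : SqSpan ((c : ℂ) • h) := by
  obtain ⟨m, a, q, hq, rfl⟩ := H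
  exact ⟨m, fun i => c * a i, q, hq, by
    rw [Finset.smul_sum]
    refine Finset.sum_congr rfl fun i _ => ?_
    rw [smul_smul]; push_cast; rfl⟩

lemma SqSpan.sum {ι : Type*} {s : Finset ι} {h : ι → Sch n} (H : ∀ i ∈ s, SqSpan (h i)) :
    SqSpan (∑ i ∈ s, h i) :=
  Finset.sum_induction _ _ (fun _ _ => SqSpan.add) SqSpan.zero H

/-- Polarization: `4FG = (F + G)² - (F - G)²`. With the product rule this makes the span stable
under derivatives. -/
lemma SqSpan.mul {F G : Sch n} (hF : RBL F) (hG : RBL G) : SqSpan (F * G) := by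
  refine ⟨2, ![1 / 4, -1 / 4], ![F + G, F - G], fun i => ?_, ?_⟩
  · fin_cases i
    · exact hF.add hG
    · exact hF.sub hG
  · ext x
    simp [Fin.sum_univ_two]
    ring

lemma SqSpan.dS {h : Sch n} (l : Fin n) (H : SqSpan h) : SqSpan (dS l h) := by
  obtain ⟨m, a, q, hq, rfl⟩ := H
  rw [map_sum]
  refine SqSpan.sum fun i _ => ?_
  rw [map_smul, dS_mul]
  exact ((SqSpan.mul ((hq i).dS l) (hq i)).add (SqSpan.mul (hq i) ((hq i).dS l))).smul _

lemma SqSpan.lapS {h : Sch n} (H : SqSpan h) : SqSpan (lapS h) := by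
  rw [lapS_eq]; exact SqSpan.sum fun l _ => (H.dS l).dS l

lemma SqSpan.neg {h : Sch n} (H : SqSpan h) : SqSpan (-h) := by simpa using H.smul (-1)

/-- Continuously differentiable time profiles supported in the unit interval. -/
def TF (c : ℝ → ℝ) : Prop := ContDiff ℝ 1 c ∧ ∀ t ∉ Ioo (0 : ℝ) 1, c t = 0

/-- The tensor `R` is, up to a multiple of the identity, a finite sum of squares
`c² q² d ⊗ d` where each constant vector `d` is orthogonal to some axis. -/
def ConeRep (R : ℝ → Fin n → Fin n → Sch n) : Prop :=
  ∃ (m : ℕ) (c : Fin m → ℝ → ℝ) (q : Fin m → Sch n) (d : Fin m → Fin n → ℝ) (η : Fin m → Fin n)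
    (ρ : ℝ → Sch n), (∀ i, TF (c i)) ∧ (∀ i, RBL (q i)) ∧ (∀ i, d i (η i) = 0) ∧
    ∀ t a b, R t a b + (if a = b then ρ t else 0) =
      ∑ i, (((c i t) ^ 2 * d i a * d i b : ℝ) : ℂ) • (q i * q i)

lemma ConeRep.zero : ConeRep (fun _ _ _ => (0 : Sch n)) :=
  ⟨0, fun _ _ => 0, fun _ => 0, fun _ _ => 0, fun i => i.elim0, fun _ => 0, fun i => i.elim0,
    fun i => i.elim0, fun i => i.elim0, by simp⟩

lemma ConeRep.add {R R' : ℝ → Fin n → Fin n → Sch n} (H : ConeRep R) (H' : ConeRep R') :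
    ConeRep (fun t a b => R t a b + R' t a b) := by
  obtain ⟨m, c, q, d, η, ρ, hc, hq, hd, h⟩ := H
  obtain ⟨m', c', q', d', η', ρ', hc', hq', hd', h'⟩ := H'
  refine ⟨m + m', Fin.append c c', Fin.append q q', Fin.append d d', Fin.append η η',
    fun t => ρ t + ρ' t, fun i => ?_, fun i => ?_, fun i => ?_, fun t a b => ?_⟩
  · refine Fin.addCases (fun i => ?_) (fun i => ?_) i
    · simpa using hc i
    · simpa using hc' i
  · refine Fin.addCases (fun i => ?_) (fun i => ?_) i
    · simpa using hq i
    · simpa using hq' i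
  · refine Fin.addCases (fun i => ?_) (fun i => ?_) i
    · simpa using hd i
    · simpa using hd' i
  · rw [Fin.sum_univ_add]
    simp only [Fin.append_left, Fin.append_right]
    rw [← h, ← h']
    split_ifs <;> abel

lemma ConeRep.sum {ι : Type*} (s : Finset ι) {R : ι → ℝ → Fin n → Fin n → Sch n}
    (H : ∀ i ∈ s, ConeRep (R i)) : ConeRep (fun t a b => ∑ i ∈ s, R i t a b) := by
  classical
  induction s using Finset.induction_on with
  | empty => simpa using ConeRep.zero
  | insert i s hi ih =>
    simp only [Finset.sum_insert hi]
    exact (H i (by simp)).add (ih fun j hj => H j (by simp [hj]))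

/-- Multiples of the identity cost nothing: they are absorbed in `ρ` and end up in the pressure. -/
lemma ConeRep.add_id {R : ℝ → Fin n → Fin n → Sch n} (H : ConeRep R) (ρ₀ : ℝ → Sch n) :
    ConeRep (fun t a b => R t a b + if a = b then ρ₀ t else 0) := by
  obtain ⟨m, c, q, d, η, ρ, hc, hq, hd, h⟩ := H
  refine ⟨m, c, q, d, η, fun t => ρ t - ρ₀ t, hc, hq, hd, fun t a b => ?_⟩
  rw [← h]
  by_cases hab : a = b
  · simp only [hab, if_true]; abel
  · simp only [hab, if_false]; abel

lemma ConeRep.square {c : ℝ → ℝ} (hc : TF c) {q : Sch n} (hq : RBL q) (d : Fin n → ℝ) (η : Fin n)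
    (hd : d η = 0) : ConeRep (fun t a b => (((c t) ^ 2 * d a * d b : ℝ) : ℂ) • (q * q)) :=
  ⟨1, fun _ => c, fun _ => q, fun _ => d, fun _ => η, fun _ => 0, fun _ => hc, fun _ => hq,
    fun _ => hd, fun t a b => by simp⟩

/-- This is where three dimensions enter: a vector supported on two coordinates is orthogonal to
some axis, and that axis can carry the frequency of a transverse wave. -/
lemma exists_third (hn : 3 ≤ n) (i j : Fin n) : ∃ k, k ≠ i ∧ k ≠ j := by
  by_contra h
  push Not at h
  have : (Finset.univ : Finset (Fin n)) ⊆ {i, j} := fun k _ => by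
    by_cases hk : k = i
    · simp [hk]
    · simp [h k hk]
  have := Finset.card_le_card this
  have h2 := Finset.card_le_two (a := i) (b := j)
  simp at this
  omega

/-- Lagrange's identity in tensor form: the vectors `d_i e_j - d_j e_i` have squares summing to `2
(|d|² I - d ⊗ d)`. -/
lemma lagrange_identity (d : Fin n → ℝ) (a b : Fin n) :
    ∑ p : Fin n × Fin n, (d p.1 * (if p.2 = a then 1 else 0) - d p.2 * (if p.1 = a then 1 else 0)) *
      (d p.1 * (if p.2 = b then 1 else 0) - d p.2 * (if p.1 = b then 1 else 0))
      = 2 * ((if a = b then ∑ i, d i ^ 2 else 0) - d a * d b) := by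
  rw [Fintype.sum_prod_type]
  simp only [sub_mul, mul_sub, Finset.sum_sub_distrib]
  have e1 : ∑ x, ∑ y, d x * (if y = a then (1 : ℝ) else 0) * (d x * (if y = b then 1 else 0)) =
      if a = b then ∑ i, d i ^ 2 else 0 := by
    split_ifs with hab
    · subst hab
      simp [pow_two]
    · simp [Ne.symm hab]
  have e2 : ∑ x, ∑ y, d y * (if x = a then (1 : ℝ) else 0) * (d y * (if x = b then 1 else 0)) =
      if a = b then ∑ i, d i ^ 2 else 0 := by
    rw [Finset.sum_comm]; exact e1
  have e3 : ∑ x, ∑ y, d x * (if y = a then (1 : ℝ) else 0) * (d y * (if x = b then 1 else 0)) =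
      d a * d b := by
    simp [mul_comm]
  have e4 : ∑ x, ∑ y, d y * (if x = a then (1 : ℝ) else 0) * (d x * (if y = b then 1 else 0)) =
      d a * d b := by
    simp [mul_comm]
  rw [e1, e2, e3, e4]
  ring

/-- Modulo `|d|² I`, the tensor `-d ⊗ d` is a positive combination of squares by Lagrange's
identity. Each vector occurring there is supported on two coordinates, hence orthogonal to a third
axis even when `d` itself is not orthogonal to any. -/
lemma ConeRep.neg_square (hn : 3 ≤ n) {c : ℝ → ℝ} (hc : TF c) {q : Sch n} (hq : RBL q)
    (d : Fin n → ℝ) : ConeRep (fun t a b => -((((c t) ^ 2 * d a * d b : ℝ) : ℂ) • (q * q))) := by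
  set D : Fin n × Fin n → Fin n → ℝ := fun p a => (Real.sqrt 2)⁻¹ *
    (d p.1 * (if p.2 = a then 1 else 0) - d p.2 * (if p.1 = a then 1 else 0)) with hD
  have h1 : ConeRep (fun t a b => ∑ p, (((c t) ^ 2 * D p a * D p b : ℝ) : ℂ) • (q * q)) :=
    ConeRep.sum _ fun p _ => by
      obtain ⟨k, hk1, hk2⟩ := exists_third hn p.1 p.2
      exact ConeRep.square hc hq (D p) k (by simp [hD, hk1.symm, hk2.symm])
  have h2 := h1.add_id (fun t => -((((c t) ^ 2 * ∑ i, d i ^ 2 : ℝ) : ℂ) • (q * q)))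
  convert h2 using 4 with t a b
  rw [← Finset.sum_smul, ← Complex.ofReal_sum]
  have e : ∑ p, (c t) ^ 2 * D p a * D p b =
      (c t) ^ 2 * ((if a = b then ∑ i, d i ^ 2 else 0) - d a * d b) := by
    have hs : (Real.sqrt 2)⁻¹ * (Real.sqrt 2)⁻¹ = 1 / 2 := by
      rw [← mul_inv, Real.mul_self_sqrt (by norm_num)]; norm_num
    have := lagrange_identity d a b
    calc _ = ∑ p : Fin n × Fin n, (c t) ^ 2 * ((Real.sqrt 2)⁻¹ * (Real.sqrt 2)⁻¹) *
          ((d p.1 * (if p.2 = a then 1 else 0) - d p.2 * (if p.1 = a then 1 else 0)) *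
          (d p.1 * (if p.2 = b then 1 else 0) - d p.2 * (if p.1 = b then 1 else 0))) :=
          Finset.sum_congr rfl fun p _ => by rw [hD]; ring
      _ = _ := by rw [← Finset.mul_sum, this, hs]; ring
  rw [e]
  split_ifs with hab
  · rw [← sub_eq_add_neg, ← sub_smul, ← neg_smul]
    congr 1
    push_cast
    ring
  · rw [← neg_smul, add_zero]
    congr 1
    push_cast
    ring

/-- Time profiles which are unchanged by the cutoff `κ`. -/
def Cut (κ τ : ℝ → ℝ) : Prop := ContDiff ℝ 1 τ ∧ ∀ t, κ t * τ t = τ t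

lemma Cut.half_add {κ τ : ℝ → ℝ} (hκ : TF κ) (h : Cut κ τ) :
    TF (fun t => (κ t + τ t) / 2) := by
  refine ⟨(hκ.1.add h.1).div_const _, fun t ht => ?_⟩
  have := h.2 t
  rw [hκ.2 t ht, zero_mul] at this
  simp [hκ.2 t ht, ← this]

lemma Cut.half_sub {κ τ : ℝ → ℝ} (hκ : TF κ) (h : Cut κ τ) :
    TF (fun t => (κ t - τ t) / 2) := by
  refine ⟨(hκ.1.sub h.1).div_const _, fun t ht => ?_⟩
  have := h.2 t
  rw [hκ.2 t ht, zero_mul] at this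
  simp [hκ.2 t ht, ← this]

lemma exists_zero_coord (hn : 3 ≤ n) (k l : Fin n) (s : ℝ) :
    ∃ η : Fin n, (fun a : Fin n => ((if k = a then 1 else 0) + s * (if l = a then 1 else 0)) / 2) η
      = (0 : ℝ) := by
  obtain ⟨η, h1, h2⟩ := exists_third hn k l
  exact ⟨η, by simp [h1.symm, h2.symm]⟩

/-- The symmetric unit tensor is the difference of the squares of `(e_k ± e_l) / 2`, and `τ = κ τ`
is the difference of the squares of `(κ ± τ) / 2`. Multiplying out gives four squares, the two
negative ones being handled by `ConeRep.neg_square`. Thus `τ` may change sign and no square root of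
a time profile is taken. -/
lemma ConeRep.sym_unit (hn : 3 ≤ n) {κ τ : ℝ → ℝ} (hκ : TF κ) (h : Cut κ τ) {q : Sch n}
    (hq : RBL q) (k l : Fin n) :
    ConeRep (fun t a b => ((τ t * (((if k = a then 1 else 0) * (if l = b then 1 else 0) +
      (if l = a then 1 else 0) * (if k = b then 1 else 0)) / 2) : ℝ) : ℂ) • (q * q)) := by
  obtain ⟨η₁, hη₁⟩ := exists_zero_coord hn k l 1
  obtain ⟨η₂, hη₂⟩ := exists_zero_coord hn k l (-1)
  have h1 := ConeRep.square (h.half_add hκ) hq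
    (fun a : Fin n => ((if k = a then 1 else 0) + 1 * (if l = a then 1 else 0)) / 2) η₁ hη₁
  have h2 := ConeRep.neg_square hn (h.half_sub hκ) hq
    (fun a : Fin n => ((if k = a then 1 else 0) + 1 * (if l = a then 1 else 0)) / 2)
  have h3 := ConeRep.neg_square hn (h.half_add hκ) hq
    (fun a : Fin n => ((if k = a then 1 else 0) + (-1) * (if l = a then 1 else 0)) / 2)
  have h4 := ConeRep.square (h.half_sub hκ) hq
    (fun a : Fin n => ((if k = a then 1 else 0) + (-1) * (if l = a then 1 else 0)) / 2) η₂ hη₂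
  convert ((h1.add h2).add h3).add h4 using 4 with t a b
  simp only [← neg_smul, ← add_smul]
  congr 1
  have := h.2 t
  rw [← Complex.ofReal_neg, ← Complex.ofReal_neg, ← Complex.ofReal_add, ← Complex.ofReal_add,
    ← Complex.ofReal_add]
  congr 1
  linear_combination (-((((if k = a then 1 else 0) * (if l = b then 1 else 0) +
      (if l = a then 1 else 0) * (if k = b then 1 else 0)) / 2) : ℝ)) * this

lemma sum_symmetrize (z : Fin n → Fin n → ℂ) (a b : Fin n) :
    ∑ k, ∑ l, ((if k = a then 1 else 0) * (if l = b then 1 else 0) +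
      (if l = a then 1 else 0) * (if k = b then 1 else 0)) * z k l = z a b + z b a := by
  simp [add_mul, Finset.sum_add_distrib]

/-- Expand in symmetric unit tensors. The coefficients of the squares may be negative, but they can
be absorbed in the time profile, whose sign is irrelevant. -/
lemma ConeRep.tensor (hn : 3 ≤ n) {κ τ : ℝ → ℝ} (hκ : TF κ) (h : Cut κ τ)
    {H : Fin n → Fin n → Sch n} (hsymm : ∀ a b, H a b = H b a) (hH : ∀ a b, SqSpan (H a b)) :
    ConeRep (fun t a b => (τ t : ℂ) • H a b) := by
  choose m α q hq hsum using hH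
  have h1 : ConeRep (fun t a b => ∑ k : Fin n, ∑ l : Fin n, ∑ i : Fin (m k l),
      ((α k l i * τ t * (((if k = a then 1 else 0) * (if l = b then 1 else 0) +
      (if l = a then 1 else 0) * (if k = b then 1 else 0)) / 2) : ℝ) : ℂ) •
        (q k l i * q k l i)) :=
    ConeRep.sum _ fun k _ => ConeRep.sum _ fun l _ => ConeRep.sum _ fun i _ =>
      ConeRep.sym_unit hn hκ (τ := fun t => α k l i * τ t)
        ⟨contDiff_const.mul h.1, fun t => by rw [mul_left_comm, h.2 t]⟩ (hq k l i) k l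
  convert h1 using 4 with t a b
  have e : ∀ k l, ∑ i : Fin (m k l),
      ((α k l i * τ t * (((if k = a then 1 else 0) * (if l = b then 1 else 0) +
      (if l = a then 1 else 0) * (if k = b then 1 else 0)) / 2) : ℝ) : ℂ) •
        (q k l i * q k l i) = ((τ t * (((if k = a then 1 else 0) * (if l = b then 1 else 0) +
      (if l = a then 1 else 0) * (if k = b then 1 else 0)) / 2) : ℝ) : ℂ) • H k l := fun k l => by
    rw [hsum k l, Finset.smul_sum]
    refine Finset.sum_congr rfl fun i _ => ?_
    rw [smul_smul]
    congr 1
    push_cast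
    ring
  simp only [e]
  ext x
  have e2 := sum_symmetrize (fun k l => H k l x) a b
  simp only [smul_apply, sum_apply, smul_eq_mul]
  calc (τ t : ℂ) * H a b x = (τ t / 2 : ℂ) * (H a b x + H b a x) := by rw [hsymm b a]; ring
    _ = _ := by
      rw [← e2, Finset.mul_sum]
      refine Finset.sum_congr rfl fun k _ => ?_
      rw [Finset.mul_sum]
      refine Finset.sum_congr rfl fun l _ => ?_
      push_cast [apply_ite ((↑) : ℝ → ℂ)]
      ring

/-! ### The low-frequency profile. -/

lemma exists_rbl_ne_zero (n : ℕ) : ∃ ψ : Sch n, RBL ψ ∧ ψ ≠ 0 := by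
  let b : ContDiffBump (0 : Rn n) := ⟨1, 2, by norm_num, by norm_num⟩
  have hsm : ContDiff ℝ ∞ (fun ξ : Rn n => ((b ξ : ℝ) : ℂ)) :=
    Complex.ofRealCLM.contDiff.comp b.contDiff
  have hcs : HasCompactSupport (fun ξ : Rn n => ((b ξ : ℝ) : ℂ)) :=
    b.hasCompactSupport.comp_left (g := fun y : ℝ => (y : ℂ)) (by simp)
  let B : Sch n := hcs.toSchwartzMap hsm
  have hB : ∀ ξ, B ξ = ((b ξ : ℝ) : ℂ) := fun ξ => rfl
  refine ⟨𝓕⁻ B, ⟨fun x => ?_, 2, fun ξ hξ => ?_⟩, fun h0 => ?_⟩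
  -- A real even bump has a real inverse transform.
  · rw [← Complex.conj_eq_iff_im, SchwartzMap.fourierInv_coe, Real.fourierInv_eq',
      ← integral_conj, ← integral_neg_eq_self]
    refine integral_congr_ae (.of_forall fun v => ?_)
    simp only [smul_eq_mul, map_mul, map_neg, ← Complex.exp_conj, hB, Complex.conj_ofReal, Complex.conj_I,
      b.neg, inner_neg_left, mul_neg, neg_mul, Complex.ofReal_neg, neg_neg]
  · rw [FourierTransform.fourier_fourierInv_eq, hB] at hξ
    have : ξ ∈ Function.support b := by simpa using hξ
    rw [b.support_eq] at this
    rw [Metric.mem_ball, dist_zero_right] at this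
    rw [sub_zero]
    exact this.le
  · have h1 : B = 0 := by
      have := congrArg (fun H : Sch n => 𝓕 H) h0
      rw [FourierTransform.fourier_fourierInv_eq] at this
      rw [this]
      ext ξ
      simp
    have h2 := congrArg (fun H : Sch n => H 0) h1
    have h3 : b 0 = 1 := b.one_of_mem_closedBall (Metric.mem_closedBall_self b.rIn_pos.le)
    simp only [hB] at h2
    rw [h3] at h2
    simp at h2

/-- At the origin the transform is `∫ ψ²`, which is positive for a nonzero real continuous function.
-/
lemma fourier_square_zero_ne_zero {ψ : Sch n} (h : RBL ψ) (h0 : ψ ≠ 0) : 𝓕 (ψ * ψ) 0 ≠ 0 := by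
  have hre : ∀ x, ψ x = ((ψ x).re : ℂ) := fun x => Complex.ext (by simp) (by simp [h.1 x])
  have h1 : 𝓕 (ψ * ψ) 0 = ((∫ x, (ψ x).re ^ 2 : ℝ) : ℂ) := by
    rw [SchwartzMap.fourier_coe, Real.fourier_eq', ← integral_complex_ofReal]
    refine integral_congr_ae (.of_forall fun x => ?_)
    simp only [inner_zero_right, mul_apply]
    rw [hre x]
    simp
    ring
  rw [h1]
  intro h2
  have h3 : ∫ x, (ψ x).re ^ 2 = 0 := by exact_mod_cast h2
  have hint : Integrable (fun x => (ψ x).re ^ 2) := by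
    have := (ψ * ψ).integrable.re (μ := volume)
    refine this.congr (.of_forall fun x => ?_)
    simp [h.1 x, pow_two]
  rw [integral_eq_zero_iff_of_nonneg (fun x => sq_nonneg _) hint] at h3
  have hc : Continuous (fun x => (ψ x).re ^ 2) := (Complex.continuous_re.comp ψ.continuous).pow 2
  have h4 := (hc.ae_eq_iff_eq volume (continuous_const (y := (0 : ℝ)))).1 h3
  apply h0
  ext x
  rw [hre x]
  have := congrFun h4 x
  simp at this
  simp [this]

lemma exists_fourier_ne_zero {P : Sch n} (hP : 𝓕 P 0 ≠ 0) (i : Fin n) :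
    ∃ ξ : Rn n, ξ i ≠ 0 ∧ 𝓕 P ξ ≠ 0 := by
  have hc : ContinuousAt (fun s : ℝ => 𝓕 P (s • axis i)) 0 := by
    have : Continuous (fun s : ℝ => 𝓕 P (s • axis i)) := by fun_prop
    exact this.continuousAt
  have h1 : ∀ᶠ s : ℝ in 𝓝 0, 𝓕 P (s • axis i) ≠ 0 := hc.eventually_ne (by simpa using hP)
  have h2 : ∀ᶠ s : ℝ in 𝓝[≠] 0, 𝓕 P (s • axis i) ≠ 0 ∧ s ≠ 0 :=
    (h1.filter_mono nhdsWithin_le_nhds).and self_mem_nhdsWithin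
  obtain ⟨s, hs, hs0⟩ := h2.exists
  exact ⟨s • axis i, by simpa [axis] using hs0, hs⟩

/-- The low-frequency profile, together with its decomposition into squares. -/
structure Profile (n : ℕ) where
  θ : ℝ → ℝ
  U : Fin n → Sch n
  m : ℕ
  c : Fin m → ℝ → ℝ
  q : Fin m → Sch n
  d : Fin m → Fin n → ℝ
  η : Fin m → Fin n
  ρ : ℝ → Sch n
  θ_tf : TF θ
  θ_half : θ (1 / 2) = 1
  U_rbl : ∀ k, RBL (U k)
  U_div : ∑ k, dS k (U k) = 0
  U_low : ∃ A, 0 ≤ A ∧ ∀ k ξ, ‖𝓕 (U k) ξ‖ ≤ A * ‖ξ‖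
  U_ne : ∃ k, ∃ ξ, ξ ≠ 0 ∧ 𝓕 (U k) ξ ≠ 0
  c_tf : ∀ i, TF (c i)
  q_rbl : ∀ i, RBL (q i)
  d_eta : ∀ i, d i (η i) = 0
  eq : ∀ t a, ((deriv θ t : ℝ) : ℂ) • U a - (θ t : ℂ) • lapS (U a) +
    ((θ t ^ 2 : ℝ) : ℂ) • ∑ b, dS b (U a * U b) +
    ∑ b, ∑ i, (((c i t) ^ 2 * d i a * d i b : ℝ) : ℂ) • dS b (q i * q i) = dS a (ρ t)

/-- Nested bumps about `1/2`: `κ` equals `1` on the ball of radius `1/4` containing the support of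
`θ` and of its derivative, and vanishes from distance `3/8 < 1/2` on. -/
lemma exists_time_profile : ∃ θ κ : ℝ → ℝ, ContDiff ℝ ∞ θ ∧ TF κ ∧ θ (1 / 2) = 1 ∧
    (∀ t, κ t * θ t = θ t) ∧ ∀ t, κ t * deriv θ t = deriv θ t := by
  let b : ContDiffBump (1 / 2 : ℝ) := ⟨1 / 8, 1 / 4, by norm_num, by norm_num⟩
  let κ : ContDiffBump (1 / 2 : ℝ) := ⟨1 / 4, 3 / 8, by norm_num, by norm_num⟩
  have hone : ∀ t ∈ tsupport b, κ t = 1 := fun t ht => by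
    rw [b.tsupport_eq] at ht
    exact κ.one_of_mem_closedBall ht
  refine ⟨b, κ, b.contDiff, ⟨κ.contDiff, fun t ht => ?_⟩, ?_, fun t => ?_, fun t => ?_⟩
  · refine κ.zero_of_le_dist ?_
    rw [Real.dist_eq]
    change (3 / 8 : ℝ) ≤ _
    rw [le_abs]
    by_contra hcon
    push Not at hcon
    exact ht ⟨by linarith, by linarith⟩
  · exact b.one_of_mem_closedBall (Metric.mem_closedBall_self (by norm_num [b]))
  · by_cases h : t ∈ tsupport b
    · rw [hone t h, one_mul]
    · rw [image_eq_zero_of_notMem_tsupport h, mul_zero]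
  · by_cases h : t ∈ tsupport b
    · rw [hone t h, one_mul]
    · have : deriv b t = 0 := by
        by_contra hne
        exact h (support_deriv_subset (Function.mem_support.2 hne))
      rw [this, mul_zero]

/-- With `Φ` a rotated gradient of `ψ²` and `U = ΔΦ`, the stress `-θ' (∇Φ + ∇Φᵀ) + θ (∇U + ∇Uᵀ) - θ²
U ⊗ U` has divergence `-θ' U + θ ΔU - θ² div (U ⊗ U)`. Its entries are spanned by squares, so
`ConeRep.tensor` applies term by term; the identity part becomes the gradient of `ρ`. -/
lemma exists_profile (hn : 3 ≤ n) : Nonempty (Profile n) := by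
  obtain ⟨ψ, hψ, hψ0⟩ := exists_rbl_ne_zero n
  obtain ⟨θ, κ, hθ, hκ, hhalf, hκθ, hκθ'⟩ := exists_time_profile
  set P := ψ * ψ with hP
  have hPs : SqSpan P := SqSpan.mul hψ hψ
  have hPr : RBL P := hψ.mul hψ
  let i₀ : Fin n := ⟨0, by omega⟩
  let i₁ : Fin n := ⟨1, by omega⟩
  have hne : i₀ ≠ i₁ := by simp [i₀, i₁]
  obtain ⟨ξ₀, hξ₁, hξP⟩ := exists_fourier_ne_zero (fourier_square_zero_ne_zero hψ hψ0) i₁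
  let Φ : Fin n → Sch n := fun k => if k = i₀ then dS i₁ P else if k = i₁ then -dS i₀ P else 0
  have hΦs : ∀ k, SqSpan (Φ k) := fun k => by
    simp only [Φ]; split_ifs
    · exact hPs.dS _
    · exact (hPs.dS _).neg
    · exact SqSpan.zero
  have hΦr : ∀ k, RBL (Φ k) := fun k => by
    simp only [Φ]; split_ifs
    · exact hPr.dS _
    · exact (hPr.dS _).neg
    · exact RBL.zero
  have hdivΦ : ∑ k, dS k (Φ k) = 0 := by
    have : ∀ k, dS k (Φ k) = (if k = i₀ then dS i₀ (dS i₁ P) else 0) +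
        (if k = i₁ then -dS i₀ (dS i₁ P) else 0) := fun k => by
      by_cases h0 : k = i₀
      · subst h0; simp [Φ, hne]
      · by_cases h1 : k = i₁
        · subst h1; simp [Φ, hne.symm, dS_comm i₁ i₀]
        · simp [Φ, h0, h1]
    simp [this, Finset.sum_add_distrib]
  -- The Laplacian serves twice: it makes `U` itself the divergence of a symmetric gradient, and it
  -- makes the transform vanish at the origin.
  let U : Fin n → Sch n := fun k => lapS (Φ k)
  have hdivU : ∑ k, dS k (U k) = 0 := by
    simp only [U, dS_lapS]
    rw [← map_sum, hdivΦ, map_zero]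
  have hUr : ∀ k, RBL (U k) := fun k => (hΦr k).lapS
  have hUs : ∀ k, SqSpan (U k) := fun k => (hΦs k).lapS
  -- For solenoidal `V` the transposed gradient is divergence free, so the symmetric gradient has
  -- divergence `ΔV`.
  have symdiv : ∀ V : Fin n → Sch n, (∑ k, dS k (V k) = 0) → ∀ a,
      ∑ b, dS b (dS b (V a) + dS a (V b)) = lapS (V a) := fun V hV a => by
    simp only [map_add, Finset.sum_add_distrib, ← lapS_eq]
    have : ∑ b, dS b (dS a (V b)) = 0 := by
      simp only [dS_comm _ a]
      rw [← map_sum, hV, map_zero]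
    rw [this, add_zero]
  have hθ1 : ContDiff ℝ 1 θ := hθ.of_le (by exact_mod_cast le_top)
  have hθ'1 : ContDiff ℝ 1 (deriv θ) :=
    (contDiff_infty_iff_deriv.1 hθ).2.of_le (by exact_mod_cast le_top)
  have hc1 : Cut κ (fun t => -deriv θ t) := ⟨hθ'1.neg, fun t => by rw [mul_neg, hκθ']⟩
  have hc2 : Cut κ θ := ⟨hθ1, hκθ⟩
  have hc3 : Cut κ (fun t => -(θ t ^ 2)) := ⟨(hθ1.pow 2).neg, fun t => by
    change κ t * -(θ t ^ 2) = -(θ t ^ 2)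
    rw [mul_neg, pow_two, ← mul_assoc, hκθ]⟩
  have r1 := ConeRep.tensor hn hκ hc1 (H := fun a b => dS b (Φ a) + dS a (Φ b))
    (fun a b => add_comm _ _) (fun a b => ((hΦs a).dS b).add ((hΦs b).dS a))
  have r2 := ConeRep.tensor hn hκ hc2 (H := fun a b => dS b (U a) + dS a (U b))
    (fun a b => add_comm _ _) (fun a b => ((hUs a).dS b).add ((hUs b).dS a))
  have r3 := ConeRep.tensor hn hκ hc3 (H := fun a b => U a * U b)
    (fun a b => by ext x; simp [mul_comm]) (fun a b => SqSpan.mul (hUr a) (hUr b))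
  obtain ⟨m, c, q, d, η, ρ, hc, hq, hd, heq⟩ := (r1.add r2).add r3
  have hΦb : ∀ k, ∃ A, 0 ≤ A ∧ ∀ ξ, ‖𝓕 (U k) ξ‖ ≤ A * ‖ξ‖ := fun k => by
    obtain ⟨R, hR⟩ := (hΦr k).2
    obtain ⟨C, hC0, hC⟩ := norm_fourier_le (Φ k)
    refine ⟨(2 * Real.pi) ^ 2 * |R| * C, by positivity, fun ξ => ?_⟩
    simp only [U]
    rw [fourier_lapS]
    by_cases h0 : 𝓕 (Φ k) ξ = 0
    · rw [h0, mul_zero, norm_zero]; positivity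
    have h1 := hR ξ h0
    rw [sub_zero] at h1
    rw [norm_mul, norm_neg, Complex.norm_real, Real.norm_of_nonneg (by positivity)]
    calc (2 * Real.pi) ^ 2 * ‖ξ‖ ^ 2 * ‖𝓕 (Φ k) ξ‖
        ≤ (2 * Real.pi) ^ 2 * (|R| * ‖ξ‖) * C := by
          gcongr
          · rw [pow_two]; gcongr; exact h1.trans (le_abs_self R)
          · exact hC ξ
      _ = _ := by ring
  choose A hA0 hA using hΦb
  refine ⟨⟨θ, U, m, c, q, d, η, ρ, ⟨hθ1, fun t ht => ?_⟩, hhalf, hUr, hdivU,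
    ⟨∑ k, A k, Finset.sum_nonneg fun k _ => hA0 k, fun k ξ => (hA k ξ).trans ?_⟩,
    ⟨i₀, ξ₀, ?_, ?_⟩, hc, hq, hd, fun t a => ?_⟩⟩
  · rw [← hκθ, hκ.2 t ht, zero_mul]
  · gcongr
    exact Finset.single_le_sum (f := A) (fun k _ => hA0 k) (Finset.mem_univ k)
  · rintro rfl; simp at hξ₁
  · have hξ0 : ξ₀ ≠ 0 := by rintro rfl; simp at hξ₁
    have hξP' : 𝓕 P ξ₀ ≠ 0 := hξP
    simp only [U, Φ, if_true]
    rw [fourier_lapS, fourier_dS]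
    have : ((((2 * Real.pi) ^ 2 * ‖ξ₀‖ ^ 2 : ℝ)) : ℂ) ≠ 0 := by
      have := Real.pi_pos
      have := norm_pos_iff.2 hξ0
      exact_mod_cast (by positivity : (2 * Real.pi) ^ 2 * ‖ξ₀‖ ^ 2 ≠ 0)
    have hpi : (Real.pi : ℂ) ≠ 0 := by exact_mod_cast Real.pi_ne_zero
    have h1 : ((ξ₀ i₁ : ℝ) : ℂ) ≠ 0 := by exact_mod_cast hξ₁
    simp only [ne_eq, mul_eq_zero, neg_eq_zero, this, hpi, h1, hξP', Complex.I_ne_zero,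
      OfNat.ofNat_ne_zero, or_self, not_false_eq_true]
  · have h1 : ∑ b, dS b ((((-deriv θ t : ℝ) : ℂ) • (dS b (Φ a) + dS a (Φ b)) +
        (θ t : ℂ) • (dS b (U a) + dS a (U b)) + ((-(θ t ^ 2) : ℝ) : ℂ) • (U a * U b)) +
        (if a = b then ρ t else 0)) = ∑ b, ∑ i,
        (((c i t) ^ 2 * d i a * d i b : ℝ) : ℂ) • dS b (q i * q i) := by
      refine Finset.sum_congr rfl fun b _ => ?_
      rw [heq t a b, map_sum]
      simp only [map_smul]
    rw [← h1]
    have h2 := symdiv Φ hdivΦ a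
    have h3 := symdiv U hdivU a
    have h4 : ∑ b, dS b (if a = b then ρ t else 0) = dS a (ρ t) := by
      have : ∀ b, dS b (if a = b then ρ t else 0) = if a = b then dS b (ρ t) else 0 := fun b => by
        split_ifs <;> simp
      simp [this]
    have h5 : ∑ b, dS b ((((-deriv θ t : ℝ) : ℂ) • (dS b (Φ a) + dS a (Φ b)) +
        (θ t : ℂ) • (dS b (U a) + dS a (U b)) + ((-(θ t ^ 2) : ℝ) : ℂ) • (U a * U b)) +
        (if a = b then ρ t else 0)) = ((-deriv θ t : ℝ) : ℂ) • U a + (θ t : ℂ) • lapS (U a) +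
          ((-(θ t ^ 2) : ℝ) : ℂ) • ∑ b, dS b (U a * U b) + dS a (ρ t) := by
      rw [← h4, ← h3, show ((-deriv θ t : ℝ) : ℂ) • U a = ((-deriv θ t : ℝ) : ℂ) •
        ∑ b, dS b (dS b (Φ a) + dS a (Φ b)) from by rw [h2]]
      rw [Finset.smul_sum, Finset.smul_sum, Finset.smul_sum, ← Finset.sum_add_distrib,
        ← Finset.sum_add_distrib, ← Finset.sum_add_distrib]
      refine Finset.sum_congr rfl fun b _ => ?_
      rw [map_add, map_add, map_add, map_smul, map_smul, map_smul]
    rw [h5]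
    push_cast
    simp only [neg_smul]
    abel

/-! ### Heat flow, Leray projection and Duhamel's formula. -/

/-- The bilinear pairing of Schwartz functions. -/
def pr (φ F : Sch n) : ℂ := ∫ x, φ x * F x

lemma pr_multS {m : Rn n → ℝ} (hm : IsSymbol m) (φ F : Sch n) :
    pr φ (multS m F) = ∫ ξ, 𝓕⁻ φ ξ * ((m ((2 * Real.pi) • ξ) : ℂ) * 𝓕 F ξ) := by
  have h := SchwartzMap.integral_fourierInv_mul_eq φ (𝓕 (multS m F))
  rw [FourierTransform.fourierInv_fourier_eq] at h
  simp only [fourier_multS hm] at h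
  exact h.symm

lemma pr_sum {ι : Type*} (s : Finset ι) (φ : Sch n) (F : ι → Sch n) :
    pr φ (∑ i ∈ s, F i) = ∑ i ∈ s, pr φ (F i) := by
  unfold pr
  rw [← integral_finsetSum _ fun i _ => integrable_mul φ (F i)]
  simp [Finset.mul_sum]

lemma pr_smul (c : ℂ) (φ F : Sch n) : pr φ (c • F) = c * pr φ F := by
  unfold pr
  rw [← integral_const_mul]
  refine integral_congr_ae (.of_forall fun x => ?_)
  simp; ring

lemma multS_add (m : Rn n → ℝ) (F G : Sch n) : multS m (F + G) = multS m F + multS m G :=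
  map_add _ _ _
lemma multS_smul (m : Rn n → ℝ) (c : ℂ) (F : Sch n) : multS m (c • F) = c • multS m F :=
  map_smul _ _ _
lemma multS_sum {ι : Type*} (s : Finset ι) (m : Rn n → ℝ) (F : ι → Sch n) :
    multS m (∑ i ∈ s, F i) = ∑ i ∈ s, multS m (F i) := map_sum _ _ _

variable {χ : Rn n → ℝ}

lemma heatSymbol_contDiff (hχ : IsLittlewoodPaley χ) (j : ℤ) (t : ℝ) : ContDiff ℝ ∞ (heatSymbol χ j t) :=
  (blockSymbol_contDiff hχ j).mul (Real.contDiff_exp.comp (contDiff_const.mul (contDiff_norm_sq ℝ)))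

lemma isSymbol_heatSymbol (hχ : IsLittlewoodPaley χ) (j : ℤ) (t : ℝ) : IsSymbol (heatSymbol χ j t) :=
  isSymbol_of_support (heatSymbol_contDiff hχ j t)
    fun _ h => (norm_of_blockSymbol_ne_zero hχ (left_ne_zero_of_mul h)).2

lemma isSymbol_lerayHeatSymbol (hχ : IsLittlewoodPaley χ) (j : ℤ) (t : ℝ) (k l : Fin n) :
    IsSymbol (lerayHeatSymbol χ j t k l) := by
  refine isSymbol_of_support (contDiff_iff_contDiffAt.2 fun ξ => ?_) fun _ h =>
    (norm_of_blockSymbol_ne_zero hχ (left_ne_zero_of_mul (left_ne_zero_of_mul h))).2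
  by_cases hξ : ξ = 0
  · have : lerayHeatSymbol χ j t k l =ᶠ[𝓝 ξ] fun _ => 0 := by
      have hp : (0 : ℝ) < 2 ^ (j - 1) := by positivity
      filter_upwards [Metric.ball_mem_nhds ξ hp] with ζ hζ
      have h0 : blockSymbol χ j ζ = 0 := by
        by_contra hne
        have := (norm_of_blockSymbol_ne_zero hχ hne).1
        rw [hξ, Metric.mem_ball, dist_zero_right] at hζ
        linarith
      simp [lerayHeatSymbol, heatSymbol, h0]
    exact contDiffAt_const.congr_of_eventuallyEq this
  · have hco : ∀ i : Fin n, ContDiff ℝ ∞ (fun ζ : Rn n => ζ i) := fun i =>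
      (EuclideanSpace.proj (𝕜 := ℝ) i).contDiff
    refine (heatSymbol_contDiff hχ j t).contDiffAt.mul (contDiffAt_const.sub ?_)
    refine ((hco k).contDiffAt.mul (hco l).contDiffAt).div (contDiff_norm_sq ℝ).contDiffAt ?_
    simpa using hξ

lemma lerayHeat_toDist (hχ : IsLittlewoodPaley χ) (j : ℤ) (t : ℝ) (W : Fin n → Sch n) (φ : Sch n) :
    lerayHeat χ j t (toDist W) φ =
      WithLp.toLp 2 (fun k => pr φ (∑ l, multS (lerayHeatSymbol χ j t k l) (W l))) := by
  unfold lerayHeat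
  congr 1
  ext k
  rw [pr_sum]
  refine Finset.sum_congr rfl fun l _ => ?_
  rw [mult_toDist (isSymbol_lerayHeatSymbol hχ j t k l), toDist_apply_apply]
  rfl

/-- The matrix `δ_{kl} - ξ_k ξ_l / |ξ|²` annihilates `ξ`; this is why the profile equation is only
needed up to a pressure gradient. -/
lemma leray_gradient (hχ : IsLittlewoodPaley χ) (j : ℤ) (t : ℝ) (k : Fin n) (p : Sch n) :
    ∑ l, multS (lerayHeatSymbol χ j t k l) (dS l p) = 0 := by
  refine sch_ext_fourier fun ξ => ?_
  rw [fourier_sum, fourier_zero]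
  simp only [fourier_multS (isSymbol_lerayHeatSymbol hχ j t k _), fourier_dS]
  by_cases hξ : ξ = 0
  · simp [hξ]
  have key : ∑ l, ((if k = l then (1 : ℝ) else 0) - ((2 * Real.pi) • ξ) k * ((2 * Real.pi) • ξ) l /
      ‖(2 * Real.pi) • ξ‖ ^ 2) * ξ l = 0 := by
    have hn : ‖ξ‖ ^ 2 ≠ 0 := by simpa using hξ
    have hs : ∑ l, ξ l * ξ l = ‖ξ‖ ^ 2 := by
      rw [EuclideanSpace.norm_sq_eq]; simp [pow_two]
    have hpi := Real.pi_ne_zero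
    have e : ∀ l, ((if k = l then (1 : ℝ) else 0) - ((2 * Real.pi) • ξ) k * ((2 * Real.pi) • ξ) l /
      ‖(2 * Real.pi) • ξ‖ ^ 2) * ξ l = (if k = l then ξ l else 0) - ξ k / ‖ξ‖ ^ 2 * (ξ l * ξ l) := by
      intro l
      rw [norm_smul, mul_pow, Real.norm_of_nonneg (by positivity)]
      simp only [PiLp.smul_apply, smul_eq_mul]
      split_ifs <;> field_simp
      ring
    simp only [e, Finset.sum_sub_distrib, ← Finset.mul_sum, hs]
    simp
    field_simp
    simp
  calc _ = ∑ l, (heatSymbol χ j t ((2 * Real.pi) • ξ) * (2 * Real.pi * Complex.I * 𝓕 p ξ)) *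
        ((((if k = l then (1 : ℝ) else 0) - ((2 * Real.pi) • ξ) k * ((2 * Real.pi) • ξ) l /
      ‖(2 * Real.pi) • ξ‖ ^ 2) * ξ l : ℝ) : ℂ) := by
        refine Finset.sum_congr rfl fun l _ => ?_
        unfold lerayHeatSymbol
        push_cast
        ring
    _ = 0 := by
        rw [← Finset.mul_sum, ← Complex.ofReal_sum, key]
        simp

lemma leray_solenoidal (hχ : IsLittlewoodPaley χ) (j : ℤ) (t : ℝ) (k : Fin n) {W : Fin n → Sch n} (hW : ∑ l, dS l (W l) = 0) :
    ∑ l, multS (lerayHeatSymbol χ j t k l) (W l) = multS (heatSymbol χ j t) (W k) := by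
  refine sch_ext_fourier fun ξ => ?_
  rw [fourier_sum, fourier_multS (isSymbol_heatSymbol hχ j t)]
  simp only [fourier_multS (isSymbol_lerayHeatSymbol hχ j t k _)]
  have hdiv : ∑ l, (ξ l : ℂ) * 𝓕 (W l) ξ = 0 := by
    have h1 := congrArg (fun F : Sch n => 𝓕 F ξ) hW
    simp only [fourier_sum, fourier_dS, fourier_zero] at h1
    have hpi : (Real.pi : ℂ) ≠ 0 := by exact_mod_cast Real.pi_ne_zero
    have h2 : (2 * Real.pi * Complex.I) * ∑ l, (ξ l : ℂ) * 𝓕 (W l) ξ = 0 := by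
      rw [← h1, Finset.mul_sum]
      exact Finset.sum_congr rfl fun l _ => by ring
    have h3 : (2 * Real.pi * Complex.I : ℂ) ≠ 0 := by simp [hpi]
    exact (mul_eq_zero.1 h2).resolve_left h3
  set h := (heatSymbol χ j t ((2 * Real.pi) • ξ) : ℂ)
  set a := (((2 * Real.pi) • ξ) k * (2 * Real.pi) / ‖(2 * Real.pi) • ξ‖ ^ 2 : ℝ)
  calc _ = ∑ l, ((if k = l then h * 𝓕 (W l) ξ else 0) - h * a * ((ξ l : ℂ) * 𝓕 (W l) ξ)) := by
        refine Finset.sum_congr rfl fun l _ => ?_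
        unfold lerayHeatSymbol
        simp only [a, h, PiLp.smul_apply, smul_eq_mul]
        split_ifs <;> push_cast <;> ring
    _ = _ := by
        rw [Finset.sum_sub_distrib, ← Finset.mul_sum, hdiv]
        simp

/-- Differentiate the Gaussian factor under the integral. The block confines `|ξ|` to at most `2 ^
(j + 1)`, which dominates the integrand even when `t - τ` is negative, so no one-sided argument is
needed at `τ = t`. -/
lemma hasDerivAt_heat (hχ : IsLittlewoodPaley χ) (j : ℤ) (t τ : ℝ) (φ V : Sch n) :
    HasDerivAt (fun τ => pr φ (multS (heatSymbol χ j (t - τ)) V))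
      (pr φ (multS (heatSymbol χ j (t - τ)) (-lapS V))) τ := by
  simp only [pr_multS (isSymbol_heatSymbol hχ j _)]
  set B : ℝ := (2 : ℝ) ^ (j + 1)
  have hcont : ∀ m : Rn n → ℝ, ContDiff ℝ ∞ m → ∀ H : Sch n, AEStronglyMeasurable
      (fun ξ => 𝓕⁻ φ ξ * ((m ((2 * Real.pi) • ξ) : ℂ) * 𝓕 H ξ)) volume := fun m hm H => by
    have := hm.continuous
    have : Continuous fun ξ => 𝓕⁻ φ ξ * ((m ((2 * Real.pi) • ξ) : ℂ) * 𝓕 H ξ) := by fun_prop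
    exact this.aestronglyMeasurable
  have hheat : ∀ (s : ℝ), s ∈ Metric.ball τ 1 → ∀ ξ,
      ‖(heatSymbol χ j (t - s) ((2 * Real.pi) • ξ) : ℂ)‖ ≤ Real.exp ((|t - τ| + 1) * B ^ 2) := by
    intro s hs ξ
    rw [Complex.norm_real]
    unfold heatSymbol
    by_cases h0 : blockSymbol χ j ((2 * Real.pi) • ξ) = 0
    · simp [h0]; positivity
    have h1 := (norm_of_blockSymbol_ne_zero hχ h0).2
    rw [norm_mul, Real.norm_of_nonneg (show 0 ≤ blockSymbol χ j _ from hχ.nonneg _),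
      Real.norm_of_nonneg (Real.exp_pos _).le]
    have h2 : Real.exp (-(t - s) * ‖(2 * Real.pi) • ξ‖ ^ 2) ≤ Real.exp ((|t - τ| + 1) * B ^ 2) := by
      refine Real.exp_le_exp.2 ?_
      have h3 : -(t - s) ≤ |t - τ| + 1 := by
        rw [Metric.mem_ball, Real.dist_eq] at hs
        have := (abs_lt.1 hs).2
        have := neg_abs_le (t - τ)
        linarith
      calc -(t - s) * ‖(2 * Real.pi) • ξ‖ ^ 2 ≤ (|t - τ| + 1) * ‖(2 * Real.pi) • ξ‖ ^ 2 := by gcongr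
        _ ≤ _ := by gcongr
    calc _ ≤ 1 * Real.exp ((|t - τ| + 1) * B ^ 2) := by
          gcongr
          exact hχ.le_one _
      _ = _ := one_mul _
  have hint0 : Integrable (fun ξ => 𝓕⁻ φ ξ * ((heatSymbol χ j (t - τ) ((2 * Real.pi) • ξ) : ℂ)
      * 𝓕 V ξ)) := by
    have := ((𝓕⁻ φ : Sch n) * 𝓕 (multS (heatSymbol χ j (t - τ)) V)).integrable (μ := volume)
    refine this.congr (.of_forall fun ξ => ?_)
    simp only [mul_apply, fourier_multS (isSymbol_heatSymbol hχ j (t - τ))]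
  have hbi : Integrable (fun ξ => ‖𝓕⁻ φ ξ‖ * (Real.exp ((|t - τ| + 1) * B ^ 2) *
      ‖𝓕 (-lapS V) ξ‖)) := by
    have := (((𝓕⁻ φ : Sch n) * 𝓕 (-lapS V)).integrable (μ := volume)).norm.const_mul
      (Real.exp ((|t - τ| + 1) * B ^ 2))
    refine this.congr (.of_forall fun ξ => ?_)
    simp only [mul_apply, norm_mul]
    ring
  refine (hasDerivAt_integral_of_dominated_loc_of_deriv_le (Metric.ball_mem_nhds τ one_pos)
    (.of_forall fun s => hcont _ (heatSymbol_contDiff hχ j (t - s)) V) hint0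
    (hcont _ (heatSymbol_contDiff hχ j (t - τ)) (-lapS V)) (F' := fun s ξ =>
      𝓕⁻ φ ξ * ((heatSymbol χ j (t - s) ((2 * Real.pi) • ξ) : ℂ) * 𝓕 (-lapS V) ξ))
    (.of_forall fun ξ s hs => ?_) hbi (.of_forall fun ξ s hs => ?_)).2
  · rw [norm_mul, norm_mul]
    gcongr
    exact hheat s hs ξ
  · have h1 : HasDerivAt (fun s => heatSymbol χ j (t - s) ((2 * Real.pi) • ξ))
        (heatSymbol χ j (t - s) ((2 * Real.pi) • ξ) * ‖(2 * Real.pi) • ξ‖ ^ 2) s := by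
      unfold heatSymbol
      have h2 : HasDerivAt (fun s : ℝ => -(t - s) * ‖(2 * Real.pi) • ξ‖ ^ 2)
          (‖(2 * Real.pi) • ξ‖ ^ 2) s := by
        have := (((hasDerivAt_id s).const_sub t).neg).mul_const (‖(2 * Real.pi) • ξ‖ ^ 2)
        simpa using this
      have := (h2.exp).const_mul (blockSymbol χ j ((2 * Real.pi) • ξ))
      exact this.congr_deriv (by ring)
    have h3 := (h1.ofReal_comp.mul_const (𝓕 V ξ)).const_mul (𝓕⁻ φ ξ)
    refine h3.congr_deriv ?_
    have : 𝓕 (-lapS V) ξ = -𝓕 (lapS V) ξ := by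
      simpa only [neg_smul, one_smul, neg_mul, one_mul] using fourier_smul (-1) (lapS V) ξ
    rw [this, fourier_lapS, norm_smul, Real.norm_of_nonneg (by positivity)]
    push_cast
    ring

/-- Duhamel's formula, block by block, for a finite sum of solenoidal fields. -/
lemma duhamel (hχ : IsLittlewoodPaley χ) {ι : Type*} (I : Finset ι) (c : ι → ℝ → ℝ) (V : ι → Fin n → Sch n) (p : ℝ → Sch n)
    (hc : ∀ i ∈ I, ContDiff ℝ 1 (c i)) (hV : ∀ i ∈ I, ∑ l, dS l (V i l) = 0)
    (j : ℤ) (φ : Sch n) {a t : ℝ} (ha : ∀ i ∈ I, c i a = 0) (G : ℝ → Dist n)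
    (hG : ∀ τ, G τ = toDist (fun k => ∑ i ∈ I, (((deriv (c i) τ : ℝ) : ℂ) • V i k -
      (c i τ : ℂ) • lapS (V i k)) + dS k (p τ))) :
    IntervalIntegrable (fun τ => lerayHeat χ j (t - τ) (G τ) φ) volume a t ∧
    block χ j (toDist (fun k => ∑ i ∈ I, (c i t : ℂ) • V i k)) φ =
      ∫ τ in a..t, lerayHeat χ j (t - τ) (G τ) φ := by
  set g : ι → Fin n → ℝ → ℂ := fun i k τ => pr φ (multS (heatSymbol χ j (t - τ)) (V i k)) with hg
  set g' : ι → Fin n → ℝ → ℂ := fun i k τ =>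
    pr φ (multS (heatSymbol χ j (t - τ)) (-lapS (V i k))) with hg'
  have hder : ∀ i k τ, HasDerivAt (g i k) (g' i k τ) τ := fun i k τ =>
    hasDerivAt_heat hχ j t τ φ (V i k)
  have hcont' : ∀ i k, Continuous (g' i k) := fun i k =>
    continuous_iff_continuousAt.2 fun τ => (hasDerivAt_heat hχ j t τ φ (-lapS (V i k))).continuousAt
  -- The projection kills the pressure and acts as the identity on the solenoidal remainder.
  have hleray : ∀ τ, lerayHeat χ j (t - τ) (G τ) φ = WithLp.toLp 2 (fun k => ∑ i ∈ I,
      (((deriv (c i) τ : ℝ) : ℂ) * g i k τ + (c i τ : ℂ) * g' i k τ)) := fun τ => by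
    rw [hG, lerayHeat_toDist hχ]
    congr 1
    ext k
    have hsol : ∑ l, dS l (∑ i ∈ I, (((deriv (c i) τ : ℝ) : ℂ) • V i l -
        (c i τ : ℂ) • lapS (V i l))) = 0 := by
      simp only [map_sum, map_sub, map_smul, dS_lapS]
      rw [Finset.sum_comm]
      refine Finset.sum_eq_zero fun i hi => ?_
      rw [Finset.sum_sub_distrib, ← Finset.smul_sum, ← Finset.smul_sum, ← map_sum, hV i hi]
      simp
    simp only [multS_add, Finset.sum_add_distrib]
    rw [leray_gradient hχ, add_zero, leray_solenoidal hχ j (t - τ) k hsol, multS_sum, pr_sum,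
      ← Finset.sum_add_distrib]
    refine Finset.sum_congr rfl fun i _ => ?_
    have e : ((deriv (c i) τ : ℝ) : ℂ) • V i k - (c i τ : ℂ) • lapS (V i k) =
        ((deriv (c i) τ : ℝ) : ℂ) • V i k + (c i τ : ℂ) • (-lapS (V i k)) := by
      rw [smul_neg, sub_eq_add_neg]
    rw [e, multS_add, multS_smul, multS_smul]
    have hadd : ∀ F H : Sch n, pr φ (F + H) = pr φ F + pr φ H := fun F H => by
      simpa using pr_sum (Finset.univ : Finset (Fin 2)) φ ![F, H]
    rw [hadd, pr_smul, pr_smul]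
  -- The integrand is the derivative of `w`. At `τ = t` this primitive is the block of the field,
  -- and at `τ = a` it vanishes because the coefficients do.
  set w : ℝ → Cn n := fun τ => WithLp.toLp 2 (fun k => ∑ i ∈ I, (c i τ : ℂ) * g i k τ) with hw
  have hwd : ∀ τ, HasDerivAt w (lerayHeat χ j (t - τ) (G τ) φ) τ := fun τ => by
    rw [hleray]
    have h1 : HasDerivAt (fun τ k => ∑ i ∈ I, (c i τ : ℂ) * g i k τ) (fun k => ∑ i ∈ I,
      (((deriv (c i) τ : ℝ) : ℂ) * g i k τ + (c i τ : ℂ) * g' i k τ)) τ := by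
      refine hasDerivAt_pi.2 fun k => HasDerivAt.fun_sum fun i hi => ?_
      exact (((hc i hi).differentiable one_ne_zero τ).hasDerivAt.ofReal_comp).mul (hder i k τ)
    exact ((PiLp.continuousLinearEquiv 2 ℝ (fun _ : Fin n => ℂ)).symm.toContinuousLinearMap.hasFDerivAt).comp_hasDerivAt τ h1
  have hcont : Continuous (fun τ => lerayHeat χ j (t - τ) (G τ) φ) := by
    have e : (fun τ => lerayHeat χ j (t - τ) (G τ) φ) = fun τ => WithLp.toLp 2 (fun k => ∑ i ∈ I,
      (((deriv (c i) τ : ℝ) : ℂ) * g i k τ + (c i τ : ℂ) * g' i k τ)) := funext hleray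
    rw [e]
    refine (PiLp.continuous_toLp 2 _).comp (continuous_pi fun k => continuous_finsetSum _ fun i hi => ?_)
    have h1 := (hc i hi).continuous_deriv le_rfl
    have h2 := (hc i hi).continuous
    have h3 : Continuous (g i k) := continuous_iff_continuousAt.2 fun τ => (hder i k τ).continuousAt
    have h4 := hcont' i k
    fun_prop
  refine ⟨hcont.intervalIntegrable _ _, ?_⟩
  rw [intervalIntegral.integral_eq_sub_of_hasDerivAt (fun τ _ => hwd τ) (hcont.intervalIntegrable _ _)]
  have hwa : w a = 0 := by
    ext k
    simp only [hw]
    exact Finset.sum_eq_zero fun i hi => by rw [ha i hi]; simp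
  rw [hwa, sub_zero, block_toDist hχ]
  ext k
  rw [toDist_apply_apply]
  have h0 : heatSymbol χ j (t - t) = blockSymbol χ j := by
    ext ξ; simp [heatSymbol]
  have h1 := pr_sum I φ (fun i => multS (blockSymbol χ j) ((c i t : ℂ) • V i k))
  rw [← multS_sum] at h1
  refine h1.trans ?_
  simp only [hw, hg, multS_smul, pr_smul, h0]

/-! ### Riesz products and lacunary cosine sums. -/

lemma exp_mul_le_cosh_add (x : ℝ) {c : ℝ} (hc : |c| ≤ 1) :
    Real.exp (x * c) ≤ Real.cosh x + Real.sinh x * c := by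
  obtain ⟨h1, h2⟩ := abs_le.1 hc
  -- These are the weights with which `x * c` is a convex combination of `x` and `-x`; the bound is
  -- the chord of the exponential, and with `c` a cosine it is a factor of a Riesz product.
  have hab : (1 + c) / 2 + (1 - c) / 2 = 1 := by ring
  have := convexOn_exp.2 (mem_univ x) (mem_univ (-x)) (by linarith : 0 ≤ (1 + c) / 2)
    (by linarith : 0 ≤ (1 - c) / 2) hab
  simp only [smul_eq_mul] at this
  rw [Real.cosh_eq, Real.sinh_eq]
  calc Real.exp (x * c) = Real.exp ((1 + c) / 2 * x + (1 - c) / 2 * -x) := by ring_nf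
    _ ≤ _ := this
    _ = _ := by ring

/-- The Riesz product `F ∏_{k<K} (α + β cos (2π λ_k x_η))`. -/
def rieszProduct (F : Sch n) (η : Fin n) (lam : ℕ → ℝ) (α β : ℝ) : ℕ → Sch n
  | 0 => F
  | K + 1 => (α : ℂ) • rieszProduct F η lam α β K + ((β / 2 : ℝ) : ℂ) •
      (Md (lam K • axis η) (rieszProduct F η lam α β K) +
        Md (-(lam K • axis η)) (rieszProduct F η lam α β K))

lemma rieszProduct_apply (F : Sch n) (η : Fin n) (lam : ℕ → ℝ) (α β : ℝ) (K : ℕ) (x : Rn n) :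
    rieszProduct F η lam α β K x =
      ((∏ k ∈ Finset.range K, (α + β * Real.cos (2 * Real.pi * (lam k * x η))) : ℝ) : ℂ) * F x := by
  induction K with
  | zero => simp [rieszProduct]
  | succ K ih =>
    rw [Finset.prod_range_succ]
    simp only [rieszProduct, add_apply, smul_apply, Md_apply, ih]
    have e1 : inner ℝ (lam K • axis η) x = lam K * x η := by
      rw [inner_smul_left, real_inner_comm, inner_axis]; simp
    rw [inner_neg_left, e1]
    have e2 : (Complex.exp (((2 * Real.pi * (lam K * x η) : ℝ) : ℂ) * Complex.I) +
        Complex.exp (((2 * Real.pi * -(lam K * x η) : ℝ) : ℂ) * Complex.I)) =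
        2 * ((Real.cos (2 * Real.pi * (lam K * x η)) : ℝ) : ℂ) := by
      rw [mul_neg, Complex.ofReal_cos, Complex.cos]
      push_cast
      ring
    simp only [smul_eq_mul]
    push_cast at e2 ⊢
    linear_combination (β / 2 * ((∏ k ∈ Finset.range K, (α + β *
      Complex.cos (2 * Real.pi * (lam k * x η)))) * F x)) * e2

lemma integral_eq_fourier_zero (F : Sch n) : ∫ x, F x = 𝓕 F 0 := by
  rw [SchwartzMap.fourier_coe, Real.fourier_eq']
  simp

/-- The integral is the transform at the origin. The partial product has spectrum of radius below
`lam K`, so its shifts by `± lam K` vanish at the origin and each new factor contributes only `α`.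
The new radius `ρ + lam K` stays below `2 lam K ≤ lam (K + 1)`. -/
lemma integral_rieszProduct {F : Sch n} {R : ℝ} (hF : Spec F 0 R) (η : Fin n) {lam : ℕ → ℝ}
    (h0 : R < lam 0) (hlam : ∀ k, 2 * lam k ≤ lam (k + 1)) (α β : ℝ) (K : ℕ) :
    ∫ x, rieszProduct F η lam α β K x = α ^ K * ∫ x, F x := by
  have key : ∀ K, ∃ ρ, ρ < lam K ∧ Spec (rieszProduct F η lam α β K) 0 ρ ∧
      𝓕 (rieszProduct F η lam α β K) 0 = α ^ K * 𝓕 F 0 := by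
    intro K
    induction K with
    | zero => exact ⟨R, h0, hF, by simp [rieszProduct]⟩
    | succ K ih =>
      obtain ⟨ρ, hρ, hs, he⟩ := ih
      have hz : ∀ s : ℝ, |s| = 1 → 𝓕 (rieszProduct F η lam α β K) (s • lam K • axis η) = 0 := by
        intro s hs1
        by_contra hne
        have h1 := hs _ hne
        rw [sub_zero, norm_smul, norm_smul, Real.norm_eq_abs, Real.norm_eq_abs, hs1] at h1
        have h2 : ‖axis η‖ = 1 := by simp [axis]
        rw [h2, one_mul, mul_one] at h1
        exact absurd (le_abs_self (lam K)) (by linarith)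
      have hlp : 0 ≤ |lam K| := abs_nonneg _
      -- Since `R` may be negative, so may `lam K`. Then the spectrum lies in a ball of negative
      -- radius and the product is zero.
      by_cases hpos : lam K < 0
      · have h0' : ∀ ξ, 𝓕 (rieszProduct F η lam α β K) ξ = 0 := fun ξ => by
          by_contra hne
          have := hs ξ hne
          have := norm_nonneg (ξ - 0)
          linarith
        have hall : ∀ ξ, 𝓕 (rieszProduct F η lam α β (K + 1)) ξ = 0 := fun ξ => by
          simp only [rieszProduct, fourier_add, fourier_smul, fourier_Md, h0']
          simp
        refine ⟨lam (K + 1) - 1, by linarith, fun ξ hξ => absurd (hall ξ) hξ, ?_⟩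
        rw [hall, pow_succ, mul_right_comm, ← he, h0', zero_mul]
      push Not at hpos
      refine ⟨ρ + lam K, by linarith [hlam K], ?_, ?_⟩
      · have hmd : ∀ μ : Rn n, ‖μ‖ = lam K → Spec (Md μ (rieszProduct F η lam α β K)) 0 (ρ + lam K) :=
          fun μ hμ ξ hξ => by
            rw [fourier_Md] at hξ
            have := hs _ hξ
            rw [sub_zero] at this ⊢
            have h3 := norm_add_le (ξ - μ) μ
            rw [sub_add_cancel] at h3
            linarith
        have hn : ‖lam K • axis η‖ = lam K := by
          rw [norm_smul, Real.norm_of_nonneg hpos]; simp [axis]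
        exact ((hs.mono (by linarith)).smul _).add
          (((hmd _ hn).add (hmd _ (by rw [norm_neg, hn]))).smul _)
      · simp only [rieszProduct, fourier_add, fourier_smul, fourier_Md, zero_sub, neg_neg]
        have a1 := hz 1 (by simp)
        have a2 := hz (-1) (by simp)
        rw [one_smul] at a1
        rw [neg_smul, one_smul] at a2
        rw [a1, a2, he]
        ring
  obtain ⟨ρ, -, -, he⟩ := key K
  rw [integral_eq_fourier_zero, integral_eq_fourier_zero, he]

lemma re_sq_of_real {F : Sch n} (hF : IsRealS F) (x : Rn n) : (F * F) x = ((F x).re ^ 2 : ℝ) := by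
  have : F x = ((F x).re : ℂ) := Complex.ext (by simp) (by simp [hF x])
  rw [mul_apply]
  conv_lhs => rw [this]
  push_cast; ring

/-- Exponential integrability of lacunary cosine sums against `q²`. -/
lemma lintegral_exp_lacunary {q : Sch n} (hq : IsRealS q) {R : ℝ} (hs : Spec (q * q) 0 R)
    (η : Fin n) {lam : ℕ → ℝ} (h0 : R < lam 0) (hlam : ∀ k, 2 * lam k ≤ lam (k + 1)) (γ : ℝ)
    (K : ℕ) :
    ∫⁻ x, ENNReal.ofReal ((q x).re ^ 2 *
        Real.exp (γ * ∑ k ∈ Finset.range K, Real.cos (2 * Real.pi * (lam k * x η)))) ≤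
      ENNReal.ofReal (Real.exp (K * (γ ^ 2 / 2)) * ∫ x, (q x).re ^ 2) := by
  set G := rieszProduct (q * q) η lam (Real.cosh γ) (Real.sinh γ) K with hG
  set g : Rn n → ℝ := fun x => (∏ k ∈ Finset.range K, (Real.cosh γ +
    Real.sinh γ * Real.cos (2 * Real.pi * (lam k * x η)))) * (q x).re ^ 2 with hg
  have hGg : ∀ x, G x = (g x : ℂ) := fun x => by
    rw [hG, rieszProduct_apply, re_sq_of_real hq]; simp only [hg]; push_cast; rfl
  have hle : ∀ x, (q x).re ^ 2 * Real.exp (γ * ∑ k ∈ Finset.range K,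
      Real.cos (2 * Real.pi * (lam k * x η))) ≤ g x := fun x => by
    rw [hg, mul_comm, Finset.mul_sum, Real.exp_sum]
    refine mul_le_mul_of_nonneg_right (Finset.prod_le_prod (fun k _ => (Real.exp_pos _).le)
      fun k _ => exp_mul_le_cosh_add γ (Real.abs_cos_le_one _)) (sq_nonneg _)
  have hgint : Integrable g := by
    have := G.integrable.re (μ := volume)
    exact this.congr (.of_forall fun x => by simp [hGg])
  have h1 : ∫ x, g x = Real.cosh γ ^ K * ∫ x, (q x).re ^ 2 := by
    have := integral_rieszProduct hs η h0 hlam (Real.cosh γ) (Real.sinh γ) K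
    simp only [re_sq_of_real hq, ← hG, hGg] at this
    rw [integral_complex_ofReal, integral_complex_ofReal] at this
    exact_mod_cast this
  calc _ ≤ ∫⁻ x, ENNReal.ofReal (g x) :=
        lintegral_mono fun x => ENNReal.ofReal_le_ofReal (hle x)
    _ = ENNReal.ofReal (∫ x, g x) :=
        (ofReal_integral_eq_lintegral_ofReal hgint (.of_forall fun x =>
          (by positivity : (0 : ℝ) ≤ _).trans (hle x))).symm
    _ ≤ _ := by
        rw [h1]
        refine ENNReal.ofReal_le_ofReal ?_
        have hp : 0 ≤ ∫ x, (q x).re ^ 2 := integral_nonneg fun x => sq_nonneg _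
        gcongr
        -- This is the sub-Gaussian gain: the exponential moment depends only on `K γ²`.
        calc Real.cosh γ ^ K ≤ Real.exp (γ ^ 2 / 2) ^ K := by
              gcongr
              exact Real.cosh_le_exp_half_sq γ
          _ = _ := by rw [← Real.exp_nat_mul]

/-- Hölder's inequality on each set `A`. -/
lemma weakLpNorm_le_eLpNorm {p : ℝ} (hp : 1 ≤ p) {g : Rn n → Rn n}
    (hg : AEStronglyMeasurable g volume) :
    weakLpNorm p g ≤ eLpNorm g (ENNReal.ofReal p) volume := by
  refine iSup_le fun A => iSup_le fun hA => iSup_le fun hA0 => iSup_le fun hAt => ?_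
  have h1 := eLpNorm_le_eLpNorm_mul_rpow_measure_univ (μ := volume.restrict A) (f := g)
    (p := 1) (q := ENNReal.ofReal p) (by simpa using hp) hg.restrict
  rw [eLpNorm_one_eq_lintegral_enorm, Measure.restrict_apply_univ,
    ENNReal.toReal_ofReal (by linarith)] at h1
  simp only [ENNReal.toReal_one, div_one] at h1
  refine ENNReal.div_le_of_le_mul (h1.trans ?_)
  gcongr
  exact Measure.restrict_le_self

/-- `L^p` bound of a square-exponentially integrable function. -/
lemma eLpNorm_lacunary_le {q : Sch n} (hq : IsRealS q) {R : ℝ} (hs : Spec (q * q) 0 R)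
    (η : Fin n) {N : ℕ} (hN : 2 ≤ N) : ∃ C : ℝ≥0∞, C < ⊤ ∧ ∀ (lam : ℕ → ℝ), R < lam 0 →
      (∀ k, 2 * lam k ≤ lam (k + 1)) → ∀ (γ : ℝ) (K : ℕ), K * γ ^ 2 ≤ 2 →
      eLpNorm (fun x : Rn n => (q x).re * (γ * ∑ k ∈ Finset.range K,
        Real.cos (2 * Real.pi * (lam k * x η)))) (ENNReal.ofReal N) volume ≤ C := by
  obtain ⟨Q, hQ0, hQ⟩ : ∃ Q : ℝ, 0 ≤ Q ∧ ∀ x, |(q x).re| ≤ Q :=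
    ⟨_, norm_nonneg _, fun x => (Complex.abs_re_le_norm _).trans
      (q.toBoundedContinuousFunction.norm_coe_le_norm x)⟩
  -- `D` comes from `|q|^N ≤ Q^(N-2) q²` and `|y|^N ≤ N! (exp y + exp (-y))`; the factor `exp 1` in
  -- `E` bounds the exponential moment under `K γ² ≤ 2`.
  set D : ℝ := Q ^ (N - 2) * N.factorial
  set E : ℝ := Real.exp 1 * ∫ x, (q x).re ^ 2
  refine ⟨(ENNReal.ofReal D * (2 * ENNReal.ofReal E)) ^ (1 / (N : ℝ)), ?_,
    fun lam h0 hlam γ K hK => ?_⟩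
  · exact ENNReal.rpow_lt_top_of_nonneg (by positivity) (by finiteness)
  have hN0 : (0 : ℝ) < N := by positivity
  rw [eLpNorm_eq_lintegral_rpow_enorm_toReal (by simpa using by omega) (by simp),
    ENNReal.toReal_ofReal hN0.le]
  gcongr
  set S : Rn n → ℝ := fun x => ∑ k ∈ Finset.range K, Real.cos (2 * Real.pi * (lam k * x η))
  have hpt : ∀ x, ‖(q x).re * (γ * S x)‖ₑ ^ (N : ℝ) ≤ ENNReal.ofReal D *
      (ENNReal.ofReal ((q x).re ^ 2 * Real.exp (γ * S x)) +
        ENNReal.ofReal ((q x).re ^ 2 * Real.exp (-γ * S x))) := fun x => by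
    rw [← ENNReal.ofReal_add (by positivity) (by positivity), ← ENNReal.ofReal_mul (by positivity),
      ENNReal.rpow_natCast, ← ofReal_norm, ← ENNReal.ofReal_pow (norm_nonneg _)]
    refine ENNReal.ofReal_le_ofReal ?_
    rw [norm_mul, mul_pow, Real.norm_eq_abs, Real.norm_eq_abs]
    have e1 : |(q x).re| ^ N ≤ Q ^ (N - 2) * (q x).re ^ 2 := by
      rw [← sq_abs (q x).re]
      calc |(q x).re| ^ N = |(q x).re| ^ (N - 2) * |(q x).re| ^ 2 := by
            rw [← pow_add]; congr 1; omega
        _ ≤ _ := by gcongr; exact hQ x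
    have e2 : |γ * S x| ^ N ≤ N.factorial * (Real.exp (γ * S x) + Real.exp (-γ * S x)) := by
      have h1 := Real.pow_div_factorial_le_exp _ (abs_nonneg (γ * S x)) N
      rw [div_le_iff₀ (by positivity)] at h1
      have h2 : Real.exp |γ * S x| ≤ Real.exp (γ * S x) + Real.exp (-γ * S x) := by
        rcases abs_cases (γ * S x) with ⟨h, -⟩ | ⟨h, -⟩ <;> rw [h]
        · linarith [Real.exp_pos (-γ * S x)]
        · rw [← neg_mul]; linarith [Real.exp_pos (γ * S x)]
      calc _ ≤ _ := h1
        _ = N.factorial * Real.exp |γ * S x| := by ring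
        _ ≤ _ := by gcongr
    calc _ ≤ (Q ^ (N - 2) * (q x).re ^ 2) *
          (N.factorial * (Real.exp (γ * S x) + Real.exp (-γ * S x))) := by gcongr
      _ = _ := by simp only [D]; ring
  have hE : ∀ γ' : ℝ, K * γ' ^ 2 ≤ 2 →
      ∫⁻ x, ENNReal.ofReal ((q x).re ^ 2 * Real.exp (γ' * S x)) ≤ ENNReal.ofReal E := fun γ' h => by
    refine (lintegral_exp_lacunary hq hs η h0 hlam γ' K).trans (ENNReal.ofReal_le_ofReal ?_)
    have hp : 0 ≤ ∫ x, (q x).re ^ 2 := integral_nonneg fun x => sq_nonneg _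
    simp only [E]
    gcongr
    linarith
  have hmeas : Measurable (fun x => ENNReal.ofReal ((q x).re ^ 2 * Real.exp (γ * S x))) := by
    have := q.continuous
    have hc : Continuous fun x => (q x).re ^ 2 * Real.exp (γ * S x) := by
      simp only [S]; fun_prop
    exact hc.measurable.ennreal_ofReal
  calc _ ≤ _ := lintegral_mono hpt
    _ = ENNReal.ofReal D * (_ + _) := by
        rw [lintegral_const_mul' _ _ ENNReal.ofReal_ne_top, lintegral_add_left hmeas]
    _ ≤ _ := by
        rw [two_mul]
        gcongr
        · exact hE γ hK
        · exact hE (-γ) (by rwa [neg_sq])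

/-! ### Solenoidal waves. -/

/-- The sign `±1`. -/
def sg (s : Bool) : ℝ := if s then 1 else -1

lemma sg_mul_self (s : Bool) : sg s * sg s = 1 := by cases s <;> simp [sg]
lemma abs_sg (s : Bool) : |sg s| = 1 := by cases s <;> simp [sg]

namespace Profile

variable (P : Profile n)

/-- Principal amplitude of the `i`-th wave. -/
def amp (i : Fin P.m) (a : Fin n) : Sch n := ((P.d i a / 2 : ℝ) : ℂ) • P.q i

/-- The corrector restoring the divergence constraint. -/
def corr (i : Fin P.m) (a : Fin n) : Sch n :=
  (P.d i a : ℂ) • dS (P.η i) (P.q i) -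
    if a = P.η i then ∑ l, (P.d i l : ℂ) • dS l (P.q i) else 0

/-- Amplitude of the corrector. -/
def camp (i : Fin P.m) (a : Fin n) : Sch n := (-Complex.I / 2) • P.corr i a

/-- The full amplitude of a wave with sign `s` and frequency `lam`. -/
def wamp (i : Fin P.m) (s : Bool) (lam : ℝ) (a : Fin n) : Sch n :=
  P.amp i a + ((sg s * (2 * Real.pi * lam)⁻¹ : ℝ) : ℂ) • P.camp i a

/-- The frequency vector of a wave. -/
def freq (i : Fin P.m) (s : Bool) (lam : ℝ) : Rn n := (sg s * lam) • axis (P.η i)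

/-- A solenoidal wave with sign `s` and frequency `lam`. -/
def wave (i : Fin P.m) (s : Bool) (lam : ℝ) (a : Fin n) : Sch n :=
  Md (P.freq i s lam) (P.wamp i s lam a)

lemma corr_rbl (i : Fin P.m) (a : Fin n) : RBL (P.corr i a) := by
  refine (((P.q_rbl i).dS _).smul _).sub ?_
  split_ifs
  · have h : ∀ l ∈ Finset.univ, RBL ((P.d i l : ℂ) • dS l (P.q i)) :=
      fun l _ => ((P.q_rbl i).dS l).smul _
    exact ⟨IsRealS.sum fun l hl => (h l hl).1, BL.sum fun l hl => (h l hl).2⟩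
  · exact RBL.zero

lemma freq_apply (i : Fin P.m) (s : Bool) (lam : ℝ) (a : Fin n) :
    P.freq i s lam a = if a = P.η i then sg s * lam else 0 := by
  simp [freq, axis]

lemma norm_freq (i : Fin P.m) (s : Bool) {lam : ℝ} (hl : 0 ≤ lam) : ‖P.freq i s lam‖ = lam := by
  rw [freq, norm_smul, Real.norm_eq_abs, abs_mul, abs_sg, abs_of_nonneg hl]
  simp [axis]

/-- The two conjugate waves together are the divergence of the antisymmetric tensor `(2πλ)⁻¹ q
sin(2πλ x_η) (d ⊗ e_η - e_η ⊗ d)`. For one wave: the corrector is itself divergence free, the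
principal amplitude has no `η` component because `d_η = 0`, and the modulated `η` component of the
corrector cancels `d · ∇q`. -/
lemma wave_div (i : Fin P.m) (s : Bool) {lam : ℝ} (hl : 0 < lam) :
    ∑ a, dS a (P.wave i s lam a) = 0 := by
  have h1 : ∀ a, dS a (P.wave i s lam a) = Md (P.freq i s lam) (dS a (P.wamp i s lam a)) +
      if a = P.η i then (2 * Real.pi * Complex.I * ((sg s * lam : ℝ) : ℂ)) •
        Md (P.freq i s lam) (P.wamp i s lam a) else 0 := fun a => by
    rw [wave, dS_Md, freq_apply]
    split_ifs <;> simp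
  simp only [h1, Finset.sum_add_distrib, ← map_sum, Finset.sum_ite_eq', Finset.mem_univ, if_true]
  rw [← map_smul, ← map_add]
  refine (congrArg _ ?_).trans (map_zero (Md (P.freq i s lam)))
  have h2 : ∑ a, dS a (P.corr i a) = 0 := by
    simp only [corr, map_sub, map_smul, Finset.sum_sub_distrib, apply_ite (dS _), map_zero, map_sum,
      Finset.sum_ite_eq', Finset.mem_univ, if_true]
    rw [sub_eq_zero]
    exact Finset.sum_congr rfl fun a _ => by rw [dS_comm]
  have h3 : P.corr i (P.η i) = -∑ l, (P.d i l : ℂ) • dS l (P.q i) := by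
    simp [corr, P.d_eta]
  have h4 : P.amp i (P.η i) = 0 := by simp [amp, P.d_eta]
  simp only [wamp, camp, map_add, map_smul, Finset.sum_add_distrib, ← Finset.smul_sum, h2, h3, h4]
  simp only [amp, map_smul, smul_zero, add_zero, zero_add, smul_neg, smul_smul]
  rw [← sub_eq_add_neg, sub_eq_zero, Finset.smul_sum]
  refine Finset.sum_congr rfl fun l _ => ?_
  rw [smul_smul]
  congr 1
  have hs : ((sg s : ℝ) : ℂ) * (sg s : ℂ) = 1 := by exact_mod_cast sg_mul_self s
  have hp : (Real.pi : ℂ) ≠ 0 := by exact_mod_cast Real.pi_ne_zero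
  have hlc : (lam : ℂ) ≠ 0 := by exact_mod_cast hl.ne'
  push_cast
  field_simp
  linear_combination (P.d i l : ℂ) * hs * (Complex.I ^ 2) + (P.d i l : ℂ) * Complex.I_sq

/-- The sum of the two conjugate waves, at a point. -/
lemma wave_pair_apply (i : Fin P.m) (lam : ℝ) (a : Fin n) (x : Rn n) :
    P.wave i true lam a x + P.wave i false lam a x =
      ((P.d i a * ((P.q i x).re * Real.cos (2 * Real.pi * (lam * x (P.η i)))) +
      (2 * Real.pi * lam)⁻¹ * (Real.sin (2 * Real.pi * (lam * x (P.η i))) * (P.corr i a x).re) : ℝ) : ℂ) := by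
  have hq : P.q i x = ((P.q i x).re : ℂ) := Complex.ext (by simp) (by simp [(P.q_rbl i).1 x])
  have hc : P.corr i a x = ((P.corr i a x).re : ℂ) :=
    Complex.ext (by simp) (by simp [(P.corr_rbl i a).1 x])
  have hin : ∀ s, inner ℝ (P.freq i s lam) x = sg s * (lam * x (P.η i)) := fun s => by
    rw [freq, inner_smul_left, real_inner_comm, inner_axis]; simp; ring
  set y := 2 * Real.pi * (lam * x (P.η i)) with hy
  have e1 : (2 * Real.pi * inner ℝ (P.freq i true lam) x) = y := by rw [hin]; simp [sg, hy]
  have e2 : (2 * Real.pi * inner ℝ (P.freq i false lam) x) = -y := by rw [hin]; simp [sg, hy]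
  rw [wave, wave, Md_apply, Md_apply, e1, e2]
  simp only [wamp, amp, camp, add_apply, smul_apply, smul_eq_mul, sg]
  rw [hq, hc]
  simp only [Complex.ofReal_re]
  have e3 : Complex.exp ((y : ℂ) * Complex.I) = Real.cos y + Real.sin y * Complex.I := by
    rw [Complex.exp_mul_I]; simp
  have e4 : Complex.exp (((-y : ℝ) : ℂ) * Complex.I) = Real.cos y - Real.sin y * Complex.I := by
    rw [Complex.exp_mul_I]; simp; ring
  rw [e3, e4]
  simp only [if_true, Bool.false_eq_true, if_false]
  push_cast
  linear_combination (-(Complex.sin y) * (2 * Real.pi * lam)⁻¹ * (P.corr i a x).re) * Complex.I_sq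

end Profile

/-! ### Amplitude bounds uniform in the frequency. -/

/-- A family of amplitudes with uniform Fourier bounds. -/
structure IsAmpFamily (S : Set (Sch n)) (C R : ℝ) : Prop where
  spec : ∀ F ∈ S, Spec F 0 R
  bound : ∀ F ∈ S, ∀ ξ, ‖𝓕 F ξ‖ ≤ C
  bound_mul : ∀ F ∈ S, ∀ G ∈ S, ∀ ξ, ‖𝓕 (F * G) ξ‖ ≤ C

lemma norm_fourier_le_integral (F : Sch n) {g : Rn n → ℝ} (hg : Integrable g)
    (h : ∀ x, ‖F x‖ ≤ g x) (ξ : Rn n) : ‖𝓕 F ξ‖ ≤ ∫ x, g x := by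
  rw [SchwartzMap.fourier_coe, Real.fourier_eq']
  refine norm_integral_le_of_norm_le hg (.of_forall fun x => ?_)
  rw [smul_eq_mul, norm_mul, Complex.norm_exp_ofReal_mul_I, one_mul]
  exact h x

/-- A single integrable envelope `g`, with `g²` integrable, dominates all members and all products
of two members, and the transform is bounded by the `L¹` norm. -/
lemma isAmpFamily_of_dominated {ι : Type*} [Fintype ι] (D : ι → Sch n) (R : ℝ) :
    ∃ C, 0 ≤ C ∧ IsAmpFamily {F : Sch n | Spec F 0 R ∧ ∀ x, ‖F x‖ ≤ ∑ i, ‖D i x‖} C R := by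
  set g : Rn n → ℝ := fun x => ∑ i, ‖D i x‖
  have hg : Integrable g := integrable_finsetSum _ fun i _ => (D i).integrable.norm
  have hg2 : Integrable (fun x => g x * g x) := by
    have : (fun x => g x * g x) = fun x => ∑ i, ∑ j, ‖(D i * D j) x‖ := by
      ext x
      simp only [g, Finset.sum_mul_sum, mul_apply, norm_mul]
    rw [this]
    exact integrable_finsetSum _ fun i _ => integrable_finsetSum _ fun j _ =>
      (D i * D j).integrable.norm
  have hg0 : ∀ x, 0 ≤ g x := fun x => Finset.sum_nonneg fun i _ => norm_nonneg _
  refine ⟨max (∫ x, g x) (∫ x, g x * g x), le_max_of_le_left (integral_nonneg hg0),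
    fun F h => h.1, fun F h ξ => ?_, fun F hF G hG ξ => ?_⟩
  · exact (norm_fourier_le_integral F hg h.2 ξ).trans (le_max_left _ _)
  · refine (norm_fourier_le_integral (F * G) hg2 (fun x => ?_) ξ).trans (le_max_right _ _)
    rw [mul_apply, norm_mul]
    exact mul_le_mul (hF.2 x) (hG.2 x) (norm_nonneg _) (hg0 x)

lemma exists_common_spec {ι : Type*} [Fintype ι] {D : ι → Sch n} (h : ∀ i, BL (D i)) :
    ∃ R, 0 ≤ R ∧ ∀ i, Spec (D i) 0 R := by
  choose R hR using h
  refine ⟨∑ i, |R i|, Finset.sum_nonneg fun i _ => abs_nonneg _, fun i => (hR i).mono ?_⟩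
  exact (le_abs_self _).trans (Finset.single_le_sum (f := fun i => |R i|)
    (fun i _ => abs_nonneg _) (Finset.mem_univ i))

/-- The frequency enters an amplitude only through a factor of modulus `(2πλ)⁻¹ ≤ 1`, so infinitely
many amplitudes share one finite envelope. -/
lemma Profile.exists_ampFamily (P : Profile n) : ∃ (S : Set (Sch n)) (C R : ℝ), 0 ≤ C ∧ 0 ≤ R ∧
    IsAmpFamily S C R ∧ (∀ a, P.U a ∈ S) ∧ (∀ i a, P.camp i a ∈ S) ∧
    ∀ i s lam a, 1 ≤ lam → P.wamp i s lam a ∈ S := by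
  classical
  let D : (Fin n ⊕ (Fin P.m × Fin n)) ⊕ (Fin P.m × Fin n) → Sch n :=
    Sum.elim (Sum.elim P.U fun p => P.amp p.1 p.2) fun p => P.camp p.1 p.2
  have hBL : ∀ i, BL (D i) := by
    rintro ((a | ⟨i, a⟩) | ⟨i, a⟩)
    · exact (P.U_rbl a).2
    · exact (P.q_rbl i).2.smul _
    · exact (P.corr_rbl i a).2.smul _
  obtain ⟨R, hR0, hR⟩ := exists_common_spec hBL
  obtain ⟨C, hC0, hC⟩ := isAmpFamily_of_dominated D R
  have hle : ∀ i x, ‖D i x‖ ≤ ∑ i, ‖D i x‖ := fun i x =>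
    Finset.single_le_sum (f := fun i => ‖D i x‖) (fun i _ => norm_nonneg _) (Finset.mem_univ i)
  refine ⟨_, C, R, hC0, hR0, hC, fun a => ⟨hR (.inl (.inl a)), hle (.inl (.inl a))⟩,
    fun i a => ⟨hR (.inr (i, a)), hle (.inr (i, a))⟩, fun i s lam a hlam =>
      ⟨(hR (.inl (.inr (i, a)))).add ((hR (.inr (i, a))).smul _), fun x => ?_⟩⟩
  have h1 : ‖P.wamp i s lam a x‖ ≤ ‖P.amp i a x‖ + ‖P.camp i a x‖ := by
    rw [Profile.wamp, add_apply, smul_apply]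
    refine (norm_add_le _ _).trans ?_
    gcongr
    rw [norm_smul, Complex.norm_real, Real.norm_eq_abs, abs_mul, abs_sg, one_mul, abs_inv]
    refine mul_le_of_le_one_left (norm_nonneg _) (inv_le_one_of_one_le₀ ?_)
    have := Real.pi_gt_three
    rw [abs_of_nonneg (by positivity)]
    nlinarith
  refine h1.trans ?_
  have hne : (Sum.inl (.inr (i, a)) : (Fin n ⊕ (Fin P.m × Fin n)) ⊕ (Fin P.m × Fin n)) ≠
    .inr (i, a) := by simp
  calc _ = ∑ k ∈ {.inl (.inr (i, a)), .inr (i, a)}, ‖D k x‖ := by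
        rw [Finset.sum_pair hne]; rfl
    _ ≤ _ := Finset.sum_le_sum_of_subset_of_nonneg (Finset.subset_univ _)
        fun _ _ _ => norm_nonneg _

/-- The divergence of a tensor with bounded Fourier transform. -/
lemma norm_fourier_div_le {H : Fin n → Fin n → Sch n} {C : ℝ} (h : ∀ a b ξ, ‖𝓕 (H a b) ξ‖ ≤ C)
    (a : Fin n) (ξ : Rn n) : ‖𝓕 (∑ b, dS b (H a b)) ξ‖ ≤ 2 * Real.pi * n * C * ‖ξ‖ := by
  rw [fourier_sum]
  have hpi := Real.pi_pos
  calc _ ≤ ∑ b : Fin n, ‖𝓕 (dS b (H a b)) ξ‖ := norm_sum_le _ _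
    _ ≤ ∑ _b : Fin n, 2 * Real.pi * ‖ξ‖ * C := by
        refine Finset.sum_le_sum fun b _ => ?_
        rw [fourier_dS, norm_mul]
        have : ‖(2 * Real.pi * Complex.I * ξ b : ℂ)‖ = 2 * Real.pi * |ξ b| := by
          simp [abs_of_pos hpi]
        rw [this]
        gcongr
        · exact PiLp.norm_apply_le ξ b
        · exact h a b ξ
    _ = _ := by simp; ring

lemma fourier_div_ne_zero {H : Fin n → Fin n → Sch n} {a : Fin n} {ξ : Rn n}
    (h : 𝓕 (∑ b, dS b (H a b)) ξ ≠ 0) : ∃ b, 𝓕 (H a b) ξ ≠ 0 := by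
  by_contra! h0
  exact h (by rw [fourier_sum]; exact Finset.sum_eq_zero fun b _ => by rw [fourier_dS, h0, mul_zero])

/-! ### Dyadic placement of the waves. -/

/-- A block bound for a wave of frequency `2 ^ L`, uniform in `L`. -/
lemma blockNorm_wave_le {χ : Rn n → ℝ} (hχ : IsLittlewoodPaley χ) {W : Fin n → Sch n} {r s κ A R : ℝ}
    (hr : 2 ≤ r) (hA : 0 ≤ A) (hsκ : s + κ ≤ 0) {c : Rn n} {M L : ℕ} (hML : M ≤ L)
    (hc : ‖c‖ = (2 : ℝ) ^ L) (hRL : 2 * R ≤ (2 : ℝ) ^ L)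
    (hb : ∀ k ξ, ‖𝓕 (W k) ξ‖ ≤ A * (2 : ℝ) ^ (κ * L)) (hR : ∀ k, Spec (W k) c R) (j : ℤ) :
    blockNorm χ s (ENNReal.ofReal r) (toDist W) j ≤
      (ENNReal.ofReal ((2 : ℝ) ^ (5 * |s|)) * (n * ENNReal.ofReal A *
        volume (Metric.closedBall (0 : Rn n) R) ^ (1 - 1 / r)) *
        ENNReal.ofReal ((2 : ℝ) ^ ((s + κ) * M))) * (Icc (L : ℤ) (L + 5)).indicator 1 j := by
  refine (blockNorm_le_of_frequency (R := R) hχ hr c L hb (fun k ξ h => ?_) j).trans ?_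
  · have h1 := hR k ξ h
    have h2 := norm_sub_norm_le c ξ
    have h3 := norm_sub_norm_le ξ c
    rw [norm_sub_rev] at h2
    refine ⟨h1, ?_, ?_⟩ <;> linarith
  · by_cases hj : j ∈ Icc (L : ℤ) (L + 5)
    · rw [indicator_of_mem hj, indicator_of_mem hj]
      simp only [Pi.one_apply, mul_one]
      rw [two_rpow, ENNReal.ofReal_mul hA]
      set V := volume (Metric.closedBall (0 : Rn n) R) ^ (1 - 1 / r)
      -- Moving from `j` to `L` costs at most `2 ^ (5|s|)`, and `s + κ ≤ 0` allows `L` to be lowered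
      -- to the common base `M`.
      have h1 : ENNReal.ofReal ((2 : ℝ) ^ (s * j)) * ENNReal.ofReal ((2 : ℝ) ^ (κ * L)) ≤
          ENNReal.ofReal ((2 : ℝ) ^ (5 * |s|)) * ENNReal.ofReal ((2 : ℝ) ^ ((s + κ) * M)) := by
        rw [← ENNReal.ofReal_mul (by positivity), ← ENNReal.ofReal_mul (by positivity)]
        refine ENNReal.ofReal_le_ofReal ?_
        rw [← Real.rpow_add two_pos, ← Real.rpow_add two_pos]
        refine Real.rpow_le_rpow_of_exponent_le one_le_two ?_
        have h2 : (L : ℝ) ≤ j := by exact_mod_cast hj.1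
        have h3 : (j : ℝ) ≤ L + 5 := by exact_mod_cast hj.2
        have h4 : (M : ℝ) ≤ L := by exact_mod_cast hML
        have h5 : s * (j - L) ≤ |s| * 5 := by
          calc s * (j - L) ≤ |s| * (j - L) :=
                mul_le_mul_of_nonneg_right (le_abs_self s) (by linarith)
            _ ≤ _ := mul_le_mul_of_nonneg_left (by linarith) (abs_nonneg s)
        have h6 : (s + κ) * L ≤ (s + κ) * M := mul_le_mul_of_nonpos_left h4 hsκ
        linarith
      calc _ = (ENNReal.ofReal ((2 : ℝ) ^ (s * j)) * ENNReal.ofReal ((2 : ℝ) ^ (κ * L))) *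
            (n * ENNReal.ofReal A * V) := by ring
        _ ≤ (ENNReal.ofReal ((2 : ℝ) ^ (5 * |s|)) * ENNReal.ofReal ((2 : ℝ) ^ ((s + κ) * M))) *
            (n * ENNReal.ofReal A * V) := by gcongr
        _ = _ := mul_right_comm _ _ _
    · rw [indicator_of_notMem hj]
      exact zero_le

/-- The dyadic level of the wave `(i, k)`. -/
def lev (M K : ℕ) {m : ℕ} (p : Fin m × Fin K) : ℕ := M + 2 + 8 * (p.2 + K * p.1)

lemma lev_lt (K : ℕ) {m : ℕ} (p : Fin m × Fin K) : (p.2 + K * p.1 : ℕ) < m * K := by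
  have := (finProdFinEquiv p).2
  rwa [finProdFinEquiv_apply_val] at this

/-- The step `8` exceeds the five-octave spread of a wave over the blocks, so different pairs of
waves occupy disjoint blocks. -/
lemma lev_gap (M : ℕ) {K m : ℕ} {p q : Fin m × Fin K} (h : p ≠ q) :
    lev M K p + 8 ≤ lev M K q ∨ lev M K q + 8 ≤ lev M K p := by
  have h1 : (finProdFinEquiv p : ℕ) ≠ finProdFinEquiv q := fun h2 =>
    h (finProdFinEquiv.injective (Fin.ext h2))
  rw [finProdFinEquiv_apply_val, finProdFinEquiv_apply_val] at h1
  unfold lev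
  omega

/-- By disjointness at most one term is nonzero for each `j`. The superposition thus has constant
height on about `8mK` blocks, and its `ℓ^σ` norm grows like the power `1/σ` of the number of waves
rather than linearly. -/
lemma sum_indicator_lev_le (M K m : ℕ) (j : ℤ) :
    ∑ p : Fin m × Fin K, (Icc (lev M K p : ℤ) (lev M K p + 5)).indicator (1 : ℤ → ℝ≥0∞) j ≤
      (Finset.Icc (M : ℤ) (M + (8 * (m * K) + 8) : ℕ) : Set ℤ).indicator 1 j := by
  classical
  by_cases hex : ∃ p : Fin m × Fin K, j ∈ Icc (lev M K p : ℤ) (lev M K p + 5)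
  · obtain ⟨p, hp⟩ := hex
    rw [Finset.sum_eq_single p]
    · have hj : j ∈ (Finset.Icc (M : ℤ) (M + (8 * (m * K) + 8) : ℕ) : Set ℤ) := by
        have := lev_lt K p
        obtain ⟨h1, h2⟩ := hp
        unfold lev at h1 h2
        rw [Finset.mem_coe, Finset.mem_Icc]
        constructor <;> omega
      rw [indicator_of_mem hp, indicator_of_mem hj]
    · intro q _ hq
      refine indicator_of_notMem (fun hq' => ?_) _
      obtain ⟨h1, h2⟩ := hp
      obtain ⟨h3, h4⟩ := hq'
      rcases lev_gap M hq with h | h <;> omega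
    · simp
  · push Not at hex
    rw [Finset.sum_eq_zero fun p _ => indicator_of_notMem (hex p) _]
    exact zero_le

lemma eLpNorm_indicator_Icc_le (M N : ℕ) {σ : ℝ} (hσ : 1 ≤ σ) (c : ℝ≥0∞) :
    eLpNorm (fun j => c * (Finset.Icc (M : ℤ) (M + N : ℕ) : Set ℤ).indicator 1 j) (ENNReal.ofReal σ)
      Measure.count ≤ c * ENNReal.ofReal ((N + 1 : ℝ) ^ (1 / σ)) := by
  have h0 : 0 < σ := by linarith
  have e : (fun j => c * (Finset.Icc (M : ℤ) (M + N : ℕ) : Set ℤ).indicator 1 j) =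
      (Finset.Icc (M : ℤ) (M + N : ℕ) : Set ℤ).indicator fun _ => c := by
    ext j
    by_cases h : j ∈ (Finset.Icc (M : ℤ) (M + N : ℕ) : Set ℤ)
    · rw [indicator_of_mem h, indicator_of_mem h, Pi.one_apply, mul_one]
    · rw [indicator_of_notMem h, indicator_of_notMem h, mul_zero]
  rw [e, eLpNorm_indicator_const (Finset.measurableSet _) (by simpa using h0) (by simp),
    ENNReal.toReal_ofReal h0.le, Measure.count_apply_finset, enorm_eq_self, Int.card_Icc,
    ← ENNReal.ofReal_rpow_of_pos (by positivity)]
  have h2 : ((M + N : ℕ) + 1 - M : ℤ).toNat = N + 1 := by omega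
  rw [h2]
  gcongr
  rw [← ENNReal.ofReal_natCast]
  push_cast
  exact le_rfl

/-! ### Velocity, force and Reynolds tensor in one time window. -/

/-- The field `div (u ⊗ u)`. -/
def convection (u : Fin n → Sch n) (a : Fin n) : Sch n := ∑ b, dS b (u a * u b)

lemma convection_zero : convection (0 : Fin n → Sch n) = 0 := by
  ext1 a
  have : (0 : Sch n) * 0 = 0 := by ext x; simp
  simp [convection, this]

lemma convection_real {u : Fin n → Sch n} (hu : ∀ a, IsRealS (u a)) (a : Fin n) :
    IsRealS (convection u a) := IsRealS.sum fun b _ => ((hu a).mul (hu b)).dS b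

/-- Off the closed interval the function is locally zero; the endpoints follow by continuity of the
derivative. -/
lemma deriv_eq_zero_of_tf {c : ℝ → ℝ} (hc : TF c) {t : ℝ} (ht : t ∉ Ioo (0 : ℝ) 1) :
    deriv c t = 0 := by
  have hcont : Continuous (deriv c) := hc.1.continuous_deriv le_rfl
  have hcl : IsClosed {t | deriv c t = 0} := isClosed_eq hcont continuous_const
  have hsub : (Icc (0 : ℝ) 1)ᶜ ⊆ {t | deriv c t = 0} := fun s hs => by
    have : c =ᶠ[𝓝 s] fun _ => 0 := by
      filter_upwards [isClosed_Icc.isOpen_compl.mem_nhds hs] with y hy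
      exact hc.2 y fun h => hy (Ioo_subset_Icc_self h)
    rw [mem_ofPred_eq, this.deriv_eq, deriv_const]
  refine closure_minimal hsub hcl ?_
  rw [closure_compl, interior_Icc]
  exact ht

/-- The amplitude normalization of `K` superposed waves. -/
def wt (K : ℕ) : ℝ := Real.sqrt (2 / K)

/-- The normalization compensates the mean value `1/2` of `cos²` and the number `K` of waves. -/
lemma wt_sq (K : ℕ) : wt K ^ 2 = 2 / K := Real.sq_sqrt (by positivity)
lemma wt_nonneg (K : ℕ) : 0 ≤ wt K := Real.sqrt_nonneg _
lemma wt_le_two {K : ℕ} (hK : 1 ≤ K) : wt K ≤ 2 := by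
  refine abs_le_of_sq_le_sq' ?_ two_pos.le |>.2
  rw [wt_sq]
  have : (1 : ℝ) ≤ K := by exact_mod_cast hK
  rw [div_le_iff₀ (by positivity)]
  linarith

namespace Profile

variable (P : Profile n) (M K : ℕ)

/-- Indices of the waves. -/
abbrev Ix (K : ℕ) : Type := (Fin P.m × Fin K) × Bool

/-- The frequency of a wave. -/
def lam (α : P.Ix K) : ℝ := 2 ^ lev M K α.1

lemma one_le_lam (α : P.Ix K) : 1 ≤ P.lam M K α := one_le_pow₀ one_le_two

/-- The frequency vector of a wave. -/
def mu (α : P.Ix K) : Rn n := P.freq α.1.1 α.2 (P.lam M K α)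

/-- The amplitude of a wave. -/
def Z (α : P.Ix K) (a : Fin n) : Sch n := P.wamp α.1.1 α.2 (P.lam M K α) a

/-- The wave itself. -/
def W (α : P.Ix K) (a : Fin n) : Sch n := Md (P.mu M K α) (P.Z M K α a)

/-- The time coefficient of a wave. -/
def cf (α : P.Ix K) (t : ℝ) : ℝ := wt K * P.c α.1.1 t

/-- The velocity field in a time window. -/
def win (t : ℝ) (a : Fin n) : Sch n := (P.θ t : ℂ) • P.U a + ∑ α, (P.cf K α t : ℂ) • P.W M K α a

/-- The linear part of the force. -/
def linForce (t : ℝ) (a : Fin n) : Sch n :=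
  ∑ α, (((deriv (P.cf K α) t : ℝ) : ℂ) • P.W M K α a - (P.cf K α t : ℂ) • lapS (P.W M K α a))

/-- The force in a time window. -/
def force (t : ℝ) (a : Fin n) : Sch n :=
  P.linForce M K t a + (convection (P.win M K t) a - ((P.θ t ^ 2 : ℝ) : ℂ) • convection P.U a -
    ∑ b, ∑ i, (((P.c i t) ^ 2 * P.d i a * P.d i b : ℝ) : ℂ) • dS b (P.q i * P.q i))

/-- The wave with the opposite frequency. -/
def opp {K : ℕ} (α : P.Ix K) : P.Ix K := (α.1, !α.2)

variable {M K}

lemma cf_contDiff (α : P.Ix K) : ContDiff ℝ 1 (P.cf K α) := contDiff_const.mul (P.c_tf _).1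

lemma cf_eq_zero (α : P.Ix K) {t : ℝ} (ht : t ∉ Ioo (0 : ℝ) 1) : P.cf K α t = 0 := by
  simp [cf, (P.c_tf _).2 t ht]

lemma W_div (α : P.Ix K) : ∑ a, dS a (P.W M K α a) = 0 :=
  P.wave_div _ _ (zero_lt_one.trans_le (P.one_le_lam M K α))

lemma win_div (t : ℝ) : ∑ a, dS a (P.win M K t a) = 0 := by
  simp only [win, map_add, map_smul, map_sum, Finset.sum_add_distrib]
  rw [← Finset.smul_sum, P.U_div, Finset.sum_comm]
  simp only [← Finset.smul_sum, P.W_div, smul_zero, Finset.sum_const_zero, add_zero]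

lemma sum_W (t : ℝ) (a : Fin n) (x : Rn n) : (∑ α, (P.cf K α t : ℂ) • P.W M K α a) x =
    ((∑ p : Fin P.m × Fin K, wt K * P.c p.1 t * (P.d p.1 a * ((P.q p.1 x).re *
      Real.cos (2 * Real.pi * ((2 : ℝ) ^ lev M K p * x (P.η p.1)))) +
      (2 * Real.pi * (2 : ℝ) ^ lev M K p)⁻¹ * (Real.sin (2 * Real.pi * ((2 : ℝ) ^ lev M K p *
        x (P.η p.1))) * (P.corr p.1 a x).re)) : ℝ) : ℂ) := by
  rw [sum_apply, Fintype.sum_prod_type, Complex.ofReal_sum]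
  refine Finset.sum_congr rfl fun p _ => ?_
  rw [Fintype.sum_bool, smul_apply, smul_apply]
  have := P.wave_pair_apply p.1 ((2 : ℝ) ^ lev M K p) a x
  simp only [smul_eq_mul, cf, Complex.ofReal_mul (wt K) (P.c _ _)]
  rw [← mul_add, Complex.ofReal_mul (wt K * P.c p.1 t), ← this, Complex.ofReal_mul (wt K)]
  rfl

lemma win_real (t : ℝ) (a : Fin n) : IsRealS (P.win M K t a) :=
  ((P.U_rbl a).1.smul _).add fun x => by rw [sum_W]; exact Complex.ofReal_im _

/-- Conjugate waves carry the same coefficient, so they recombine into real pairs. -/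
lemma linForce_real (t : ℝ) (a : Fin n) : IsRealS (P.linForce M K t a) := by
  have h : ∀ g : P.Ix K → ℝ, (∀ p, g (p, true) = g (p, false)) →
      IsRealS (∑ α, (g α : ℂ) • P.W M K α a) := fun g hg => by
    rw [Fintype.sum_prod_type]
    refine IsRealS.sum fun p _ => ?_
    rw [Fintype.sum_bool, hg, ← smul_add]
    refine IsRealS.smul _ fun x => ?_
    have := P.wave_pair_apply p.1 ((2 : ℝ) ^ lev M K p) a x
    rw [add_apply]
    exact (congrArg Complex.im this).trans (Complex.ofReal_im _)
  have e : P.linForce M K t a = (∑ α, ((deriv (P.cf K α) t : ℝ) : ℂ) • P.W M K α a) -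
      lapS (∑ α, (P.cf K α t : ℂ) • P.W M K α a) := by
    simp only [linForce, Finset.sum_sub_distrib, map_sum, map_smul]
  rw [e]
  exact (h _ fun p => rfl).sub (h _ fun p => rfl).lapS

lemma force_real (t : ℝ) (a : Fin n) : IsRealS (P.force M K t a) :=
  (P.linForce_real t a).add (((convection_real (P.win_real t) a).sub
    ((convection_real (fun k => (P.U_rbl k).1) a).smul _)).sub (IsRealS.sum fun b _ =>
      IsRealS.sum fun i _ => (((P.q_rbl i).1.mul (P.q_rbl i).1).dS b).smul _))

lemma deriv_cf_eq_zero (α : P.Ix K) {t : ℝ} (ht : t ∉ Ioo (0 : ℝ) 1) : deriv (P.cf K α) t = 0 :=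
  deriv_eq_zero_of_tf ⟨P.cf_contDiff α, fun _ h => P.cf_eq_zero α h⟩ ht

lemma win_eq_zero {t : ℝ} (ht : t ∉ Ioo (0 : ℝ) 1) : P.win M K t = 0 := by
  ext1 a
  simp [win, P.cf_eq_zero _ ht, P.θ_tf.2 t ht]

lemma force_eq_zero {t : ℝ} (ht : t ∉ Ioo (0 : ℝ) 1) : P.force M K t = 0 := by
  ext1 a
  simp [force, linForce, P.win_eq_zero ht, P.cf_eq_zero _ ht, P.θ_tf.2 t ht, (P.c_tf _).2 t ht,
    P.deriv_cf_eq_zero _ ht, convection_zero]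

/-- The force is defined with the mean stress of the waves removed; the profile equation trades that
stress and the convection of `U` for `θ' U - θ ΔU` and a gradient. What is left is a heat operator
on finitely many solenoidal modes, as `duhamel` requires: `none` stands for the profile, `some α`
for a wave. -/
lemma force_sub_convection (t : ℝ) (a : Fin n) :
    P.force M K t a - convection (P.win M K t) a =
      (∑ o : Option (P.Ix K), (((deriv (o.elim P.θ (P.cf K)) t : ℝ) : ℂ) • o.elim P.U (P.W M K) a -
        ((o.elim P.θ (P.cf K) t : ℝ) : ℂ) • lapS (o.elim P.U (P.W M K) a))) + dS a (-P.ρ t) := by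
  rw [Fintype.sum_option, map_neg, ← P.eq t a]
  simp only [Option.elim, force, linForce, convection]
  abel

/-- The part of the Reynolds tensor which is not cancelled by the waves. -/
lemma tensor_eq (hK : 1 ≤ K) (t : ℝ) (a b : Fin n) :
    P.win M K t a * P.win M K t b = ((P.θ t ^ 2 : ℝ) : ℂ) • (P.U a * P.U b) +
      ∑ i, (((P.c i t) ^ 2 * P.d i a * P.d i b : ℝ) : ℂ) • (P.q i * P.q i) +
      (∑ α, ((P.θ t * P.cf K α t : ℝ) : ℂ) • (P.U a * P.W M K α b + P.W M K α a * P.U b) +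
      ∑ p : P.Ix K × P.Ix K, ((P.cf K p.1 t * P.cf K p.2 t : ℝ) : ℂ) •
        (if p.2 = P.opp p.1 then 0 else P.W M K p.1 a * P.W M K p.2 b) +
      ∑ α, ((-((2 * Real.pi * P.lam M K α)⁻¹ * P.cf K α t) ^ 2 : ℝ) : ℂ) •
        (P.camp α.1.1 a * P.camp α.1.1 b)) := by
  have hZ : ∀ α, P.W M K α a * P.W M K (P.opp α) b = P.Z M K α a * P.Z M K (P.opp α) b := fun α => by
    rw [W, W, Md_mul]
    have : P.mu M K α + P.mu M K (P.opp α) = 0 := by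
      rcases α with ⟨p, _ | _⟩ <;> simp [mu, freq, opp, sg, lam]
    rw [this, Md_zero]
  -- Over the two signs the mixed products of principal amplitude and corrector cancel. The
  -- principal squares contribute `wt K ^ 2 / 2 = 1 / K` of the target for each of the `K` waves,
  -- which sums to exactly the prescribed tensor.
  have hdiag : ∑ α, ((P.cf K α t : ℂ) * (P.cf K (P.opp α) t : ℂ)) • (P.Z M K α a * P.Z M K (P.opp α) b) =
      ∑ i, (((P.c i t) ^ 2 * P.d i a * P.d i b : ℝ) : ℂ) • (P.q i * P.q i) +
      ∑ α, ((-((2 * Real.pi * P.lam M K α)⁻¹ * P.cf K α t) ^ 2 : ℝ) : ℂ) •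
        (P.camp α.1.1 a * P.camp α.1.1 b) := by
    have h1 : ∀ i : Fin P.m, (((P.c i t) ^ 2 * P.d i a * P.d i b : ℝ) : ℂ) • (P.q i * P.q i) =
        ∑ _k : Fin K, ((wt K ^ 2 / 2 * ((P.c i t) ^ 2 * P.d i a * P.d i b) : ℝ) : ℂ) •
          (P.q i * P.q i) := fun i => by
      have hK0 : (K : ℝ) ≠ 0 := by positivity
      rw [wt_sq, Finset.sum_const, Finset.card_univ, Fintype.card_fin, ← Nat.cast_smul_eq_nsmul ℂ,
        smul_smul]
      congr 1
      rw [← Complex.ofReal_natCast, ← Complex.ofReal_mul]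
      congr 1
      field_simp
    simp only [h1]
    rw [Fintype.sum_prod_type, Fintype.sum_prod_type (f := fun α : P.Ix K => _),
      ← Fintype.sum_prod_type' (f := fun (i : Fin P.m) (_ : Fin K) => _),
      ← Finset.sum_add_distrib]
    refine Finset.sum_congr rfl fun p _ => ?_
    ext x
    simp only [Fintype.sum_bool, opp, Z, wamp, amp, add_apply, smul_apply, mul_apply, smul_eq_mul,
      cf, sg, lam, Bool.not_true, Bool.not_false, if_true, Bool.false_eq_true, if_false]
    push_cast
    ring
  -- Only pairs of opposite frequency are resonant.
  have hoff : ∀ p : P.Ix K × P.Ix K, ((P.cf K p.1 t * P.cf K p.2 t : ℝ) : ℂ) •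
      (P.W M K p.1 a * P.W M K p.2 b) = ((P.cf K p.1 t * P.cf K p.2 t : ℝ) : ℂ) •
        (if p.2 = P.opp p.1 then 0 else P.W M K p.1 a * P.W M K p.2 b) +
      if p.2 = P.opp p.1 then ((P.cf K p.1 t : ℂ) * (P.cf K p.2 t : ℂ)) •
        (P.Z M K p.1 a * P.Z M K p.2 b) else 0 := fun p => by
    split_ifs with h
    · rw [h, ← hZ]; simp
    · simp
  have hsum : ∑ p : P.Ix K × P.Ix K, ((P.cf K p.1 t * P.cf K p.2 t : ℝ) : ℂ) •
      (P.W M K p.1 a * P.W M K p.2 b) = ∑ p : P.Ix K × P.Ix K,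
        ((P.cf K p.1 t * P.cf K p.2 t : ℝ) : ℂ) •
        (if p.2 = P.opp p.1 then 0 else P.W M K p.1 a * P.W M K p.2 b) +
      (∑ i, (((P.c i t) ^ 2 * P.d i a * P.d i b : ℝ) : ℂ) • (P.q i * P.q i) +
      ∑ α, ((-((2 * Real.pi * P.lam M K α)⁻¹ * P.cf K α t) ^ 2 : ℝ) : ℂ) •
        (P.camp α.1.1 a * P.camp α.1.1 b)) := by
    rw [← hdiag, Finset.sum_congr rfl fun p _ => hoff p, Finset.sum_add_distrib]
    congr 1
    rw [Fintype.sum_prod_type]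
    exact Finset.sum_congr rfl fun α _ => by simp
  have hexp : P.win M K t a * P.win M K t b = ((P.θ t ^ 2 : ℝ) : ℂ) • (P.U a * P.U b) +
      ∑ α, ((P.θ t * P.cf K α t : ℝ) : ℂ) • (P.U a * P.W M K α b + P.W M K α a * P.U b) +
      ∑ p : P.Ix K × P.Ix K, ((P.cf K p.1 t * P.cf K p.2 t : ℝ) : ℂ) •
      (P.W M K p.1 a * P.W M K p.2 b) := by
    ext x
    simp only [win, mul_apply, add_apply, smul_apply, sum_apply, smul_eq_mul, Complex.ofReal_mul,
      Complex.ofReal_pow, mul_add, Finset.sum_add_distrib]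
    have e1 : ∑ p : P.Ix K × P.Ix K, (P.cf K p.1 t : ℂ) * (P.cf K p.2 t : ℂ) *
        (P.W M K p.1 a x * P.W M K p.2 b x) =
        (∑ α, (P.cf K α t : ℂ) * P.W M K α a x) * ∑ β, (P.cf K β t : ℂ) * P.W M K β b x := by
      rw [Finset.sum_mul_sum, Fintype.sum_prod_type]
      exact Finset.sum_congr rfl fun α _ => Finset.sum_congr rfl fun β _ => by ring
    have e2 : ∑ α, (P.θ t : ℂ) * (P.cf K α t : ℂ) * (P.U a x * P.W M K α b x) =
        (P.θ t : ℂ) * P.U a x * ∑ α, (P.cf K α t : ℂ) * P.W M K α b x := by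
      rw [Finset.mul_sum]
      exact Finset.sum_congr rfl fun α _ => by ring
    have e3 : ∑ α, (P.θ t : ℂ) * (P.cf K α t : ℂ) * (P.W M K α a x * P.U b x) =
        (P.θ t : ℂ) * P.U b x * ∑ α, (P.cf K α t : ℂ) * P.W M K α a x := by
      rw [Finset.mul_sum]
      exact Finset.sum_congr rfl fun α _ => by ring
    rw [e1, e2, e3]
    ring
  rw [hexp, hsum]
  abel

end Profile

/-! ### Continuity in time for Besov norms. -/

lemma besovNorm_add_le (χ : Rn n → ℝ) (s : ℝ) {p q : ℝ≥0∞} (hp : 1 ≤ p) (hq : 1 ≤ q)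
    (T T' : Dist n) : besovNorm χ s p q (T + T') ≤ besovNorm χ s p q T + besovNorm χ s p q T' := by
  simp only [besovNorm_eq]
  refine le_trans (eLpNorm_mono_enorm fun j => ?_)
    (eLpNorm_add_le (f := blockNorm χ s p T) (g := blockNorm χ s p T') .of_discrete .of_discrete hq)
  simpa using blockNorm_add_le χ s hp T T' j

/-- Continuity in time with respect to a Besov norm. -/
def BesovCont (χ : Rn n → ℝ) (s : ℝ) (p q : ℝ≥0∞) (g : ℝ → Dist n) : Prop :=
  ∀ t₀, Tendsto (fun t => besovNorm χ s p q (g t - g t₀)) (𝓝 t₀) (𝓝 0)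

lemma BesovCont.add {χ : Rn n → ℝ} {s : ℝ} {p q : ℝ≥0∞} (hp : 1 ≤ p) (hq : 1 ≤ q)
    {g g' : ℝ → Dist n} (h : BesovCont χ s p q g) (h' : BesovCont χ s p q g') :
    BesovCont χ s p q (fun t => g t + g' t) := fun t₀ => by
  refine tendsto_of_tendsto_of_tendsto_of_le_of_le tendsto_const_nhds
    (by simpa using (h t₀).add (h' t₀)) (fun t => zero_le) fun t => ?_
  refine le_trans (le_of_eq ?_) (besovNorm_add_le χ s hp hq (g t - g t₀) (g' t - g' t₀))
  rw [add_sub_add_comm]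

lemma BesovCont.sum_smul {χ : Rn n → ℝ} {s : ℝ} {p q : ℝ≥0∞} (hp : 1 ≤ p) (hq : 1 ≤ q)
    {ι : Type*} [Fintype ι] {c : ι → ℝ → ℝ} (hc : ∀ i, Continuous (c i)) {F : ι → Dist n}
    (hF : ∀ i, besovNorm χ s p q (F i) < ⊤) :
    BesovCont χ s p q (fun t => ∑ i, (c i t : ℂ) • F i) := fun t₀ => by
  have hlim : Tendsto (fun t => ∑ i, ‖((c i t - c i t₀ : ℝ) : ℂ)‖ₑ * besovNorm χ s p q (F i)) (𝓝 t₀)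
      (𝓝 0) := by
    have : (0 : ℝ≥0∞) = ∑ i : ι, 0 := by simp
    rw [this]
    refine tendsto_finsetSum _ fun i _ => ?_
    have h1 : Tendsto (fun t => ‖((c i t - c i t₀ : ℝ) : ℂ)‖ₑ) (𝓝 t₀) (𝓝 0) := by
      have h2 : Continuous fun t => ‖((c i t - c i t₀ : ℝ) : ℂ)‖ₑ := by
        have := hc i
        fun_prop
      simpa using h2.tendsto t₀
    simpa using ENNReal.Tendsto.mul_const h1 (.inr (hF i).ne)
  refine tendsto_of_tendsto_of_tendsto_of_le_of_le tendsto_const_nhds hlim (fun t => zero_le)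
    fun t => ?_
  refine le_trans (le_of_eq ?_) (besovNorm_sum_smul_le χ s hp hq Finset.univ _ F)
  congr 1
  rw [← Finset.sum_sub_distrib]
  exact Finset.sum_congr rfl fun i _ => by rw [Complex.ofReal_sub]; exact (sub_smul _ _ _).symm

lemma besovNorm_lt_top_of_tsum {χ : Rn n → ℝ} {s σ : ℝ} (hσ : 1 ≤ σ) {p : ℝ≥0∞} {T : Dist n}
    (h : ∑' j, blockNorm χ s p T j < ⊤) : besovNorm χ s p (ENNReal.ofReal σ) T < ⊤ :=
  (eLpNorm_count_le_tsum _ hσ).trans_lt h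

lemma besovNorm_lt_top_of_indicator {χ : Rn n → ℝ} {s σ : ℝ} (hσ : 1 ≤ σ) {p : ℝ≥0∞} {T : Dist n}
    {c : ℝ≥0∞} (hc : c ≠ ⊤) {L : ℕ}
    (h : ∀ j, blockNorm χ s p T j ≤ c * (Icc (L : ℤ) (L + 5)).indicator 1 j) :
    besovNorm χ s p (ENNReal.ofReal σ) T < ⊤ := by
  have h1 := eLpNorm_indicator_Icc_le L 5 hσ c
  refine lt_of_le_of_lt ?_ (h1.trans_lt (by finiteness))
  rw [besovNorm_eq]
  refine eLpNorm_mono_enorm fun j => (h j).trans ?_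
  rw [Finset.coe_Icc]
  push_cast
  exact le_rfl

lemma TF.exists_bound {c : ℝ → ℝ} (hc : TF c) : ∃ C, ∀ t, |c t| ≤ C ∧ |deriv c t| ≤ C := by
  obtain ⟨C₁, h1⟩ := isCompact_Icc.exists_bound_of_continuousOn (s := Icc (0 : ℝ) 1)
    hc.1.continuous.continuousOn
  obtain ⟨C₂, h2⟩ := isCompact_Icc.exists_bound_of_continuousOn (s := Icc (0 : ℝ) 1)
    (hc.1.continuous_deriv le_rfl).continuousOn
  refine ⟨max C₁ C₂, fun t => ?_⟩
  have h0 : 0 ≤ max C₁ C₂ := ((norm_nonneg _).trans (h1 0 (by simp))).trans (le_max_left _ _)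
  by_cases ht : t ∈ Ioo (0 : ℝ) 1
  · exact ⟨(h1 t (Ioo_subset_Icc_self ht)).trans (le_max_left _ _),
      (h2 t (Ioo_subset_Icc_self ht)).trans (le_max_right _ _)⟩
  · rw [hc.2 t ht, deriv_eq_zero_of_tf hc ht, abs_zero]
    exact ⟨h0, h0⟩

/-! ### Time bounds, nonresonance and the expansion of the force. -/

namespace Profile

variable (P : Profile n)

lemma exists_time_bound : ∃ C, 1 ≤ C ∧ ∀ t, |P.θ t| ≤ C ∧ ∀ i, |P.c i t| ≤ C ∧ |deriv (P.c i) t| ≤ C := by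
  obtain ⟨C₀, h0⟩ := P.θ_tf.exists_bound
  choose C hC using fun i => (P.c_tf i).exists_bound
  have hs : ∀ i, C i ≤ ∑ i, |C i| := fun i => (le_abs_self _).trans
    (Finset.single_le_sum (f := fun i => |C i|) (fun i _ => abs_nonneg _) (Finset.mem_univ i))
  have hp : 0 ≤ ∑ i, |C i| := Finset.sum_nonneg fun i _ => abs_nonneg _
  have hp0 : 0 ≤ C₀ := (abs_nonneg _).trans (h0 0).1
  refine ⟨1 + C₀ + ∑ i, |C i|, by linarith, fun t => ⟨by linarith [(h0 t).1], fun i =>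
    ⟨by linarith [(hC i t).1, hs i], by linarith [(hC i t).2, hs i]⟩⟩⟩

variable {M K : ℕ}

/-- Waves at different levels have frequencies differing by at least a factor `2`, so the larger one
dominates the sum. At the same level a non-opposite pair is a wave with itself, and its frequency
doubles. -/
lemma le_norm_mu_add {α β : P.Ix K} (h : β ≠ P.opp α) :
    (2 : ℝ) ^ (M + 1) ≤ ‖P.mu M K α + P.mu M K β‖ := by
  have hpow : ∀ γ : P.Ix K, (2 : ℝ) ^ (M + 2) ≤ P.lam M K γ := fun γ =>
    pow_le_pow_right₀ one_le_two (by unfold lev; omega)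
  have hn : ∀ γ : P.Ix K, ‖P.mu M K γ‖ = P.lam M K γ := fun γ =>
    P.norm_freq _ _ (zero_le_one.trans (P.one_le_lam M K γ))
  have h2 : (2 : ℝ) ^ (M + 2) = 2 * 2 ^ (M + 1) := by ring
  have h0 : (0 : ℝ) < 2 ^ (M + 1) := by positivity
  by_cases hp : α.1 = β.1
  · have hab : β = α := by
      rcases α with ⟨p, s⟩
      rcases β with ⟨p', s'⟩
      obtain rfl : p = p' := hp
      cases s <;> cases s' <;> simp_all [opp]
    have : P.mu M K α + P.mu M K β = (2 : ℝ) • P.mu M K α := by rw [hab, two_smul]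
    rw [this, norm_smul, hn]
    have := hpow α
    norm_num
    linarith
  · have h8 : ∀ a b : ℕ, a + 8 ≤ b → (2 : ℝ) ^ a * 2 ≤ 2 ^ b := fun a b hab => by
      rw [← pow_succ]
      exact pow_le_pow_right₀ one_le_two (by omega)
    have ha := hpow α
    have hb := hpow β
    have n1 := norm_sub_norm_le (P.mu M K α) (-P.mu M K β)
    have n2 := norm_sub_norm_le (P.mu M K β) (-P.mu M K α)
    rw [norm_neg, sub_neg_eq_add, hn, hn] at n1 n2
    rw [add_comm (P.mu M K β)] at n2
    rcases lev_gap M hp with h | h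
    · have := h8 _ _ h
      change P.lam M K α * 2 ≤ P.lam M K β at this
      linarith
    · have := h8 _ _ h
      change P.lam M K β * 2 ≤ P.lam M K α at this
      linarith

/-- Interaction of the profile with a wave. -/
def crossField (M : ℕ) (α : P.Ix K) (a : Fin n) : Sch n :=
  ∑ b, dS b (P.U a * P.W M K α b + P.W M K α a * P.U b)

/-- Nonresonant interaction of two waves. -/
def pairField (M : ℕ) (p : P.Ix K × P.Ix K) (a : Fin n) : Sch n :=
  ∑ b, dS b (if p.2 = P.opp p.1 then 0 else P.W M K p.1 a * P.W M K p.2 b)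

/-- Self-interaction of a corrector. -/
def selfField (i : Fin P.m) (a : Fin n) : Sch n := ∑ b, dS b (P.camp i a * P.camp i b)

/-- After `tensor_eq` the low-frequency part of the quadratic term is exactly what the definition of
the force subtracts. The five remaining families are finite sums of fixed fields with scalar time
coefficients, which gives both the size and the continuity of the force. -/
lemma force_expand (hK : 1 ≤ K) (t : ℝ) : toDist (P.force M K t) =
    (∑ α, ((deriv (P.cf K α) t : ℝ) : ℂ) • toDist (P.W M K α) +
      ∑ α, ((-P.cf K α t : ℝ) : ℂ) • toDist (fun a => lapS (P.W M K α a))) +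
    (∑ α, ((P.θ t * P.cf K α t : ℝ) : ℂ) • toDist (P.crossField M α) +
      ∑ p : P.Ix K × P.Ix K, ((P.cf K p.1 t * P.cf K p.2 t : ℝ) : ℂ) • toDist (P.pairField M p) +
      ∑ α, ((-((2 * Real.pi * P.lam M K α)⁻¹ * P.cf K α t) ^ 2 : ℝ) : ℂ) •
        toDist (P.selfField α.1.1)) := by
  simp only [← map_smul, ← map_sum, ← map_add]
  congr 1
  ext1 a
  simp only [force, linForce, convection, P.tensor_eq hK, Pi.add_apply, Finset.sum_apply,
    Pi.smul_apply, crossField, pairField, selfField, map_add, map_sum, map_smul,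
    Finset.sum_add_distrib, Finset.smul_sum, Finset.sum_sub_distrib, smul_add]
  rw [Finset.sum_comm (f := fun b α => ((P.θ t * P.cf K α t : ℝ) : ℂ) • dS b (P.U a * P.W M K α b)),
    Finset.sum_comm (f := fun b α => ((P.θ t * P.cf K α t : ℝ) : ℂ) • dS b (P.W M K α a * P.U b)),
    Finset.sum_comm (f := fun b (p : P.Ix K × P.Ix K) => ((P.cf K p.1 t * P.cf K p.2 t : ℝ) : ℂ) •
      dS b (if p.2 = P.opp p.1 then 0 else P.W M K p.1 a * P.W M K p.2 b)),
    Finset.sum_comm (f := fun b (α : P.Ix K) =>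
      ((-((2 * Real.pi * P.lam M K α)⁻¹ * P.cf K α t) ^ 2 : ℝ) : ℂ) •
        dS b (P.camp α.1.1 a * P.camp α.1.1 b))]
  simp only [Complex.ofReal_neg, neg_smul, Finset.sum_neg_distrib]
  abel

/-- The wave part of the velocity. -/
lemma win_expand (t : ℝ) : toDist (P.win M K t) = (P.θ t : ℂ) • toDist P.U +
    ∑ α, (P.cf K α t : ℂ) • toDist (P.W M K α) := by
  simp only [← map_smul, ← map_sum, ← map_add]
  congr 1
  ext1 a
  simp [win]

end Profile

/-! ### Uniform bounds on the building blocks. -/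

/-- Uniform bounds on the building blocks of the force. -/
structure BlockBounds (P : Profile n) (χ : Rn n → ℝ) (r : ℝ) (Q : ℝ≥0∞) (M₀ : ℕ) : Prop where
  wave : ∀ M, M₀ ≤ M → ∀ K (α : P.Ix K) j,
    blockNorm χ (n / r - 1) (ENNReal.ofReal r) (toDist (P.W M K α)) j ≤
      (Q * ENNReal.ofReal ((2 : ℝ) ^ ((n / r - 1) * M))) *
        (Icc (lev M K α.1 : ℤ) (lev M K α.1 + 5)).indicator 1 j
  wave' : ∀ M, M₀ ≤ M → ∀ K (α : P.Ix K) j,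
    blockNorm χ (n / r - 3) (ENNReal.ofReal r) (toDist (P.W M K α)) j ≤
      (Q * ENNReal.ofReal ((2 : ℝ) ^ ((n / r - 1) * M))) *
        (Icc (lev M K α.1 : ℤ) (lev M K α.1 + 5)).indicator 1 j
  lap : ∀ M, M₀ ≤ M → ∀ K (α : P.Ix K) j,
    blockNorm χ (n / r - 3) (ENNReal.ofReal r) (toDist (fun a => lapS (P.W M K α a))) j ≤
      (Q * ENNReal.ofReal ((2 : ℝ) ^ ((n / r - 1) * M))) *
        (Icc (lev M K α.1 : ℤ) (lev M K α.1 + 5)).indicator 1 j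
  cross : ∀ M, M₀ ≤ M → ∀ K (α : P.Ix K),
    ∑' j, blockNorm χ (n / r - 3) (ENNReal.ofReal r) (toDist (P.crossField M α)) j ≤
      Q * ENNReal.ofReal (2⁻¹ ^ M)
  pair : ∀ M, M₀ ≤ M → ∀ K (p : P.Ix K × P.Ix K),
    ∑' j, blockNorm χ (n / r - 3) (ENNReal.ofReal r) (toDist (P.pairField M p)) j ≤
      Q * ENNReal.ofReal (2⁻¹ ^ M)
  self : ∀ i, ∑' j, blockNorm χ (n / r - 3) (ENNReal.ofReal r) (toDist (P.selfField i)) j ≤ Q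

/-- Divergences of high-frequency tensors are small. -/
lemma tsum_blockNorm_div_high {χ : Rn n → ℝ} (hχ : IsLittlewoodPaley χ) {r s C R : ℝ} (hr : 2 ≤ r)
    (hs : s + 1 ≤ -1) (hC : 0 ≤ C) {W : Fin n → Sch n} (H : Fin n → Fin n → Sch n) {c : Rn n} {M : ℕ}
    (hW : ∀ a, W a = ∑ b, dS b (H a b)) (hb : ∀ a b ξ, ‖𝓕 (H a b) ξ‖ ≤ C)
    (hH : ∀ a b, Spec (H a b) c R) (hRM : R ≤ (2 : ℝ) ^ M)
    (hc : (∃ a b, H a b ≠ 0) → (2 : ℝ) ^ (M + 1) ≤ ‖c‖) :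
    ∑' j, blockNorm χ s (ENNReal.ofReal r) (toDist W) j ≤
      (n * volume (Metric.closedBall (0 : Rn n) R) ^ (1 - 1 / r) * 2) *
        ENNReal.ofReal (2 * Real.pi * n * C) * ENNReal.ofReal (2⁻¹ ^ M) := by
  have hpi := Real.pi_pos
  have := tsum_blockNorm_le_of_high (W := W) (A := 2 * Real.pi * n * C) (R := R) (s := s) hχ hr
    hs (by positivity) c M (fun a ξ => by rw [hW]; exact norm_fourier_div_le hb a ξ)
    (fun a ξ h => by
      rw [hW] at h
      obtain ⟨b, hb⟩ := fourier_div_ne_zero h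
      have h1 := hH a b ξ hb
      have h2 := hc ⟨a, b, fun h0 => hb (by rw [h0, fourier_zero])⟩
      refine ⟨h1, ?_⟩
      have h3 := norm_sub_norm_le c ξ
      rw [norm_sub_rev] at h3
      rw [pow_succ] at h2
      linarith)
  rwa [ENNReal.ofReal_mul (by positivity), ← mul_assoc] at this

/-- Divergences of band-limited tensors have finite norm. -/
lemma tsum_blockNorm_div_low {χ : Rn n → ℝ} (hχ : IsLittlewoodPaley χ) {r s C R : ℝ} (hr : 2 ≤ r)
    (hs : 0 < s + 1 + n * (1 - 1 / r)) (hC : 0 ≤ C) {W : Fin n → Sch n} (H : Fin n → Fin n → Sch n)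
    (hW : ∀ a, W a = ∑ b, dS b (H a b)) (hb : ∀ a b ξ, ‖𝓕 (H a b) ξ‖ ≤ C)
    (hH : ∀ a b, Spec (H a b) 0 R) :
    ∑' j, blockNorm χ s (ENNReal.ofReal r) (toDist W) j < ⊤ := by
  have hpi := Real.pi_pos
  refine tsum_blockNorm_lt_top (A := 2 * Real.pi * n * C) (R := R) hχ hr hs (by positivity)
    (fun a ξ => by rw [hW]; exact norm_fourier_div_le hb a ξ) (fun a ξ h => ?_)
  rw [hW] at h
  obtain ⟨b, hb⟩ := fourier_div_ne_zero h
  simpa using hH a b ξ hb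

lemma norm_fourier_lapS_le {F : Sch n} {c : Rn n} {R C lam : ℝ} (hC : ∀ ξ, ‖𝓕 F ξ‖ ≤ C)
    (hF : Spec F c R) (hc : ‖c‖ = lam) (hR : R ≤ lam) (ξ : Rn n) :
    ‖𝓕 (lapS F) ξ‖ ≤ 16 * Real.pi ^ 2 * C * lam ^ 2 := by
  have hC0 : 0 ≤ C := (norm_nonneg _).trans (hC 0)
  rw [fourier_lapS, norm_mul, norm_neg, Complex.norm_real, Real.norm_of_nonneg (by positivity)]
  by_cases h0 : 𝓕 F ξ = 0
  · rw [h0, norm_zero, mul_zero]; positivity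
  have h1 := hF ξ h0
  have h2 := norm_sub_norm_le ξ c
  have h4 : ‖ξ‖ ≤ 2 * lam := by linarith
  calc _ ≤ (2 * Real.pi) ^ 2 * (2 * lam) ^ 2 * C := by
        gcongr
        exact hC ξ
    _ = _ := by ring

lemma mul_Md (μ : Rn n) (F G : Sch n) : F * Md μ G = Md μ (F * G) := by
  conv_lhs => rw [← Md_zero F]
  rw [Md_mul, zero_add]

lemma Md_mul' (μ : Rn n) (F G : Sch n) : Md μ F * G = Md μ (F * G) := by
  conv_lhs => rw [← Md_zero G]
  rw [Md_mul, add_zero]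

/-- The constant in `blockNorm_wave_le`. -/
def waveConst (n : ℕ) (r R s A : ℝ) : ℝ≥0∞ :=
  ENNReal.ofReal ((2 : ℝ) ^ (5 * |s|)) * (n * ENNReal.ofReal A *
        volume (Metric.closedBall (0 : Rn n) R) ^ (1 - 1 / r))

lemma waveConst_ne_top (n : ℕ) {r : ℝ} (hr : 1 ≤ r) (R s A : ℝ) : waveConst n r R s A ≠ ⊤ := by
  have : volume (Metric.closedBall (0 : Rn n) R) ^ (1 - 1 / r) ≠ ⊤ :=
    ENNReal.rpow_ne_top_of_nonneg (by rw [sub_nonneg, div_le_one (by linarith)]; linarith)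
      measure_closedBall_lt_top.ne
  unfold waveConst
  finiteness

/-- The constant in `tsum_blockNorm_div_high`. -/
def divConst (n : ℕ) (r R C : ℝ) : ℝ≥0∞ :=
  (n * volume (Metric.closedBall (0 : Rn n) R) ^ (1 - 1 / r) * 2) *
        ENNReal.ofReal (2 * Real.pi * n * C)

lemma divConst_ne_top (n : ℕ) {r : ℝ} (hr : 1 ≤ r) (R C : ℝ) : divConst n r R C ≠ ⊤ := by
  have : volume (Metric.closedBall (0 : Rn n) R) ^ (1 - 1 / r) ≠ ⊤ :=
    ENNReal.rpow_ne_top_of_nonneg (by rw [sub_nonneg, div_le_one (by linarith)]; linarith)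
      measure_closedBall_lt_top.ne
  unfold divConst
  finiteness

namespace Profile

variable (P : Profile n) {M K : ℕ}

lemma norm_mu (α : P.Ix K) : ‖P.mu M K α‖ = (2 : ℝ) ^ lev M K α.1 :=
  P.norm_freq _ _ (zero_le_one.trans (P.one_le_lam M K α))

variable {P} {S : Set (Sch n)} {C R : ℝ}

lemma W_spec (hS : IsAmpFamily S C R) {α : P.Ix K} {a : Fin n} (hZ : P.Z M K α a ∈ S) :
    Spec (P.W M K α a) (P.mu M K α) R := by
  have := (hS.spec _ hZ).Md (P.mu M K α)
  rwa [zero_add] at this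

lemma W_bound (hS : IsAmpFamily S C R) {α : P.Ix K} {a : Fin n} (hZ : P.Z M K α a ∈ S) (ξ : Rn n) :
    ‖𝓕 (P.W M K α a) ξ‖ ≤ C := by
  rw [W, fourier_Md]; exact hS.bound _ hZ _

variable {χ : Rn n → ℝ} {r : ℝ}

/-- The product is a fixed-size amplitude modulated at a frequency of size at least `2 ^ (M + 2)`.
The hypothesis `n / r ≤ 1` supplies the decay needed for divergences at high frequency. -/
lemma tsum_crossField_le (hχ : IsLittlewoodPaley χ) (hr : 2 ≤ r) (hnr : n / r ≤ 1)
    (hS : IsAmpFamily S C R) (hC : 0 ≤ C) (hU : ∀ a, P.U a ∈ S)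
    (hZ : ∀ (α : P.Ix K) a, P.Z M K α a ∈ S) (hRM : 2 * R ≤ (2 : ℝ) ^ M) (α : P.Ix K) :
    ∑' j, blockNorm χ (n / r - 3) (ENNReal.ofReal r) (toDist (P.crossField M α)) j ≤
      divConst n r (2 * R) (2 * C) * ENNReal.ofReal (2⁻¹ ^ M) := by
  have hH : ∀ a b, P.U a * P.W M K α b + P.W M K α a * P.U b =
      Md (P.mu M K α) (P.U a * P.Z M K α b + P.Z M K α a * P.U b) := fun a b => by
    rw [map_add, W, W, mul_Md, Md_mul']
  refine tsum_blockNorm_div_high (c := P.mu M K α) (C := 2 * C) hχ hr (by linarith) (by linarith)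
    (fun a b => P.U a * P.W M K α b + P.W M K α a * P.U b) (fun a => rfl) (fun a b ξ => ?_)
    (fun a b => ?_) hRM fun _ => ?_
  · rw [hH, fourier_Md, fourier_add, two_mul C]
    exact (norm_add_le _ _).trans (add_le_add (hS.bound_mul _ (hU a) _ (hZ α b) _)
      (hS.bound_mul _ (hZ α a) _ (hU b) _))
  · rw [hH]
    have := (((hS.spec _ (hU a)).mul (hS.spec _ (hZ α b))).add
      ((hS.spec _ (hZ α a)).mul (hS.spec _ (hU b)))).Md (P.mu M K α)
    rwa [zero_add, ← two_mul] at this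
  · rw [norm_mu]
    exact pow_le_pow_right₀ one_le_two (by unfold lev; omega)

lemma tsum_pairField_le (hχ : IsLittlewoodPaley χ) (hr : 2 ≤ r) (hnr : n / r ≤ 1)
    (hS : IsAmpFamily S C R) (hC : 0 ≤ C)
    (hZ : ∀ (α : P.Ix K) a, P.Z M K α a ∈ S) (hRM : 2 * R ≤ (2 : ℝ) ^ M) (p : P.Ix K × P.Ix K) :
    ∑' j, blockNorm χ (n / r - 3) (ENNReal.ofReal r) (toDist (P.pairField M p)) j ≤
      divConst n r (2 * R) (2 * C) * ENNReal.ofReal (2⁻¹ ^ M) := by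
  have hH : ∀ a b, P.W M K p.1 a * P.W M K p.2 b =
      Md (P.mu M K p.1 + P.mu M K p.2) (P.Z M K p.1 a * P.Z M K p.2 b) := fun a b => by
    rw [W, W, Md_mul]
  refine tsum_blockNorm_div_high (c := P.mu M K p.1 + P.mu M K p.2) (C := 2 * C) hχ hr
    (by linarith) (by linarith)
    (fun a b => if p.2 = P.opp p.1 then 0 else P.W M K p.1 a * P.W M K p.2 b)
    (fun a => rfl) (fun a b ξ => ?_) (fun a b => ?_) hRM fun hex => ?_
  · split_ifs
    · rw [fourier_zero, norm_zero]; positivity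
    · rw [hH, fourier_Md]
      have := hS.bound_mul _ (hZ p.1 a) _ (hZ p.2 b) (ξ - (P.mu M K p.1 + P.mu M K p.2))
      linarith
  · split_ifs
    · exact Spec.zero _ _
    · rw [hH]
      have := ((hS.spec _ (hZ p.1 a)).mul (hS.spec _ (hZ p.2 b))).Md (P.mu M K p.1 + P.mu M K p.2)
      rwa [zero_add, ← two_mul] at this
  · obtain ⟨a, b, hab⟩ := hex
    exact P.le_norm_mu_add fun h => hab (if_pos h)

/-- This interaction is unmodulated, so only finiteness is available here; smallness will come from
the squared inverse frequency in its coefficient. The low-frequency exponent is `n - 2 > 0`. -/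
lemma tsum_selfField_lt_top (hχ : IsLittlewoodPaley χ) (hn : 3 ≤ n) (hr : 2 ≤ r)
    (hS : IsAmpFamily S C R) (hC : 0 ≤ C) (hB : ∀ i a, P.camp i a ∈ S) (i : Fin P.m) :
    ∑' j, blockNorm χ (n / r - 3) (ENNReal.ofReal r) (toDist (P.selfField i)) j < ⊤ := by
  have hn3 : (3 : ℝ) ≤ n := by exact_mod_cast hn
  refine tsum_blockNorm_div_low (R := R + R) hχ hr ?_ hC (fun a b => P.camp i a * P.camp i b)
    (fun a => rfl) (fun a b ξ => hS.bound_mul _ (hB i a) _ (hB i b) ξ)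
    fun a b => (hS.spec _ (hB i a)).mul (hS.spec _ (hB i b))
  have hr0 : r ≠ 0 := by linarith
  have : (n : ℝ) / r - 3 + 1 + n * (1 - 1 / r) = n - 2 := by field_simp; ring
  rw [this]
  linarith

lemma exists_blockBounds (P : Profile n) (hχ : IsLittlewoodPaley χ) (hn : 3 ≤ n)
    (hr : (n : ℝ) ≤ r) : ∃ Q M₀, Q ≠ ⊤ ∧ BlockBounds P χ r Q M₀ := by
  obtain ⟨S, C, R, hC, hR, hS, hU, hcamp, hwamp⟩ := P.exists_ampFamily
  have hn3 : (3 : ℝ) ≤ n := by exact_mod_cast hn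
  have hr2 : 2 ≤ r := by linarith
  have hnr : n / r ≤ 1 := (div_le_one (by linarith)).2 hr
  -- Frequencies above this threshold outweigh the spectral radius of any product of two amplitudes.
  obtain ⟨M₀, hM₀⟩ : ∃ M₀ : ℕ, 2 * R < (2 : ℝ) ^ M₀ := pow_unbounded_of_one_lt _ one_lt_two
  have hRM : ∀ M, M₀ ≤ M → 2 * R ≤ (2 : ℝ) ^ M := fun M hM =>
    hM₀.le.trans (pow_le_pow_right₀ one_le_two hM)
  have hZ : ∀ M K (α : P.Ix K) a, P.Z M K α a ∈ S := fun M K α a =>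
    hwamp _ _ _ _ (P.one_le_lam M K α)
  have hML : ∀ M K (α : P.Ix K), M ≤ lev M K α.1 := fun M K α => by unfold lev; omega
  have hRL : ∀ M, M₀ ≤ M → ∀ K (α : P.Ix K), 2 * R ≤ (2 : ℝ) ^ lev M K α.1 := fun M hM K α =>
    (hRM M hM).trans (pow_le_pow_right₀ one_le_two (hML M K α))
  have h31 : (n : ℝ) / r - 3 + 2 = n / r - 1 := by ring
  have hmono : ∀ (Q Q' : ℝ≥0∞) (x y : ℝ≥0∞), Q ≤ Q' → Q * x * y ≤ Q' * x * y :=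
    fun Q Q' x y h => by gcongr
  obtain ⟨q₁, hq₁⟩ : ∃ q, q = waveConst n r R (n / r - 1) C := ⟨_, rfl⟩
  obtain ⟨q₂, hq₂⟩ : ∃ q, q = waveConst n r R (n / r - 3) C := ⟨_, rfl⟩
  obtain ⟨q₃, hq₃⟩ : ∃ q, q = waveConst n r R (n / r - 3) (16 * Real.pi ^ 2 * C) := ⟨_, rfl⟩
  obtain ⟨q₄, hq₄⟩ : ∃ q, q = divConst n r (2 * R) (2 * C) := ⟨_, rfl⟩
  obtain ⟨q₅, hq₅⟩ : ∃ q, q = ∑ i, ∑' j, blockNorm χ (n / r - 3) (ENNReal.ofReal r)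
    (toDist (P.selfField i)) j := ⟨_, rfl⟩
  have ht₁ : q₁ ≠ ⊤ := hq₁ ▸ waveConst_ne_top n (by linarith) _ _ _
  have ht₂ : q₂ ≠ ⊤ := hq₂ ▸ waveConst_ne_top n (by linarith) _ _ _
  have ht₃ : q₃ ≠ ⊤ := hq₃ ▸ waveConst_ne_top n (by linarith) _ _ _
  have ht₄ : q₄ ≠ ⊤ := hq₄ ▸ divConst_ne_top n (by linarith) _ _
  have ht₅ : q₅ ≠ ⊤ := hq₅ ▸ (ENNReal.sum_lt_top.2 fun i _ =>
    tsum_selfField_lt_top hχ hn hr2 hS hC hcamp i).ne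
  refine ⟨q₁ + q₂ + q₃ + q₄ + q₅, M₀, by finiteness, ⟨fun M hM K α j => ?_, fun M hM K α j => ?_,
    fun M hM K α j => ?_, fun M hM K α => ?_, fun M hM K p => ?_, fun i => ?_⟩⟩
  · have := blockNorm_wave_le (κ := 0) (s := n / r - 1) hχ hr2 hC (by linarith)
      (hML M K α) (P.norm_mu α) (hRL M hM K α)
      (fun a ξ => by simpa using W_bound hS (hZ M K α a) ξ) (fun a => W_spec hS (hZ M K α a)) j
    rw [add_zero] at this
    refine this.trans (hmono _ _ _ _ ?_)
    exact hq₁.symm.le.trans (le_self_add.trans (le_self_add.trans (le_self_add.trans le_self_add)))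
  -- Taking `κ = 2` is wasteful for the time-derivative term, but it puts it at the same exponent `n
  -- / r - 1` as the Laplacian term.
  · have := blockNorm_wave_le (κ := 2) (s := n / r - 3) hχ hr2 hC (by linarith)
      (hML M K α) (P.norm_mu α) (hRL M hM K α)
      (fun a ξ => (W_bound hS (hZ M K α a) ξ).trans (le_mul_of_one_le_right hC
        (Real.one_le_rpow one_le_two (by positivity)))) (fun a => W_spec hS (hZ M K α a)) j
    rw [h31] at this
    refine this.trans (hmono _ _ _ _ ?_)
    exact hq₂.symm.le.trans (le_add_self.trans (le_self_add.trans (le_self_add.trans le_self_add)))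
  · have := blockNorm_wave_le (κ := 2) (s := n / r - 3) (A := 16 * Real.pi ^ 2 * C)
      (W := fun a => lapS (P.W M K α a)) hχ hr2 (by positivity) (by linarith)
      (hML M K α) (P.norm_mu α) (hRL M hM K α)
      (fun a ξ => ?_) (fun a ξ hξ => W_spec hS (hZ M K α a) ξ fun h => hξ (by
        rw [fourier_lapS, h, mul_zero])) j
    · rw [h31] at this
      refine this.trans (hmono _ _ _ _ ?_)
      exact hq₃.symm.le.trans (le_add_self.trans (le_self_add.trans le_self_add))
    · have h5 : (2 : ℝ) ^ (2 * (lev M K α.1 : ℝ)) = (2 ^ lev M K α.1) ^ 2 := by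
        rw [mul_comm, Real.rpow_mul two_pos.le, Real.rpow_natCast, Real.rpow_two]
      rw [h5]
      exact norm_fourier_lapS_le (W_bound hS (hZ M K α a)) (W_spec hS (hZ M K α a)) (P.norm_mu α)
        (by have := hRL M hM K α; linarith) ξ
  · refine (tsum_crossField_le hχ hr2 hnr hS hC hU (hZ M K) (hRM M hM) α).trans ?_
    gcongr
    exact hq₄.symm.le.trans (le_add_self.trans le_self_add)
  · refine (tsum_pairField_le hχ hr2 hnr hS hC (hZ M K) (hRM M hM) p).trans ?_
    gcongr
    exact hq₄.symm.le.trans (le_add_self.trans le_self_add)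
  · refine le_trans ?_ (hq₅.symm.le.trans le_add_self)
    exact (Finset.single_le_sum (f := fun i => ∑' j, blockNorm χ (n / r - 3) (ENNReal.ofReal r)
      (toDist (P.selfField i)) j) (fun i _ => zero_le) (Finset.mem_univ i))

end Profile

/-! ### Size and continuity of the force and velocity in a window. -/

lemma blockNorm_sum_smul_le_const {χ : Rn n → ℝ} {s : ℝ} {p : ℝ≥0∞} (hp : 1 ≤ p) {ι : Type*}
    [Fintype ι] {c : ι → ℝ} {C : ℝ} (hc : ∀ i, |c i| ≤ C) (T : ι → Dist n) (j : ℤ) :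
    blockNorm χ s p (∑ i, (c i : ℂ) • T i) j ≤ ENNReal.ofReal C * ∑ i, blockNorm χ s p (T i) j := by
  refine (blockNorm_sum_smul_le χ s hp _ _ _ j).trans ?_
  rw [Finset.mul_sum]
  refine Finset.sum_le_sum fun i _ => ?_
  gcongr
  rw [← ofReal_norm, Complex.norm_real]
  exact ENNReal.ofReal_le_ofReal (hc i)

namespace Profile

variable (P : Profile n) {M K : ℕ}

lemma sum_indicator_wave_le (j : ℤ) :
    ∑ α : P.Ix K, (Icc (lev M K α.1 : ℤ) (lev M K α.1 + 5)).indicator (1 : ℤ → ℝ≥0∞) j ≤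
      2 * (Finset.Icc (M : ℤ) (M + (8 * (P.m * K) + 8) : ℕ) : Set ℤ).indicator 1 j := by
  rw [Fintype.sum_prod_type]
  simp only [Fintype.sum_bool, ← two_mul, ← Finset.mul_sum]
  gcongr
  exact sum_indicator_lev_le M K P.m j

/-- The size of the wave contribution. -/
def waveSize (K M : ℕ) (r σ : ℝ) : ℝ :=
  wt K * (8 * (P.m * K) + 9 : ℝ) ^ (1 / σ) * (2 : ℝ) ^ ((n / r - 1) * M)

variable {P} {χ : Rn n → ℝ} {r σ : ℝ} {Q : ℝ≥0∞} {M₀ : ℕ} {C : ℝ}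

lemma abs_cf_le (hC : ∀ t, |P.θ t| ≤ C ∧ ∀ i, |P.c i t| ≤ C ∧ |deriv (P.c i) t| ≤ C) (α : P.Ix K)
    (t : ℝ) : |P.cf K α t| ≤ wt K * C ∧ |deriv (P.cf K α) t| ≤ wt K * C := by
  have hd : deriv (P.cf K α) t = wt K * deriv (P.c α.1.1) t :=
    deriv_const_mul _ ((P.c_tf α.1.1).1.differentiable one_ne_zero t)
  rw [hd, cf, abs_mul, abs_mul, abs_of_nonneg (wt_nonneg K)]
  have := wt_nonneg K
  exact ⟨by gcongr; exact ((hC t).2 _).1, by gcongr; exact ((hC t).2 _).2⟩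

lemma eLpNorm_wave_le (hσ : 1 ≤ σ) {g : ℤ → ℝ≥0∞} (hg : ∀ j, g j ≤
      4 * (ENNReal.ofReal (wt K * C) * (Q * ENNReal.ofReal ((2 : ℝ) ^ ((n / r - 1) * M)))) *
      (Finset.Icc (M : ℤ) (M + (8 * (P.m * K) + 8) : ℕ) : Set ℤ).indicator 1 j) :
    eLpNorm g (ENNReal.ofReal σ) Measure.count ≤
      (4 * ENNReal.ofReal C * Q) * ENNReal.ofReal (P.waveSize K M r σ) := by
  refine (eLpNorm_mono_enorm hg).trans ((eLpNorm_indicator_Icc_le M _ hσ _).trans (le_of_eq ?_))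
  have := wt_nonneg K
  have e : ((8 * (P.m * K) + 8 : ℕ) + 1 : ℝ) = 8 * (P.m * K) + 9 := by push_cast; ring
  rw [e, waveSize, ENNReal.ofReal_mul (by positivity), ENNReal.ofReal_mul (by positivity),
    ENNReal.ofReal_mul (by positivity)]
  ring

lemma win_bound (B : BlockBounds P χ r Q M₀) (hr : 1 ≤ r) (hσ : 1 ≤ σ) (hM : M₀ ≤ M)
    (hC : ∀ t, |P.θ t| ≤ C ∧ ∀ i, |P.c i t| ≤ C ∧ |deriv (P.c i) t| ≤ C) :
    ∃ h : ℤ → ℝ≥0∞, (∀ t j, blockNorm χ (n / r - 1) (ENNReal.ofReal r)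
      (∑ α, (P.cf K α t : ℂ) • toDist (P.W M K α)) j ≤ h j) ∧
      eLpNorm h (ENNReal.ofReal σ) Measure.count ≤
        (4 * ENNReal.ofReal C * Q) * ENNReal.ofReal (P.waveSize K M r σ) := by
  refine ⟨_, fun t j => ?_, eLpNorm_wave_le hσ fun j => le_rfl⟩
  refine (blockNorm_sum_smul_le_const (by simpa using hr) (fun α => (abs_cf_le hC α t).1) _ j).trans ?_
  set q := Q * ENNReal.ofReal ((2 : ℝ) ^ ((n / r - 1) * M))
  calc _ ≤ ENNReal.ofReal (wt K * C) * ∑ α : P.Ix K, q *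
        (Icc (lev M K α.1 : ℤ) (lev M K α.1 + 5)).indicator 1 j := by
        gcongr with α
        exact B.wave M hM K α j
    _ = ENNReal.ofReal (wt K * C) * q * ∑ α : P.Ix K,
        (Icc (lev M K α.1 : ℤ) (lev M K α.1 + 5)).indicator 1 j := by
        rw [← Finset.mul_sum _ _ q, mul_assoc _ q]
    -- The sum over the two signs gives `2`; the larger `4` matches the force, which has two such
    -- sums.
    _ ≤ ENNReal.ofReal (wt K * C) * q * (4 *
        (Finset.Icc (M : ℤ) (M + (8 * (P.m * K) + 8) : ℕ) : Set ℤ).indicator 1 j) := by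
        gcongr
        refine (P.sum_indicator_wave_le j).trans ?_
        gcongr
        norm_num
    _ = _ := by ring

/-- The linear terms have the size of the waves. The remaining terms are counted crudely in `ℓ¹`,
with a number of terms depending on `K`, but gain `2 ^ (-M)`. Hence `K` can be fixed first and `M`
chosen afterwards. The envelope `h` is independent of time, as the Chemin–Lerner norm demands. -/
lemma force_bound (B : BlockBounds P χ r Q M₀) (hr : 1 ≤ r) (hσ : 1 ≤ σ) (hK : 1 ≤ K) (hM : M₀ ≤ M)
    (hC1 : 1 ≤ C) (hC : ∀ t, |P.θ t| ≤ C ∧ ∀ i, |P.c i t| ≤ C ∧ |deriv (P.c i) t| ≤ C) :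
    ∃ h : ℤ → ℝ≥0∞, (∀ t j, blockNorm χ (n / r - 3) (ENNReal.ofReal r)
      (toDist (P.force M K t)) j ≤ h j) ∧
      eLpNorm h (ENNReal.ofReal σ) Measure.count ≤
        (4 * ENNReal.ofReal C * Q) * ENNReal.ofReal (P.waveSize K M r σ) +
        (ENNReal.ofReal (4 * C ^ 2) * ((Fintype.card (P.Ix K) + Fintype.card (P.Ix K × P.Ix K) +
          Fintype.card (P.Ix K) : ℕ) * Q)) * ENNReal.ofReal (2⁻¹ ^ M) := by
  have hp : 1 ≤ ENNReal.ofReal r := by simpa using hr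
  have hw := wt_nonneg K
  have hw2 := wt_le_two hK
  have hC0 : 0 ≤ C := zero_le_one.trans hC1
  set s : ℝ := n / r - 3
  set p := ENNReal.ofReal r
  set q := Q * ENNReal.ofReal ((2 : ℝ) ^ ((n / r - 1) * M))
  set ind : ℤ → ℝ≥0∞ := (Finset.Icc (M : ℤ) (M + (8 * (P.m * K) + 8) : ℕ) : Set ℤ).indicator 1
  set lo : ℤ → ℝ≥0∞ := fun j => 4 * (ENNReal.ofReal (wt K * C) * q) * ind j
  set hi : ℤ → ℝ≥0∞ := fun j => ENNReal.ofReal (4 * C ^ 2) *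
    ((∑ α, blockNorm χ s p (toDist (P.crossField M α)) j +
      ∑ x : P.Ix K × P.Ix K, blockNorm χ s p (toDist (P.pairField M x)) j) +
      ∑ α : P.Ix K, ENNReal.ofReal (2⁻¹ ^ M) * blockNorm χ s p (toDist (P.selfField α.1.1)) j)
  refine ⟨fun j => lo j + hi j, fun t j => ?_, ?_⟩
  · have hcf := fun α => (abs_cf_le hC (K := K) α t)
    have hcf2 : ∀ α, |P.cf K α t| ≤ 2 * C := fun α =>
      (hcf α).1.trans (mul_le_mul_of_nonneg_right hw2 hC0)
    rw [P.force_expand hK]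
    refine (blockNorm_add_le χ s hp _ _ j).trans (add_le_add ?_ ?_)
    · have h1 : ∀ T : P.Ix K → Dist n, (∀ α, blockNorm χ s p (T α) j ≤
          q * (Icc (lev M K α.1 : ℤ) (lev M K α.1 + 5)).indicator 1 j) → ∀ c : P.Ix K → ℝ,
          (∀ α, |c α| ≤ wt K * C) → blockNorm χ s p (∑ α, (c α : ℂ) • T α) j ≤
            2 * (ENNReal.ofReal (wt K * C) * q) * ind j := fun T hT c hc => by
        refine (blockNorm_sum_smul_le_const hp hc _ j).trans ?_
        calc _ ≤ ENNReal.ofReal (wt K * C) * ∑ α : P.Ix K, q *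
              (Icc (lev M K α.1 : ℤ) (lev M K α.1 + 5)).indicator 1 j := by
              gcongr with α
              exact hT α
          _ = ENNReal.ofReal (wt K * C) * q * ∑ α : P.Ix K,
              (Icc (lev M K α.1 : ℤ) (lev M K α.1 + 5)).indicator 1 j := by
              rw [← Finset.mul_sum _ _ q, mul_assoc _ q]
          _ ≤ ENNReal.ofReal (wt K * C) * q * (2 * ind j) := by
              gcongr
              exact P.sum_indicator_wave_le j
          _ = _ := by ring
      refine (blockNorm_add_le χ s hp _ _ j).trans ((add_le_add
        (h1 _ (fun α => B.wave' M hM K α j) _ fun α => (hcf α).2)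
        (h1 _ (fun α => B.lap M hM K α j) _ fun α => by rw [abs_neg]; exact (hcf α).1)).trans
        (le_of_eq ?_))
      simp only [lo]
      ring
    · simp only [hi]
      rw [mul_add, mul_add]
      refine (blockNorm_add_le χ s hp _ _ j).trans (add_le_add
        ((blockNorm_add_le χ s hp _ _ j).trans (add_le_add ?_ ?_)) ?_)
      · refine blockNorm_sum_smul_le_const hp (fun α => ?_) _ j
        rw [abs_mul]
        calc _ ≤ C * (2 * C) := by gcongr; exacts [(hC t).1, hcf2 α]
          _ ≤ _ := by nlinarith
      · refine blockNorm_sum_smul_le_const hp (fun α => ?_) _ j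
        rw [abs_mul]
        calc _ ≤ (2 * C) * (2 * C) := by gcongr; exacts [hcf2 _, hcf2 _]
          _ = _ := by ring
      -- The squared inverse frequency is at most `2 ^ (-2M)`; one factor `2 ^ (-M)` is kept.
      · have hb : ∀ α : P.Ix K, |-((2 * Real.pi * P.lam M K α)⁻¹ * P.cf K α t) ^ 2| ≤
            4 * C ^ 2 * 2⁻¹ ^ M := fun α => by
          have hlam : (2 : ℝ) ^ M ≤ P.lam M K α :=
            pow_le_pow_right₀ one_le_two (by unfold lev; omega)
          have h2M : (1 : ℝ) ≤ 2 ^ M := one_le_pow₀ one_le_two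
          have hpi := Real.pi_gt_three
          have hinv : (2 * Real.pi * P.lam M K α)⁻¹ ≤ 2⁻¹ ^ M := by
            rw [inv_pow]
            refine inv_anti₀ (by positivity) ?_
            nlinarith
          have hinv0 : 0 ≤ (2 * Real.pi * P.lam M K α)⁻¹ :=
            inv_nonneg.2 (mul_nonneg (by positivity) (zero_le_one.trans (P.one_le_lam M K α)))
          have h1 : (2⁻¹ : ℝ) ^ M ≤ 1 := pow_le_one₀ (by norm_num) (by norm_num)
          rw [abs_neg, abs_pow, abs_mul, mul_pow, abs_of_nonneg hinv0]
          calc _ ≤ (2⁻¹ ^ M) ^ 2 * (2 * C) ^ 2 := by gcongr; exact hcf2 α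
            _ = 4 * C ^ 2 * (2⁻¹ ^ M * 2⁻¹ ^ M) := by ring
            _ ≤ _ := by
              gcongr
              exact mul_le_of_le_one_left (by positivity) h1
        refine (blockNorm_sum_smul_le_const hp hb _ j).trans (le_of_eq ?_)
        rw [ENNReal.ofReal_mul (by positivity), mul_assoc, Finset.mul_sum]
  · have e1 : eLpNorm lo (ENNReal.ofReal σ) Measure.count ≤ _ :=
      eLpNorm_wave_le hσ (Q := Q) (P := P) fun j => le_rfl
    have e2 : eLpNorm hi (ENNReal.ofReal σ) Measure.count ≤
        (ENNReal.ofReal (4 * C ^ 2) * ((Fintype.card (P.Ix K) + Fintype.card (P.Ix K × P.Ix K) +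
          Fintype.card (P.Ix K) : ℕ) * Q)) * ENNReal.ofReal (2⁻¹ ^ M) := by
      refine (eLpNorm_count_le_tsum _ hσ).trans ?_
      simp only [hi]
      rw [ENNReal.tsum_mul_left, ENNReal.tsum_add, ENNReal.tsum_add,
        Summable.tsum_finsetSum fun _ _ => ENNReal.summable,
        Summable.tsum_finsetSum fun _ _ => ENNReal.summable,
        Summable.tsum_finsetSum fun _ _ => ENNReal.summable]
      simp only [ENNReal.tsum_mul_left]
      have b1 := Finset.sum_le_sum fun (α : P.Ix K) (_ : α ∈ Finset.univ) => B.cross M hM K α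
      have b2 := Finset.sum_le_sum fun (α : P.Ix K × P.Ix K) (_ : α ∈ Finset.univ) => B.pair M hM K α
      have b3 := Finset.sum_le_sum fun (α : P.Ix K) (_ : α ∈ Finset.univ) =>
        mul_le_mul_right (B.self α.1.1) (ENNReal.ofReal (2⁻¹ ^ M))
      refine (mul_le_mul_right (add_le_add (add_le_add b1 b2) b3) _).trans (le_of_eq ?_)
      simp only [Finset.sum_const, Finset.card_univ, nsmul_eq_mul]
      push_cast
      ring
    exact (eLpNorm_add_le (f := lo) (g := hi) .of_discrete .of_discrete (by simpa using hσ)).trans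
      (add_le_add e1 e2)

lemma force_cont (B : BlockBounds P χ r Q M₀) (hQ : Q ≠ ⊤) (hr : 1 ≤ r) (hσ : 1 ≤ σ) (hK : 1 ≤ K)
    (hM : M₀ ≤ M) : BesovCont χ (n / r - 3) (ENNReal.ofReal r) (ENNReal.ofReal σ)
      (fun t => toDist (P.force M K t)) := by
  have hp : 1 ≤ ENNReal.ofReal r := by simpa using hr
  have hq : 1 ≤ ENNReal.ofReal σ := by simpa using hσ
  simp only [P.force_expand hK]
  have hθ := P.θ_tf.1.continuous
  have hc := fun α => (P.cf_contDiff (K := K) α).continuous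
  have hc' := fun α => (P.cf_contDiff (K := K) α).continuous_deriv le_rfl
  have hqt : Q * ENNReal.ofReal ((2 : ℝ) ^ ((n / r - 1) * M)) ≠ ⊤ := by finiteness
  have hqt' : Q * ENNReal.ofReal (2⁻¹ ^ M) < ⊤ := by finiteness
  have h1 := BesovCont.sum_smul hp hq hc' (F := fun α => toDist (P.W M K α)) fun α =>
    besovNorm_lt_top_of_indicator hσ hqt (B.wave' M hM K α)
  have h2 := BesovCont.sum_smul hp hq (fun α => (hc α).neg)
    (F := fun α => toDist (fun a => lapS (P.W M K α a))) fun α =>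
    besovNorm_lt_top_of_indicator hσ hqt (B.lap M hM K α)
  have h3 := BesovCont.sum_smul hp hq (fun α => hθ.mul (hc α))
    (F := fun α => toDist (P.crossField M α)) fun α =>
    besovNorm_lt_top_of_tsum hσ ((B.cross M hM K α).trans_lt hqt')
  have h4 := BesovCont.sum_smul hp hq (fun x : P.Ix K × P.Ix K => (hc x.1).mul (hc x.2))
    (F := fun x => toDist (P.pairField M x)) fun x =>
    besovNorm_lt_top_of_tsum hσ ((B.pair M hM K x).trans_lt hqt')
  have h5 := BesovCont.sum_smul hp hq (c := fun (α : P.Ix K) t =>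
      -((2 * Real.pi * P.lam M K α)⁻¹ * P.cf K α t) ^ 2)
    (fun α => ((continuous_const.mul (hc α)).pow 2).neg)
    (F := fun α : P.Ix K => toDist (P.selfField α.1.1)) fun α =>
    besovNorm_lt_top_of_tsum hσ ((B.self α.1.1).trans_lt hQ.lt_top)
  exact (h1.add hp hq h2).add hp hq ((h3.add hp hq h4).add hp hq h5)

lemma tsum_blockNorm_U_lt_top (P : Profile n) (hχ : IsLittlewoodPaley χ) (hn : 3 ≤ n) (hr : 2 ≤ r) :
    ∑' j, blockNorm χ (n / r - 1) (ENNReal.ofReal r) (toDist P.U) j < ⊤ := by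
  obtain ⟨A, hA, hb⟩ := P.U_low
  obtain ⟨R, -, hR⟩ := exists_common_spec fun a => (P.U_rbl a).2
  have hn3 : (3 : ℝ) ≤ n := by exact_mod_cast hn
  refine tsum_blockNorm_lt_top (A := A) (R := R) hχ hr ?_ hA hb fun a ξ h => by
    simpa using hR a ξ h
  have hr0 : r ≠ 0 := by linarith
  have : (n : ℝ) / r - 1 + 1 + n * (1 - 1 / r) = n := by field_simp; ring
  rw [this]
  linarith

lemma win_cont (B : BlockBounds P χ r Q M₀) (hχ : IsLittlewoodPaley χ) (hn : 3 ≤ n) (hQ : Q ≠ ⊤)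
    (hr : 2 ≤ r) (hσ : 1 ≤ σ) (hM : M₀ ≤ M) :
    BesovCont χ (n / r - 1) (ENNReal.ofReal r) (ENNReal.ofReal σ)
      (fun t => toDist (P.win M K t)) := by
  have hp : 1 ≤ ENNReal.ofReal r := by simpa using one_le_two.trans hr
  have hq : 1 ≤ ENNReal.ofReal σ := by simpa using hσ
  have hqt : Q * ENNReal.ofReal ((2 : ℝ) ^ ((n / r - 1) * M)) ≠ ⊤ := by finiteness
  simp only [P.win_expand]
  have h1 := BesovCont.sum_smul (χ := χ) (s := n / r - 1) hp hq (ι := Unit) (c := fun _ => P.θ)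
    (F := fun _ => toDist P.U) (fun _ => P.θ_tf.1.continuous) fun _ =>
      besovNorm_lt_top_of_tsum hσ (P.tsum_blockNorm_U_lt_top hχ hn hr)
  simp only [Finset.univ_unique, Finset.sum_singleton] at h1
  exact h1.add hp hq (BesovCont.sum_smul hp hq (fun α => (P.cf_contDiff (K := K) α).continuous)
    fun α => besovNorm_lt_top_of_indicator hσ hqt (B.wave M hM K α))

end Profile

/-! ### A lower bound at a fixed low frequency. -/

lemma exists_toDist_ne_zero {W : Fin n → Sch n} {k : Fin n} (h : W k ≠ 0) :
    ∃ φ : Sch n, toDist W φ ≠ 0 := by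
  let φ : Sch n := SchwartzMap.postcompCLM (𝕜 := ℝ) (Complex.conjCLE : ℂ →L[ℝ] ℂ) (W k)
  have hφ : ∀ x, φ x = (starRingEnd ℂ) (W k x) := fun x => rfl
  refine ⟨φ, fun h0 => h ?_⟩
  have h1 : toDist W φ k = ((∫ x, ‖W k x‖ ^ 2 : ℝ) : ℂ) := by
    rw [toDist_apply_apply, ← integral_complex_ofReal]
    refine integral_congr_ae (.of_forall fun x => ?_)
    simp only [hφ, Complex.conj_mul', Complex.ofReal_pow]
  have h2 : ∫ x, ‖W k x‖ ^ 2 = 0 := by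
    have h3 : ((∫ x, ‖W k x‖ ^ 2 : ℝ) : ℂ) = 0 := by rw [← h1, h0]; rfl
    exact_mod_cast h3
  have hint : Integrable (fun x => ‖W k x‖ ^ 2) := by
    have := (W k * W k).integrable.norm (μ := volume)
    exact this.congr (.of_forall fun x => by simp [pow_two])
  rw [integral_eq_zero_iff_of_nonneg (fun x => sq_nonneg _) hint] at h2
  have hc : Continuous (fun x => ‖W k x‖ ^ 2) := (W k).continuous.norm.pow 2
  have h4 := (hc.ae_eq_iff_eq volume (continuous_const (y := (0 : ℝ)))).1 h2
  ext x
  simpa using congrFun h4 x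

/-- `L¹`–`L^∞` duality for every representative, hence for the infimum. The added `1` keeps the
factor nonzero so that it can be divided out. -/
lemma enorm_apply_le_lpNorm_top (T : Dist n) (φ : Sch n) :
    ‖T φ‖ₑ ≤ lpNorm ⊤ T * ((∫⁻ x, ‖φ x‖ₑ) + 1) := by
  have hfin : (∫⁻ x, ‖φ x‖ₑ) + 1 ≠ ⊤ := by
    have : ∫⁻ x, ‖φ x‖ₑ < ⊤ := φ.integrable.2
    finiteness
  rw [← ENNReal.div_le_iff (by simp) hfin]
  refine le_iInf₂ fun g hg => ?_
  rw [ENNReal.div_le_iff (by simp) hfin, (hg.2 φ).2]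
  calc _ ≤ ∫⁻ x, ‖φ x • g x‖ₑ := enorm_integral_le_lintegral_enorm _
    _ ≤ ∫⁻ x, eLpNorm g ⊤ volume * ‖φ x‖ₑ := by
        rw [eLpNorm_exponent_top]
        refine lintegral_mono_ae ?_
        filter_upwards [enorm_ae_le_eLpNormEssSup g volume] with x hx
        rw [enorm_smul, mul_comm]
        gcongr
    _ = eLpNorm g ⊤ volume * ∫⁻ x, ‖φ x‖ₑ := lintegral_const_mul _ (by fun_prop)
    _ ≤ _ := by gcongr; exact le_self_add

lemma lpNorm_top_toDist_pos {W : Fin n → Sch n} {k : Fin n} (h : W k ≠ 0) :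
    0 < lpNorm ⊤ (toDist W) := by
  obtain ⟨φ, hφ⟩ := exists_toDist_ne_zero h
  refine pos_iff_ne_zero.2 fun h0 => hφ ?_
  have := enorm_apply_le_lpNorm_top (toDist W) φ
  simpa [h0] using this

namespace Profile

variable (P : Profile n) {χ : Rn n → ℝ}

/-- At a frequency where the transform of `U` is nonzero some symbol of the partition of unity is
nonzero too. The resulting lower bound depends on the profile alone, not on the waves. -/
lemma exists_block_pos (hχ : IsLittlewoodPaley χ) : ∃ j, 0 < lpNorm ⊤ (block χ j (toDist P.U)) := by
  obtain ⟨k, ξ, hξ, hU⟩ := P.U_ne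
  have hpi := Real.pi_ne_zero
  obtain ⟨j, hj⟩ : ∃ j, blockSymbol χ j ((2 * Real.pi) • ξ) ≠ 0 := by
    by_contra! h
    have h1 := hχ.sum_eq_one ((2 * Real.pi) • ξ) (by simp [hξ, hpi])
    have h2 : (fun j : ℤ => χ ((2 : ℝ) ^ (-j) • (2 * Real.pi) • ξ)) = fun _ => 0 := funext h
    rw [h2] at h1
    exact zero_ne_one (hasSum_zero.unique h1)
  refine ⟨j, ?_⟩
  rw [block_toDist hχ]
  refine lpNorm_top_toDist_pos (k := k) fun h0 => ?_
  have h1 := fourier_multS (isSymbol_blockSymbol hχ j) (P.U k) ξ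
  rw [h0, fourier_zero] at h1
  exact mul_ne_zero (by exact_mod_cast hj) hU h1.symm

/-- Low frequencies do not see the waves. -/
lemma exists_block_win (hχ : IsLittlewoodPaley χ) (j : ℤ) : ∃ M₀, ∀ M, M₀ ≤ M → ∀ K,
    block χ j (toDist (P.win M K (1 / 2))) = block χ j (toDist P.U) := by
  obtain ⟨S, C, R, hC, hR, hS, hU, hcamp, hwamp⟩ := P.exists_ampFamily
  -- The spectrum of a wave stays at distance at least `2 ^ M₀ - R` from the origin, beyond the
  -- annulus of the `j`-th block.
  obtain ⟨M₀, hM₀⟩ : ∃ M₀ : ℕ, R + (2 : ℝ) ^ (j : ℝ) < (2 : ℝ) ^ M₀ :=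
    pow_unbounded_of_one_lt _ one_lt_two
  refine ⟨M₀, fun M hM K => ?_⟩
  have hW : ∀ α : P.Ix K, block χ j (toDist (P.W M K α)) = 0 := fun α => by
    rw [block_toDist hχ, ← map_zero toDist]
    congr 1
    ext1 k
    refine sch_ext_fourier fun ξ => ?_
    rw [Pi.zero_apply, fourier_zero, fourier_multS (isSymbol_blockSymbol hχ j)]
    by_contra hne
    have h1 := W_spec hS (hwamp _ _ _ _ (P.one_le_lam M K α)) ξ (right_ne_zero_of_mul hne)
    have h2 := (annulus_norm_lt (mem_annulus_of_blockSymbol_ne_zero hχ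
      (Complex.ofReal_ne_zero.1 (left_ne_zero_of_mul hne)))).1
    have h3 := norm_sub_norm_le (P.mu M K α) ξ
    rw [norm_sub_rev, P.norm_mu] at h3
    have h4 : (2 : ℝ) ^ M₀ ≤ 2 ^ lev M K α.1 :=
      pow_le_pow_right₀ one_le_two (by unfold lev; omega)
    linarith
  rw [P.win_expand, P.θ_half]
  unfold block at hW ⊢
  rw [mult_add, mult_sum, Complex.ofReal_one]
  have h1 : (1 : ℂ) • toDist P.U = toDist P.U := one_smul _ _
  rw [h1, add_eq_left]
  refine Finset.sum_eq_zero fun α _ => ?_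
  rw [mult_smul, hW]
  exact smul_zero (M := ℂ) (A := Dist n) _

/-! ### The `L^{n,∞}` bound. -/

/-- The velocity as a real vector field. -/
def vel (M K : ℕ) (t : ℝ) (x : Rn n) : Rn n := WithLp.toLp 2 (fun a => (P.win M K t a x).re)

/-- The principal part is, for each `i`, a lacunary sum with `γ = wt K`, which exactly meets the
requirement `K γ² ≤ 2`. The correctors are `K` terms of size `2 ^ (-M)`, harmless because `K ≤ M < 2
^ M`. The bound is therefore independent of both parameters. -/
lemma eLpNorm_wave_sum_le (hn : 2 ≤ n) {C : ℝ} (hC1 : 1 ≤ C)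
    (hC : ∀ t, |P.θ t| ≤ C ∧ ∀ i, |P.c i t| ≤ C ∧ |deriv (P.c i) t| ≤ C) (a : Fin n) :
    ∃ D : ℝ≥0∞, D ≠ ⊤ ∧ ∃ M₀, ∀ M, M₀ ≤ M → ∀ K, 1 ≤ K → K ≤ M → ∀ t,
      eLpNorm (∑ α, (P.cf K α t : ℂ) • P.W M K α a : Sch n) (ENNReal.ofReal n) volume ≤ D := by
  choose R hR using fun i => (P.q_rbl i).2.mul (P.q_rbl i).2
  choose L hLt hL using fun i => eLpNorm_lacunary_le (P.q_rbl i).1 (hR i) (P.η i) hn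
  have hp1 : 1 ≤ ENNReal.ofReal (n : ℝ) := by simpa using one_le_two.trans hn
  obtain ⟨M₀, hM₀⟩ : ∃ M₀ : ℕ, ∑ i, |R i| < (2 : ℝ) ^ M₀ := pow_unbounded_of_one_lt _ one_lt_two
  have hRM : ∀ i, R i < 2 ^ M₀ := fun i => ((le_abs_self _).trans (Finset.single_le_sum
    (f := fun i => |R i|) (fun i _ => abs_nonneg _) (Finset.mem_univ i))).trans_lt hM₀
  set p := ENNReal.ofReal (n : ℝ)
  have hC0 : 0 ≤ C := zero_le_one.trans hC1
  refine ⟨∑ i, (ENNReal.ofReal (C * |P.d i a|) * L i +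
    ENNReal.ofReal (2 * C) * eLpNorm (P.corr i a) p volume), ?_, M₀, fun M hM K hK hKM t => ?_⟩
  · refine (ENNReal.sum_lt_top.2 fun i _ => ?_).ne
    have h1 := hLt i
    have h2 := SchwartzMap.eLpNorm_lt_top (P.corr i a) p volume
    finiteness
  have hw := wt_nonneg K
  have hw2 := wt_le_two hK
  set lam : Fin P.m → ℕ → ℝ := fun i k => (2 : ℝ) ^ (M + 2 + 8 * (k + K * i))
  set G : Fin P.m → Rn n → ℝ := fun i x => P.c i t * P.d i a * ((P.q i x).re * (wt K *
    ∑ k ∈ Finset.range K, Real.cos (2 * Real.pi * (lam i k * x (P.η i)))))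
  set H : Fin P.m → Rn n → ℝ := fun i x => (∑ k ∈ Finset.range K, wt K * P.c i t *
    ((2 * Real.pi * lam i k)⁻¹ * Real.sin (2 * Real.pi * (lam i k * x (P.η i))))) * (P.corr i a x).re
  have hGc : ∀ i, Continuous (G i) := fun i => by
    have := (P.q i).continuous
    simp only [G]
    fun_prop
  have hHc : ∀ i, Continuous (H i) := fun i => by
    have := (P.corr i a).continuous
    simp only [H]
    fun_prop
  have hGb : ∀ i, eLpNorm (G i) p volume ≤ ENNReal.ofReal (C * |P.d i a|) * L i := fun i => by
    have h1 := hL i (lam i) ((hRM i).trans_le (pow_le_pow_right₀ one_le_two (by omega)))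
      (fun k => by
        simp only [lam]
        rw [← pow_succ']
        exact pow_le_pow_right₀ one_le_two (by ring_nf; omega)) (wt K) K
      (by rw [wt_sq]; exact le_of_eq (mul_div_cancel₀ _ (by positivity)))
    refine (eLpNorm_le_mul_eLpNorm_of_ae_le_mul (c := C * |P.d i a|) (.of_forall fun x => ?_) p).trans
      (by gcongr)
    rw [norm_mul, norm_mul]
    gcongr
    · exact ((hC t).2 i).1
    · exact le_of_eq (Real.norm_eq_abs _)
  have hHb : ∀ i, eLpNorm (H i) p volume ≤ ENNReal.ofReal (2 * C) * eLpNorm (P.corr i a) p volume :=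
    fun i => by
      refine eLpNorm_le_mul_eLpNorm_of_ae_le_mul (.of_forall fun x => ?_) p
      rw [norm_mul]
      refine mul_le_mul ?_ (Complex.abs_re_le_norm _) (norm_nonneg _) (by positivity)
      have hterm : ∀ k ∈ Finset.range K, ‖wt K * P.c i t * ((2 * Real.pi * lam i k)⁻¹ *
          Real.sin (2 * Real.pi * (lam i k * x (P.η i))))‖ ≤ 2 * C * 2⁻¹ ^ M := fun k _ => by
        have hlam : (2 : ℝ) ^ M ≤ lam i k := pow_le_pow_right₀ one_le_two (by omega)
        have h2M : (1 : ℝ) ≤ 2 ^ M := one_le_pow₀ one_le_two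
        have hpi := Real.pi_gt_three
        have hinv : (2 * Real.pi * lam i k)⁻¹ ≤ 2⁻¹ ^ M := by
          rw [inv_pow]
          refine inv_anti₀ (by positivity) ?_
          nlinarith
        have hinv0 : 0 ≤ (2 * Real.pi * lam i k)⁻¹ :=
          inv_nonneg.2 (mul_nonneg (by positivity) (by linarith))
        rw [norm_mul, norm_mul, norm_mul, Real.norm_of_nonneg hw, Real.norm_of_nonneg hinv0]
        calc _ ≤ 2 * C * (2⁻¹ ^ M * 1) := by
              gcongr
              · exact ((hC t).2 i).1
              · exact Real.abs_sin_le_one _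
          _ = _ := by ring
      refine (norm_sum_le_of_le _ hterm).trans ?_
      rw [Finset.sum_const, Finset.card_range, nsmul_eq_mul]
      have hKM' : (K : ℝ) * 2⁻¹ ^ M ≤ 1 := by
        rw [inv_pow, ← div_eq_mul_inv, div_le_one (by positivity)]
        exact_mod_cast hKM.trans (Nat.lt_two_pow_self).le
      calc _ = 2 * C * (K * 2⁻¹ ^ M) := by ring
        _ ≤ 2 * C * 1 := by gcongr
        _ = _ := mul_one _
  calc _ ≤ eLpNorm (∑ i, (G i + H i)) p volume := by
        refine eLpNorm_mono fun x => le_of_eq ?_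
        rw [P.sum_W, Complex.norm_real, Fintype.sum_prod_type, Finset.sum_apply]
        congr 1
        refine Finset.sum_congr rfl fun i _ => ?_
        simp only [Pi.add_apply, G, H, Finset.mul_sum, Finset.sum_mul, ← Finset.sum_add_distrib,
          Finset.sum_range, lev, lam]
        exact Finset.sum_congr rfl fun k _ => by ring
    _ ≤ ∑ i, eLpNorm (G i + H i) p volume := eLpNorm_sum_le (fun i _ =>
        ((hGc i).add (hHc i)).aestronglyMeasurable) hp1
    _ ≤ _ := by
        refine Finset.sum_le_sum fun i _ => ?_
        exact (eLpNorm_add_le (hGc i).aestronglyMeasurable (hHc i).aestronglyMeasurable hp1).trans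
          (add_le_add (hGb i) (hHb i))

lemma exists_weakLpNorm_le (hn : 2 ≤ n) : ∃ D : ℝ≥0∞, D ≠ ⊤ ∧ ∃ M₀, ∀ M, M₀ ≤ M → ∀ K, 1 ≤ K →
    K ≤ M → ∀ t, weakLpNorm n (P.vel M K t) ≤ D := by
  obtain ⟨C, hC1, hC⟩ := P.exists_time_bound
  choose D hD M₀ hM₀ using P.eLpNorm_wave_sum_le hn hC1 hC
  have hp1 : 1 ≤ ENNReal.ofReal (n : ℝ) := by simpa using one_le_two.trans hn
  set p := ENNReal.ofReal (n : ℝ)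
  refine ⟨∑ a, (ENNReal.ofReal C * eLpNorm (P.U a) p volume + D a), ?_, ∑ a, M₀ a,
    fun M hM K hK hKM t => ?_⟩
  · refine (ENNReal.sum_lt_top.2 fun a _ => ?_).ne
    have h1 := hD a
    have h2 := SchwartzMap.eLpNorm_lt_top (P.U a) p volume
    finiteness
  have hvc : Continuous (P.vel M K t) := (PiLp.continuous_toLp 2 _).comp (continuous_pi fun a =>
    Complex.continuous_re.comp (P.win M K t a).continuous)
  refine (weakLpNorm_le_eLpNorm (by exact_mod_cast one_le_two.trans hn)
    hvc.aestronglyMeasurable).trans ?_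
  calc _ ≤ eLpNorm (vec (P.win M K t)) p volume := by
        refine eLpNorm_mono fun x => ?_
        rw [EuclideanSpace.norm_eq, EuclideanSpace.norm_eq]
        refine Real.sqrt_le_sqrt (Finset.sum_le_sum fun a _ => ?_)
        rw [vec_apply]
        gcongr
        exact Complex.abs_re_le_norm _
    _ ≤ ∑ a, eLpNorm (P.win M K t a) p volume := eLpNorm_vec_le _ hp1
    _ ≤ _ := by
        refine Finset.sum_le_sum fun a _ => ?_
        have h1 : M₀ a ≤ M := (Finset.single_le_sum (fun a _ => Nat.zero_le _)
          (Finset.mem_univ a)).trans hM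
        have h2 : eLpNorm ((P.θ t : ℂ) • P.U a : Sch n) p volume ≤
            ENNReal.ofReal C * eLpNorm (P.U a) p volume := by
          refine eLpNorm_le_mul_eLpNorm_of_ae_le_mul (.of_forall fun x => ?_) p
          rw [smul_apply, norm_smul, Complex.norm_real]
          gcongr
          exact (hC t).1
        have h3 := eLpNorm_add_le ((P.θ t : ℂ) • P.U a : Sch n).continuous.aestronglyMeasurable
          (∑ α, (P.cf K α t : ℂ) • P.W M K α a : Sch n).continuous.aestronglyMeasurable hp1
          (μ := volume)
        exact h3.trans (add_le_add h2 (hM₀ a M h1 K hK hKM t))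

end Profile

/-! ### Choice of the parameters of a window. -/

namespace Profile

variable (P : Profile n) {χ : Rn n → ℝ} {r σ : ℝ}

/-- If `n < r`, one wave suffices, since `2 ^ ((n/r - 1) M) → 0`. If `r = n`, frequency gives
nothing and smallness comes from `K ^ (1/σ - 1/2) → 0`, for every `M`. -/
lemma exists_waveSize_le (hn : 1 ≤ n)
    (h : ((n : ℝ) < r ∧ r < 2 * (n : ℝ) ∧ 1 ≤ σ) ∨ (r = (n : ℝ) ∧ 2 < σ)) {ε : ℝ} (hε : 0 < ε) :
    ∃ K, 1 ≤ K ∧ ∀ᶠ M in atTop, P.waveSize K M r σ ≤ ε := by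
  have hn0 : (0 : ℝ) < n := by exact_mod_cast hn
  rcases h with ⟨h1, -, -⟩ | ⟨rfl, h2⟩
  · refine ⟨1, le_rfl, ?_⟩
    have hlt : (2 : ℝ) ^ ((n : ℝ) / r - 1) < 1 :=
      Real.rpow_lt_one_of_one_lt_of_neg one_lt_two (by
        rw [sub_neg, div_lt_one (hn0.trans h1)]; exact h1)
    have hlim := (tendsto_pow_atTop_nhds_zero_of_lt_one (by positivity) hlt).const_mul
      (wt 1 * (8 * (P.m * (1 : ℕ)) + 9 : ℝ) ^ (1 / σ))
    rw [mul_zero] at hlim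
    filter_upwards [hlim.eventually (gt_mem_nhds hε)] with M hM
    rw [waveSize, Real.rpow_mul two_pos.le, Real.rpow_natCast]
    exact hM.le
  · have hσ : 0 < σ := by linarith
    have hexp : 0 < 1 / 2 - 1 / σ := sub_pos.2 (one_div_lt_one_div_of_lt two_pos h2)
    have hlim : Tendsto (fun K : ℕ => Real.sqrt 2 * (8 * P.m + 9 : ℝ) ^ (1 / σ) *
        (K : ℝ) ^ (-(1 / 2 - 1 / σ))) atTop (𝓝 0) := by
      have := ((tendsto_rpow_neg_atTop hexp).comp tendsto_natCast_atTop_atTop).const_mul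
        (Real.sqrt 2 * (8 * P.m + 9 : ℝ) ^ (1 / σ))
      rwa [mul_zero] at this
    obtain ⟨K, hK1, hK⟩ := ((eventually_ge_atTop 1).and (hlim.eventually (gt_mem_nhds hε))).exists
    refine ⟨K, hK1, .of_forall fun M => le_trans ?_ hK.le⟩
    have hKr : (1 : ℝ) ≤ K := by exact_mod_cast hK1
    rw [waveSize, div_self hn0.ne', sub_self, zero_mul, Real.rpow_zero, mul_one, wt,
      Real.sqrt_div two_pos.le, neg_sub, sub_eq_add_neg, Real.rpow_add (by linarith),
      Real.rpow_neg (by linarith), ← Real.sqrt_eq_rpow]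
    have h3 : (8 * (P.m * K) + 9 : ℝ) ^ (1 / σ) ≤ (8 * P.m + 9 : ℝ) ^ (1 / σ) * (K : ℝ) ^ (1 / σ) := by
      rw [← Real.mul_rpow (by positivity) (by positivity)]
      refine Real.rpow_le_rpow (by positivity) ?_ (by positivity)
      nlinarith
    calc _ ≤ Real.sqrt 2 / Real.sqrt K * ((8 * P.m + 9 : ℝ) ^ (1 / σ) * (K : ℝ) ^ (1 / σ)) := by
          gcongr
      _ = _ := by ring

/-- A time window whose force, and the waves in it, are of size at most `δ`. -/
structure IsWindow (χ : Rn n → ℝ) (r σ : ℝ) (D : ℝ≥0∞) (j₀ : ℤ) (δ : ℝ) (M K : ℕ) : Prop where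
  force_le : ∃ h : ℤ → ℝ≥0∞, (∀ t j, blockNorm χ (n / r - 3) (ENNReal.ofReal r)
    (toDist (P.force M K t)) j ≤ h j) ∧ eLpNorm h (ENNReal.ofReal σ) Measure.count ≤ ENNReal.ofReal δ
  wave_le : ∃ h : ℤ → ℝ≥0∞, (∀ t j, blockNorm χ (n / r - 1) (ENNReal.ofReal r)
    (∑ α, (P.cf K α t : ℂ) • toDist (P.W M K α)) j ≤ h j) ∧
      eLpNorm h (ENNReal.ofReal σ) Measure.count ≤ ENNReal.ofReal δ
  force_cont : BesovCont χ (n / r - 3) (ENNReal.ofReal r) (ENNReal.ofReal σ)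
    (fun t => toDist (P.force M K t))
  win_cont : BesovCont χ (n / r - 1) (ENNReal.ofReal r) (ENNReal.ofReal σ)
    (fun t => toDist (P.win M K t))
  weak : ∀ t, weakLpNorm n (P.vel M K t) ≤ D
  block : block χ j₀ (toDist (P.win M K (1 / 2))) = block χ j₀ (toDist P.U)

lemma ofReal_mul_le_of_le {X : ℝ≥0∞} (hX : X ≠ ⊤) {y δ : ℝ}
    (hy : y ≤ δ / (X.toReal + 1)) (hδ : 0 < δ) : X * ENNReal.ofReal y ≤ ENNReal.ofReal δ := by
  have h0 : 0 ≤ X.toReal := ENNReal.toReal_nonneg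
  rw [← ENNReal.ofReal_toReal hX, ← ENNReal.ofReal_mul h0]
  refine ENNReal.ofReal_le_ofReal ?_
  calc X.toReal * y ≤ X.toReal * (δ / (X.toReal + 1)) := by gcongr
    _ = δ * (X.toReal / (X.toReal + 1)) := by ring
    _ ≤ δ * 1 := by
        gcongr
        rw [div_le_one (by linarith)]
        linarith
    _ = δ := mul_one δ

/-- The constant `D` precedes `δ`, so that all windows share one `L^{n,∞}` bound. Given `δ`, the
number `K` of waves is fixed first, and then `M` is taken so large that the quadratic errors, whose
constant depends on `K`, are small too. -/
lemma exists_window (hχ : IsLittlewoodPaley χ) (hn : 3 ≤ n)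
    (h : ((n : ℝ) < r ∧ r < 2 * (n : ℝ) ∧ 1 ≤ σ) ∨ (r = (n : ℝ) ∧ 2 < σ)) (j₀ : ℤ) :
    ∃ D : ℝ≥0∞, D ≠ ⊤ ∧ ∀ δ : ℝ, 0 < δ → ∃ M K, P.IsWindow χ r σ D j₀ δ M K := by
  have hn3 : (3 : ℝ) ≤ n := by exact_mod_cast hn
  have hnr : (n : ℝ) ≤ r := by rcases h with ⟨h, -⟩ | ⟨h, -⟩ <;> linarith
  have hσ : 1 ≤ σ := by rcases h with ⟨-, -, h⟩ | ⟨-, h⟩ <;> linarith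
  obtain ⟨C, hC1, hC⟩ := P.exists_time_bound
  obtain ⟨Q, M₁, hQ, B⟩ := P.exists_blockBounds hχ hn hnr
  obtain ⟨M₂, hM₂⟩ := P.exists_block_win hχ j₀
  obtain ⟨D, hD, M₃, hM₃⟩ := P.exists_weakLpNorm_le (by omega)
  refine ⟨D, hD, fun δ hδ => ?_⟩
  obtain ⟨X, hX⟩ : ∃ X, X = 4 * ENNReal.ofReal C * Q := ⟨_, rfl⟩
  have hXt : X ≠ ⊤ := by rw [hX]; finiteness
  have hδ2 : 0 < δ / 2 := by linarith
  obtain ⟨K, hK, hKM⟩ := P.exists_waveSize_le (by omega) h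
    (show 0 < δ / 2 / (X.toReal + 1) from div_pos hδ2 (by positivity))
  obtain ⟨Y, hY⟩ : ∃ Y, Y = ENNReal.ofReal (4 * C ^ 2) * ((Fintype.card (P.Ix K) +
    Fintype.card (P.Ix K × P.Ix K) + Fintype.card (P.Ix K) : ℕ) * Q) := ⟨_, rfl⟩
  have hYt : Y ≠ ⊤ := by rw [hY]; finiteness
  have hlim : Tendsto (fun M : ℕ => (2⁻¹ : ℝ) ^ M) atTop (𝓝 0) :=
    tendsto_pow_atTop_nhds_zero_of_lt_one (by norm_num) (by norm_num)
  have hev := hlim.eventually (gt_mem_nhds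
    (show 0 < δ / 2 / (Y.toReal + 1) from div_pos hδ2 (by positivity)))
  obtain ⟨M, hM1, hM2, hM⟩ := (hKM.and (hev.and (eventually_ge_atTop (M₁ + M₂ + M₃ + K)))).exists
  have e1 := ofReal_mul_le_of_le hXt hM1 hδ2
  have e2 := ofReal_mul_le_of_le hYt hM2.le hδ2
  have hm1 : M₁ ≤ M := by omega
  refine ⟨M, K, ?_, ?_, force_cont B hQ (by linarith) hσ hK hm1,
    win_cont B hχ hn hQ (by linarith) hσ hm1, hM₃ M (by omega) K hK (by omega), hM₂ M (by omega) K⟩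
  · obtain ⟨g, hg, hg'⟩ := force_bound B (by linarith) hσ hK hm1 hC1 hC
    refine ⟨g, hg, hg'.trans ?_⟩
    rw [← hX, ← hY]
    refine (add_le_add e1 e2).trans (le_of_eq ?_)
    rw [← ENNReal.ofReal_add hδ2.le hδ2.le, add_halves]
  · obtain ⟨g, hg, hg'⟩ := win_bound B (by linarith) hσ hm1 hC
    refine ⟨g, hg, hg'.trans ?_⟩
    rw [← hX]
    exact e1.trans (ENNReal.ofReal_le_ofReal (by linarith))

end Profile

/-! ### Gluing windows in time. -/

/-- Concatenation in time of a sequence of functions living in the unit interval. -/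
def glue {X : Type*} (F : ℕ → ℝ → X) (t : ℝ) : X := F ⌊t⌋₊ (t - ⌊t⌋₊)

/-- Only the summand of the current window can be nonzero. Up to a given time gluing is thus a
finite sum, so continuity and Duhamel's formula can be proved window by window. Negative times,
where the floor is `0`, are included. -/
lemma glue_eq_sum {X : Type*} [AddCommMonoid X] {F : ℕ → ℝ → X}
    (hF : ∀ w, ∀ t ∉ Ioo (0 : ℝ) 1, F w t = 0) {t : ℝ} {N : ℕ} (ht : t < N) :
    glue F t = ∑ w ∈ Finset.range N, F w (t - w) := by
  have h0 : ∀ w : ℕ, w ≠ ⌊t⌋₊ → F w (t - w) = 0 := fun w hw => hF w _ fun h => hw <| by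
    obtain ⟨h1, h2⟩ := h
    exact ((Nat.floor_eq_iff (by have : (0 : ℝ) ≤ w := w.cast_nonneg; linarith)).2
      ⟨by linarith, by linarith⟩).symm
  by_cases hN : ⌊t⌋₊ < N
  · rw [Finset.sum_eq_single_of_mem ⌊t⌋₊ (Finset.mem_range.2 hN) fun w _ hw => h0 w hw]
    rfl
  · have ht0 : t ≤ 0 := by
      by_contra hcon
      push Not at hcon
      exact hN ((Nat.floor_lt hcon.le).2 ht)
    rw [Finset.sum_eq_zero fun w hw => h0 w fun h => hN (by rw [← h]; exact Finset.mem_range.1 hw)]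
    refine hF _ _ fun h => ?_
    rw [Nat.floor_of_nonpos ht0] at h
    have := h.1
    simp at this
    linarith

lemma glue_add_natCast {X : Type*} (F : ℕ → ℝ → X) (w : ℕ) {t : ℝ} (ht : t ∈ Ico (0 : ℝ) 1) :
    glue F (w + t) = F w t := by
  have : ⌊(w : ℝ) + t⌋₊ = w := by
    rw [Nat.floor_eq_iff (by have := ht.1; positivity)]
    exact ⟨by linarith [ht.1], by linarith [ht.2]⟩
  rw [glue, this]
  congr 1
  ring

lemma BesovCont.zero (χ : Rn n → ℝ) (s : ℝ) (p q : ℝ≥0∞) : BesovCont χ s p q fun _ => 0 := fun t₀ => by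
  simp [besovNorm_zero]

lemma BesovCont.comp_sub {χ : Rn n → ℝ} {s : ℝ} {p q : ℝ≥0∞} {g : ℝ → Dist n}
    (h : BesovCont χ s p q g) (a : ℝ) : BesovCont χ s p q fun t => g (t - a) := fun t₀ =>
  (h (t₀ - a)).comp ((continuous_sub_right a).tendsto t₀)

lemma BesovCont.glue {χ : Rn n → ℝ} {s : ℝ} {p q : ℝ≥0∞} (hp : 1 ≤ p) (hq : 1 ≤ q)
    {F : ℕ → ℝ → Dist n} (hF : ∀ w, ∀ t ∉ Ioo (0 : ℝ) 1, F w t = 0)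
    (h : ∀ w, BesovCont χ s p q (F w)) : BesovCont χ s p q (glue F) := by
  have hsum : ∀ N : ℕ, BesovCont χ s p q fun t => ∑ w ∈ Finset.range N, F w (t - w) := fun N => by
    induction N with
    | zero => simpa using BesovCont.zero χ s p q
    | succ N ih =>
      simp only [Finset.sum_range_succ]
      exact ih.add hp hq ((h N).comp_sub N)
  intro t₀
  obtain ⟨N, hN⟩ := exists_nat_gt t₀
  refine (hsum N t₀).congr' ?_
  filter_upwards [gt_mem_nhds hN] with t ht
  rw [glue_eq_sum hF hN, glue_eq_sum hF ht]

lemma cheminLernerNorm_le {χ : Rn n → ℝ} {I : Set ℝ} (hI : MeasurableSet I) {s : ℝ} {p q : ℝ≥0∞}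
    {f : ℝ → Dist n} {h : ℤ → ℝ≥0∞} (hf : ∀ t ∈ I, ∀ j, blockNorm χ s p (f t) j ≤ h j) :
    cheminLernerNorm χ ⊤ I s p q f ≤ eLpNorm h q Measure.count := by
  refine eLpNorm_mono_enorm fun j => ?_
  simp only [enorm_eq_self]
  have h0 : (2 : ℝ≥0∞) ^ (s * j) ≠ 0 := by simp
  have ht : (2 : ℝ≥0∞) ^ (s * j) ≠ ⊤ := by simp
  rw [mul_comm, ← ENNReal.le_div_iff_mul_le (.inl h0) (.inl ht), eLpNorm_exponent_top]
  refine essSup_le_of_ae_le _ ?_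
  filter_upwards [ae_restrict_mem hI] with t htI
  simp only [enorm_eq_self]
  rw [ENNReal.le_div_iff_mul_le (.inl h0) (.inl ht), mul_comm]
  exact hf t htI j

/-- The Chemin–Lerner norm takes the supremum in time inside each block. The `σ`-th power of a
supremum is at most the sum of the powers, so summable window sizes control it. -/
lemma eLpNorm_iSup_le {σ : ℝ} (hσ : 1 ≤ σ) (h : ℕ → ℤ → ℝ≥0∞) :
    eLpNorm (fun j => ⨆ w, h w j) (ENNReal.ofReal σ) Measure.count ≤
      ∑' w, eLpNorm (h w) (ENNReal.ofReal σ) Measure.count := by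
  have h0 : 0 < σ := by linarith
  have hcancel : ∀ x : ℝ≥0∞, (x ^ (1 / σ)) ^ σ = x := fun x => by
    rw [← ENNReal.rpow_mul, one_div_mul_cancel h0.ne', ENNReal.rpow_one]
  rw [eLpNorm_count_eq h0, one_div, ENNReal.rpow_inv_le_iff h0]
  have h1 : ∀ j, (⨆ w, h w j) ^ σ ≤ ∑' w, h w j ^ σ := fun j => by
    rw [← ENNReal.le_rpow_inv_iff h0]
    refine iSup_le fun w => ?_
    rw [ENNReal.le_rpow_inv_iff h0]
    exact ENNReal.le_tsum (f := fun w => h w j ^ σ) w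
  calc _ ≤ ∑' j, ∑' w, h w j ^ σ := ENNReal.tsum_le_tsum h1
    _ = ∑' w, ∑' j, h w j ^ σ := ENNReal.tsum_comm
    _ = ∑' w, eLpNorm (h w) (ENNReal.ofReal σ) Measure.count ^ σ := by
        simp only [eLpNorm_count_eq h0, hcancel]
    _ ≤ _ := tsum_rpow_le_rpow_tsum _ hσ

lemma blockNorm_le_besovNorm_top (χ : Rn n → ℝ) (s : ℝ) (p : ℝ≥0∞) (T : Dist n) (j : ℤ) :
    blockNorm χ s p T j ≤ besovNorm χ s p ⊤ T := by
  rw [besovNorm_eq, eLpNorm_exponent_top]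
  have := enorm_ae_le_eLpNormEssSup (blockNorm χ s p T) Measure.count
  rw [Measure.ae_count_iff] at this
  simpa using this j

/-! ### The glued field as a mild solution. -/

lemma isRealDist_toDist {W : Fin n → Sch n} (hW : ∀ k, IsRealS (W k)) : IsRealDist (toDist W) := by
  intro φ hφ k
  rw [toDist_apply_apply]
  have h1 : ∀ x, φ x * W k x = (((φ * W k) x).re : ℂ) := fun x =>
    Complex.ext (by simp) (by simp [hφ x, hW k x])
  simp only [h1]
  rw [integral_complex_ofReal, Complex.ofReal_im]

lemma integral_lineDeriv_mul (φ F : Sch n) (l : Fin n) :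
    ∫ x, (∂_{axis l} φ) x * F x = -∫ x, φ x * dS l F x := by
  have := SchwartzMap.integral_mul_lineDerivOp_right_eq_neg_left (μ := volume) φ F (axis l)
  rw [dS_eq, this, neg_neg]

lemma isSolenoidal_toDist {W : Fin n → Sch n} (hW : ∑ k, dS k (W k) = 0) :
    IsSolenoidal (toDist W) := by
  intro φ
  simp only [toDist_apply_apply, integral_lineDeriv_mul]
  rw [Finset.sum_neg_distrib, neg_eq_zero]
  have := pr_sum Finset.univ φ fun k => dS k (W k)
  rw [hW] at this
  refine this.symm.trans ?_
  simp [pr]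

lemma isDivTensor_convection {W : Fin n → Sch n} {v : Rn n → Rn n}
    (hv : ∀ k x, W k x = ((v x k : ℝ) : ℂ)) : IsDivTensor (toDist (convection W)) v := by
  have h1 : ∀ k l x, ((v x k * v x l : ℝ) : ℂ) = (W k * W l) x := fun k l x => by
    rw [mul_apply, hv, hv]; push_cast; rfl
  intro φ k
  simp only [h1]
  refine ⟨fun l => integrable_mul _ _, ?_⟩
  have e1 : toDist (convection W) φ k = ∑ l, ∫ x, φ x * dS l (W k * W l) x := by
    rw [toDist_apply_apply]
    exact pr_sum Finset.univ φ fun l => dS l (W k * W l)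
  rw [e1, ← Finset.sum_neg_distrib]
  refine Finset.sum_congr rfl fun l _ => ?_
  have := integral_lineDeriv_mul φ (W k * W l) l
  rw [← neg_eq_iff_eq_neg] at this
  rw [← this]
  simp only [mul_comm]

lemma lerayHeat_zero (χ : Rn n → ℝ) (j : ℤ) (t : ℝ) (φ : Sch n) : lerayHeat χ j t 0 φ = 0 := by
  ext k
  have h : ∀ m : Rn n → ℝ, mult m (0 : Dist n) = 0 := fun m => map_zero _
  simp only [lerayHeat, h]
  exact Finset.sum_eq_zero fun l _ => rfl

lemma lerayHeat_add (χ : Rn n → ℝ) (j : ℤ) (t : ℝ) (G G' : Dist n) (φ : Sch n) :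
    lerayHeat χ j t (G + G') φ = lerayHeat χ j t G φ + lerayHeat χ j t G' φ := by
  ext k
  simp only [lerayHeat, mult_add, PiLp.add_apply]
  rw [← Finset.sum_add_distrib]
  exact Finset.sum_congr rfl fun l _ => rfl

lemma lerayHeat_sum (χ : Rn n → ℝ) (j : ℤ) (t : ℝ) {ι : Type*} (s : Finset ι) (G : ι → Dist n)
    (φ : Sch n) : lerayHeat χ j t (∑ i ∈ s, G i) φ = ∑ i ∈ s, lerayHeat χ j t (G i) φ := by
  classical
  induction s using Finset.induction_on with
  | empty => simp [lerayHeat_zero]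
  | insert a s ha ih => rw [Finset.sum_insert ha, Finset.sum_insert ha, lerayHeat_add, ih]

lemma block_sum_apply (χ : Rn n → ℝ) (j : ℤ) {ι : Type*} (s : Finset ι) (T : ι → Dist n)
    (φ : Sch n) : block χ j (∑ i ∈ s, T i) φ = ∑ i ∈ s, block χ j (T i) φ := by
  classical
  unfold block
  rw [mult_sum]
  induction s using Finset.induction_on with
  | empty => rfl
  | insert a s ha ih =>
    rw [Finset.sum_insert ha, Finset.sum_insert ha, ← ih]
    rfl

namespace Profile

variable (P : Profile n) {χ : Rn n → ℝ}

/-- Force minus convection in a time window. -/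
def source (M K : ℕ) (t : ℝ) : Dist n :=
  toDist (P.force M K t) - toDist (convection (P.win M K t))

/-- Any starting time `a ≤ 0` is allowed because in the local time of window `w` the global initial
time is `-w`. -/
lemma win_duhamel (hχ : IsLittlewoodPaley χ) (M K : ℕ) (j : ℤ) (φ : Sch n) {a : ℝ} (ha : a ≤ 0)
    (t : ℝ) : IntervalIntegrable (fun τ => lerayHeat χ j (t - τ) (P.source M K τ) φ) volume a t ∧
      block χ j (toDist (P.win M K t)) φ = ∫ τ in a..t, lerayHeat χ j (t - τ) (P.source M K τ) φ := by
  have ha' : a ∉ Ioo (0 : ℝ) 1 := fun h => absurd h.1 ha.not_gt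
  have h := duhamel hχ (Finset.univ : Finset (Option (P.Ix K))) (fun o => o.elim P.θ (P.cf K))
    (fun o => o.elim P.U (P.W M K)) (fun τ => -P.ρ τ) (fun o _ => ?_) (fun o _ => ?_) j φ (a := a)
    (t := t) (fun o _ => ?_) (P.source M K) fun τ => ?_
  · refine ⟨h.1, h.2 ▸ ?_⟩
    congr 2
    congr 1
    ext1 k
    rw [Fintype.sum_option]
    rfl
  · cases o with
    | none => exact P.θ_tf.1
    | some α => exact P.cf_contDiff α
  · cases o with
    | none => exact P.U_div
    | some α => exact P.W_div α
  · cases o with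
    | none => exact P.θ_tf.2 a ha'
    | some α => exact P.cf_eq_zero α ha'
  · rw [source, ← map_sub]
    congr 1
    ext1 k
    exact P.force_sub_convection τ k

lemma source_eq_zero (M K : ℕ) {t : ℝ} (ht : t ∉ Ioo (0 : ℝ) 1) : P.source M K t = 0 := by
  rw [source, P.force_eq_zero ht, P.win_eq_zero ht, convection_zero, map_zero, sub_zero]

variable (M K : ℕ → ℕ)

/-- The glued velocity field. -/
def velocity : ℝ → Fin n → Sch n := glue fun w => P.win (M w) (K w)

/-- The glued force. -/
def totalForce : ℝ → Fin n → Sch n := glue fun w => P.force (M w) (K w)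

/-- At each time only one window is active, so the quadratic source of the glued field is the sum of
the individual sources. The formula is then the sum of the translated window formulas. -/
lemma velocity_duhamel (hχ : IsLittlewoodPaley χ) {t : ℝ} (ht : 0 ≤ t) (j : ℤ) (φ : Sch n) :
    IntervalIntegrable (fun τ => lerayHeat χ j (t - τ)
      (toDist (P.totalForce M K τ) - toDist (convection (P.velocity M K τ))) φ) volume 0 t ∧
      block χ j (toDist (P.velocity M K t)) φ = ∫ τ in (0 : ℝ)..t, lerayHeat χ j (t - τ)
        (toDist (P.totalForce M K τ) - toDist (convection (P.velocity M K τ))) φ := by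
  obtain ⟨N, hN⟩ := exists_nat_gt t
  have hG : ∀ τ ∈ uIcc 0 t, lerayHeat χ j (t - τ)
      (toDist (P.totalForce M K τ) - toDist (convection (P.velocity M K τ))) φ =
      ∑ w ∈ Finset.range N, lerayHeat χ j (t - τ) (P.source (M w) (K w) (τ - w)) φ := fun τ hτ => by
    rw [← lerayHeat_sum]
    congr 1
    rw [uIcc_of_le ht] at hτ
    exact glue_eq_sum (F := fun w => P.source (M w) (K w)) (fun w s hs => P.source_eq_zero _ _ hs)
      (hτ.2.trans_lt hN)
  have hw : ∀ w : ℕ, IntervalIntegrable (fun τ => lerayHeat χ j (t - τ)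
      (P.source (M w) (K w) (τ - w)) φ) volume 0 t ∧
      block χ j (toDist (P.win (M w) (K w) (t - w))) φ =
        ∫ τ in (0 : ℝ)..t, lerayHeat χ j (t - τ) (P.source (M w) (K w) (τ - w)) φ := fun w => by
    have h := P.win_duhamel hχ (M w) (K w) j φ (a := 0 - w) (by simp) (t - w)
    have e : ∀ τ : ℝ, t - w - (τ - w) = t - τ := fun τ => by ring
    constructor
    · have := h.1.comp_sub_right (w : ℝ)
      simpa only [e, sub_add_cancel] using this
    · rw [h.2, ← intervalIntegral.integral_comp_sub_right (fun τ => lerayHeat χ j (t - w - τ)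
        (P.source (M w) (K w) τ) φ) (w : ℝ)]
      simp only [e]
  constructor
  · have : IntervalIntegrable (fun τ => ∑ w ∈ Finset.range N, lerayHeat χ j (t - τ)
        (P.source (M w) (K w) (τ - w)) φ) volume 0 t := by
      have h := IntervalIntegrable.sum (Finset.range N) fun w _ => (hw w).1
      refine h.congr fun τ _ => ?_
      simp
    exact this.congr fun τ hτ => (hG τ (uIoc_subset_uIcc hτ)).symm
  · rw [intervalIntegral.integral_congr hG, intervalIntegral.integral_finsetSum fun w _ => (hw w).1]
    have : toDist (P.velocity M K t) = ∑ w ∈ Finset.range N, toDist (P.win (M w) (K w) (t - w)) :=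
      glue_eq_sum (F := fun w s => toDist (P.win (M w) (K w) s)) (fun w s hs => by
        rw [P.win_eq_zero hs, map_zero]) hN
    rw [this, block_sum_apply]
    exact Finset.sum_congr rfl fun w _ => (hw w).2

lemma velocity_isMildSolution (hχ : IsLittlewoodPaley χ) {D : ℝ≥0∞} (hD : D ≠ ⊤)
    (hv : ∀ w t, weakLpNorm n (P.vel (M w) (K w) t) ≤ D) :
    IsMildSolution χ 0 (fun t => toDist (P.totalForce M K t)) fun t => toDist (P.velocity M K t) := by
  have hvel : ∀ t k x, P.velocity M K t k x =
      ((glue (fun w => P.vel (M w) (K w)) t x k : ℝ) : ℂ) := fun t k x =>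
    Complex.ext rfl (P.win_real _ _ x)
  refine ⟨glue fun w => P.vel (M w) (K w), fun t => toDist (convection (P.velocity M K t)),
    fun t _ => ?_, ?_, fun t _ => isSolenoidal_toDist (P.win_div _),
    fun t _ => isDivTensor_convection (hvel t), fun t ht j φ => ?_⟩
  · have : (fun x => toComplex (glue (fun w => P.vel (M w) (K w)) t x)) = vec (P.velocity M K t) := by
      ext x k
      rw [vec_apply, hvel]
      rfl
    rw [this]
    exact isGivenBy_toDist _
  · exact (iSup₂_le fun t _ => hv _ _).trans_lt hD.lt_top
  · obtain ⟨h1, h2⟩ := P.velocity_duhamel M K hχ ht j φ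
    refine ⟨h1, h2.trans ?_⟩
    have : mult (heatSymbol χ j t) (0 : Dist n) φ = 0 := by
      have h0 : mult (heatSymbol χ j t) (0 : Dist n) = 0 := map_zero _
      rw [h0]
      rfl
    rw [this, zero_add]

end Profile

/-! ### Assembly of the global solution. -/

lemma tsum_halves {ε : ℝ} (hε : 0 < ε) : ∑' w : ℕ, ENNReal.ofReal (ε / 2 / 2 ^ w) = ENNReal.ofReal ε := by
  rw [← ENNReal.ofReal_tsum_of_nonneg (fun w => by positivity) (summable_geometric_two' ε),
    tsum_geometric_two']

lemma tendsto_halves_floor (ε : ℝ) :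
    Tendsto (fun t : ℝ => ENNReal.ofReal (ε / 2 / 2 ^ ⌊t⌋₊)) atTop (𝓝 0) := by
  have h1 : Tendsto (fun w : ℕ => ε / 2 / 2 ^ w) atTop (𝓝 0) := (summable_geometric_two' ε).tendsto_atTop_zero
  have h2 := ENNReal.tendsto_ofReal (h1.comp (tendsto_nat_floor_atTop (α := ℝ)))
  simpa using h2

lemma frequently_natCast_add {p : ℝ → Prop} {s : ℝ} (hs : 0 ≤ s) (h : ∀ w : ℕ, p (w + s)) :
    ∃ᶠ t in atTop, p t := by
  refine frequently_atTop.2 fun a => ⟨⌈a⌉₊ + s, ?_, h _⟩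
  have := Nat.le_ceil a
  linarith

lemma BesovCont.memCTilde {χ : Rn n → ℝ} {I : Set ℝ} (hI : MeasurableSet I) {s : ℝ} {p q : ℝ≥0∞}
    {f : ℝ → Dist n} (hf : BesovCont χ s p q f) {h : ℤ → ℝ≥0∞}
    (hb : ∀ t j, blockNorm χ s p (f t) j ≤ h j) (hh : eLpNorm h q Measure.count < ⊤) :
    MemCTilde χ I s p q f where
  mem t _ := (eLpNorm_mono_enorm (hb t)).trans_lt hh
  cont t₀ _ := (hf t₀).mono_left nhdsWithin_le_nhds
  bound := (cheminLernerNorm_le hI fun t _ j => hb t j).trans_lt hh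

namespace Profile

variable (P : Profile n) {χ : Rn n → ℝ} {r σ : ℝ}

lemma exists_solution (hχ : IsLittlewoodPaley χ) (hn : 3 ≤ n)
    (h : ((n : ℝ) < r ∧ r < 2 * (n : ℝ) ∧ 1 ≤ σ) ∨ (r = (n : ℝ) ∧ 2 < σ)) {D : ℝ≥0∞} (hD : D ≠ ⊤)
    {j₀ : ℤ} (hwin : ∀ δ : ℝ, 0 < δ → ∃ M K, P.IsWindow χ r σ D j₀ δ M K) {c₀ : ℝ≥0∞}
    (hc₀ : c₀ ≤ blockNorm χ (-1) ⊤ (toDist P.U) j₀) {ε : ℝ} (hε : 0 < ε) :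
    ∃ f : ℝ → Dist n,
      (∀ t, 0 < t → IsRealDist (f t)) ∧
      MemCTilde χ (Ioi 0) (n / r - 3) (ENNReal.ofReal r) (ENNReal.ofReal σ) f ∧
      cheminLernerNorm χ ⊤ (Ioi 0) (n / r - 3) (ENNReal.ofReal r) (ENNReal.ofReal σ) f ≤
        ENNReal.ofReal ε ∧
      Tendsto (fun t => besovNorm χ (n / r - 3) (ENNReal.ofReal r) (ENNReal.ofReal σ) (f t))
        atTop (𝓝 0) ∧
      ∃ u : ℝ → Dist n,
        IsMildSolution χ 0 f u ∧
        MemCTilde χ (Ici 0) (n / r - 1) (ENNReal.ofReal r) (ENNReal.ofReal σ) u ∧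
        c₀ ≤ limsup (fun t => besovNorm χ (-1) ⊤ ⊤ (u t)) atTop ∧
        liminf (fun t => besovNorm χ (n / r - 1) (ENNReal.ofReal r) (ENNReal.ofReal σ) (u t))
          atTop = 0 := by
  have hn3 : (3 : ℝ) ≤ n := by exact_mod_cast hn
  have hnr : (n : ℝ) ≤ r := by rcases h with ⟨h, -⟩ | ⟨h, -⟩ <;> linarith
  have hσ : 1 ≤ σ := by rcases h with ⟨-, -, h⟩ | ⟨-, h⟩ <;> linarith
  have hr2 : 2 ≤ r := by linarith
  have hp : 1 ≤ ENNReal.ofReal r := by simpa using one_le_two.trans hr2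
  have hq : 1 ≤ ENNReal.ofReal σ := by simpa using hσ
  -- The sizes `ε / 2 ^ (w + 1)` sum to `ε` and tend to `0`, giving both the smallness and the decay
  -- of the force.
  choose M K hMK using fun w : ℕ => hwin (ε / 2 / 2 ^ w) (by positivity)
  choose g hg hg' using fun w => (hMK w).force_le
  choose k hk hk' using fun w => (hMK w).wave_le
  obtain ⟨C, hC1, hC⟩ := P.exists_time_bound
  have hG : eLpNorm (fun j => ⨆ w, g w j) (ENNReal.ofReal σ) Measure.count ≤ ENNReal.ofReal ε :=
    (eLpNorm_iSup_le hσ g).trans ((ENNReal.tsum_le_tsum hg').trans (tsum_halves hε).le)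
  have hfb : ∀ t j, blockNorm χ (n / r - 3) (ENNReal.ofReal r) (toDist (P.totalForce M K t)) j ≤
      ⨆ w, g w j := fun t j => (hg _ _ j).trans (le_iSup (fun w => g w j) _)
  set u : ℝ → Dist n := fun t => toDist (P.velocity M K t)
  -- The profile is the same in every window and is counted once; only the waves require a supremum
  -- over windows.
  set ku : ℤ → ℝ≥0∞ := fun j => ENNReal.ofReal C *
    blockNorm χ (n / r - 1) (ENNReal.ofReal r) (toDist P.U) j + ⨆ w, k w j
  have hub : ∀ t j, blockNorm χ (n / r - 1) (ENNReal.ofReal r) (u t) j ≤ ku j := fun t j => by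
    have h1 : u t = _ := P.win_expand (M := M ⌊t⌋₊) (K := K ⌊t⌋₊) (t - ⌊t⌋₊)
    rw [h1]
    refine (blockNorm_add_le χ _ hp _ _ j).trans (add_le_add ?_
      ((hk _ _ j).trans (le_iSup (fun w => k w j) _)))
    have := blockNorm_sum_smul_le_const (χ := χ) (s := n / r - 1) hp (ι := Unit)
      (c := fun _ => P.θ (t - ⌊t⌋₊)) (fun _ => (hC _).1) (fun _ => toDist P.U) j
    simpa using this
  have hku : eLpNorm ku (ENNReal.ofReal σ) Measure.count < ⊤ := by
    refine (eLpNorm_add_le (f := fun j => ENNReal.ofReal C *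
      blockNorm χ (n / r - 1) (ENNReal.ofReal r) (toDist P.U) j) (g := fun j => ⨆ w, k w j)
      .of_discrete .of_discrete hq).trans_lt (ENNReal.add_lt_top.2 ⟨?_, ?_⟩)
    · refine (eLpNorm_count_le_tsum _ hσ).trans_lt ?_
      rw [ENNReal.tsum_mul_left]
      exact ENNReal.mul_lt_top ENNReal.ofReal_lt_top (P.tsum_blockNorm_U_lt_top hχ hn hr2)
    · exact ((eLpNorm_iSup_le hσ k).trans ((ENNReal.tsum_le_tsum hk').trans
        (tsum_halves hε).le)).trans_lt ENNReal.ofReal_lt_top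
  have hfc : BesovCont χ (n / r - 3) (ENNReal.ofReal r) (ENNReal.ofReal σ)
      fun t => toDist (P.totalForce M K t) :=
    BesovCont.glue hp hq (F := fun w t => toDist (P.force (M w) (K w) t))
      (fun w t ht => by rw [P.force_eq_zero ht, map_zero]) fun w => (hMK w).force_cont
  have huc : BesovCont χ (n / r - 1) (ENNReal.ofReal r) (ENNReal.ofReal σ) u :=
    BesovCont.glue hp hq (F := fun w t => toDist (P.win (M w) (K w) t))
      (fun w t ht => by rw [P.win_eq_zero ht, map_zero]) fun w => (hMK w).win_cont
  refine ⟨fun t => toDist (P.totalForce M K t), fun t _ => isRealDist_toDist (P.force_real _),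
    hfc.memCTilde measurableSet_Ioi hfb (hG.trans_lt ENNReal.ofReal_lt_top),
    (cheminLernerNorm_le measurableSet_Ioi fun t _ j => hfb t j).trans hG, ?_, u,
    P.velocity_isMildSolution M K hχ hD fun w t => (hMK w).weak t,
    huc.memCTilde measurableSet_Ici hub hku, ?_, ?_⟩
  · exact tendsto_of_tendsto_of_tendsto_of_le_of_le tendsto_const_nhds (tendsto_halves_floor ε)
      (fun t => zero_le) fun t => (eLpNorm_mono_enorm (hg _ _)).trans (hg' _)
  -- At the midpoints the block `j₀` of the velocity is that of `U`.
  · refine le_limsup_of_frequently_le' (frequently_natCast_add (s := 1 / 2) (by norm_num) fun w => ?_)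
    have h1 : u (w + 1 / 2) = toDist (P.win (M w) (K w) (1 / 2)) :=
      congrArg toDist (glue_add_natCast _ w ⟨by norm_num, by norm_num⟩)
    refine hc₀.trans (le_trans (le_of_eq ?_) (blockNorm_le_besovNorm_top χ (-1) ⊤ _ j₀))
    rw [h1, blockNorm, blockNorm, (hMK w).block]
  -- At integer times the velocity vanishes identically.
  · refine le_antisymm (liminf_le_of_frequently_le' (frequently_natCast_add (s := 0) le_rfl
      fun w => ?_)) zero_le
    have h1 : u (w + 0) = toDist (P.win (M w) (K w) 0) :=
      congrArg toDist (glue_add_natCast _ w ⟨le_rfl, one_pos⟩)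
    rw [h1, P.win_eq_zero (by simp), map_zero, besovNorm_zero]

end Profile

end ForcedNS

end

theorem theorem3p1 (n : ℕ) (hn : 3 ≤ n) (r σ : ℝ)
    (h : ((n : ℝ) < r ∧ r < 2 * (n : ℝ) ∧ 1 ≤ σ) ∨ (r = (n : ℝ) ∧ 2 < σ))
    (χ : ForcedNS.Rn n → ℝ) (hχ : ForcedNS.IsLittlewoodPaley χ) :
    ∃ ε₀ : ℝ, 0 < ε₀ ∧ ∃ c₀ : ℝ, 0 < c₀ ∧ ∀ ε : ℝ, 0 < ε → ε ≤ ε₀ →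
      ∃ f : ℝ → ForcedNS.Dist n,
        (∀ t, 0 < t → ForcedNS.IsRealDist (f t)) ∧
        ForcedNS.MemCTilde χ (Ioi 0) (n / r - 3) (ENNReal.ofReal r) (ENNReal.ofReal σ) f ∧
        ForcedNS.cheminLernerNorm χ ⊤ (Ioi 0) (n / r - 3) (ENNReal.ofReal r)
          (ENNReal.ofReal σ) f ≤ ENNReal.ofReal ε ∧
        Tendsto (fun t => ForcedNS.besovNorm χ (n / r - 3) (ENNReal.ofReal r)
          (ENNReal.ofReal σ) (f t)) atTop (𝓝 0) ∧
        ∃ u : ℝ → ForcedNS.Dist n,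
          ForcedNS.IsMildSolution χ 0 f u ∧
          ForcedNS.MemCTilde χ (Ici 0) (n / r - 1) (ENNReal.ofReal r) (ENNReal.ofReal σ) u ∧
          ENNReal.ofReal c₀ ≤
            limsup (fun t => ForcedNS.besovNorm χ (-1) ⊤ ⊤ (u t)) atTop ∧
          liminf (fun t => ForcedNS.besovNorm χ (n / r - 1) (ENNReal.ofReal r)
            (ENNReal.ofReal σ) (u t)) atTop = 0 := by
  obtain ⟨P⟩ := ForcedNS.exists_profile hn
  obtain ⟨j₀, hj₀⟩ := P.exists_block_pos hχ
  obtain ⟨D, hD, hwin⟩ := P.exists_window hχ hn h j₀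
  have hpos : 0 < ForcedNS.blockNorm χ (-1) ⊤ (ForcedNS.toDist P.U) j₀ :=
    ENNReal.mul_pos (by simp) hj₀.ne'
  obtain ⟨c₀, hc₀, hc₀le⟩ : ∃ c₀ : ℝ, 0 < c₀ ∧
      ENNReal.ofReal c₀ ≤ ForcedNS.blockNorm χ (-1) ⊤ (ForcedNS.toDist P.U) j₀ := by
    obtain ⟨c, hc, hc'⟩ := ENNReal.lt_iff_exists_nnreal_btwn.1 hpos
    exact ⟨c, by exact_mod_cast hc, by rw [ENNReal.ofReal_coe_nnreal]; exact hc'.le⟩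
  -- No threshold is needed: the construction works for every `ε > 0`, so `1` is an arbitrary
  -- choice.
  refine ⟨1, one_pos, c₀, hc₀, fun ε hε _ => ?_⟩
  exact P.exists_solution hχ hn h hD hwin hc₀le hε
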